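/- For an integer $k\ge 3$ let $\varphi_k$ be the morphism on $\{0,1,\dots,k-1\}^*$ given by $\varphi_k(i)=0\,(i+1)$ for $0\le i\le k-2$ and $\varphi_k(k-1)=0\,(k-1)\,(k-1)$. A finite word $w$ is rich if it has $|w|+1$ distinct palindromic factors (including the empty word), and a sequence is rich if all its factors are rich. The exponent of a non-empty word $z$ is $|z|/q$, where $q$ is the minimum length of a non-empty word $x$ such that $z$ is a prefix of $x^\omega=xxx\cdots$. For a sequence $\mathbf u$, the critical exponent $E(\mathbf u)\in[0,\infty]$ is the supremum of the exponents of its non-empty factors, and the asymptotic critical exponent $E^*(\mathbf u)$ is the limit, as $n\to\infty$, of the supremum of the exponents of its non-empty factors of length at least $n$. **Theorem.** Let $d\ge 3$ be an integer. The morphism $\varphi_{2d+1}$ has exactly one fixed point $\mathbf u_{2d+1}$ (an infinite sequence over $\{0,\dots,2d\}$), and the polynomial $t^{2d}(t-2)^2-1$ has a root $\Lambda\in(2,3)$ whose modulus is strictly larger than that of every other complex root. There are an alphabet $\mathcal B$ with exactly $d+2^d$ letters and a morphism $\pi:\{0,1,\dots,2d\}^*\to\mathcal B^*$ such that 1. with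 $h_i=1$ for $0\le i<d$ and $h_i=2^{i-d}$ for $d\le i\le 2d$, each $\pi(i)$ is a palindrome of length $h_i$ containing exactly $\lceil h_i/2\rceil$ distinct letters (the maximum possible), for $i\ne j$ the words $\pi(i)$ and $\pi(j)$ have no letter in common, and every letter of $\mathcal B$ occurs in some $\pi(i)$; 2. the sequence $\pi(\mathbf u_{2d+1})$ is rich; 3. $E\bigl(\pi(\mathbf u_{2d+1})\bigr)=E^*(\mathbf u_{2d+1})=1+\dfrac{1}{3-\Lambda}$. -/

import Mathlib

/-!  Words are lists, and sequences over `A` are functions `ℕ → A`. A morphism `A* → B*` is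
given by its letter images `ψ : A → List B`; its value on a word `w` is `w.flatMap ψ`. -/

namespace RichSeq

/-- The word `u_j u_{j+1} ⋯ u_{j+n-1}`. -/
def block {A : Type*} (u : ℕ → A) (j n : ℕ) : List A :=
  (List.range n).map fun i => u (j + i)

/-- `w` is a factor of the sequence `u`. -/
def IsFactor {A : Type*} (w : List A) (u : ℕ → A) : Prop :=
  ∃ j : ℕ, w = block u j w.length

/-- The sequence `v` is the infinite concatenation `ψ(u_0) ψ(u_1) ψ(u_2) ⋯`: all images of
prefixes of `u` are prefixes of `v`, and their lengths are unbounded. At most one `v` satisfies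
this. -/
def IsImage {A B : Type*} (ψ : A → List B) (u : ℕ → A) (v : ℕ → B) : Prop :=
  (∀ n : ℕ, (block u 0 n).flatMap ψ = block v 0 ((block u 0 n).flatMap ψ).length) ∧
    ∀ N : ℕ, ∃ n : ℕ, N ≤ ((block u 0 n).flatMap ψ).length

/-- `u` is a fixed point of the morphism `ψ`. -/
def IsFixedPoint {A : Type*} (ψ : A → List A) (u : ℕ → A) : Prop :=
  IsImage ψ u u

/-- A word `w` is rich if it has `|w| + 1` distinct palindromic factors, the empty word
included. -/
def RichWord {A : Type*} (w : List A) : Prop :=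
  {p : List A | p <:+: w ∧ p.Palindrome}.ncard = w.length + 1

/-- A sequence is rich if all of its factors are rich. -/
def Rich {A : Type*} (u : ℕ → A) : Prop :=
  ∀ w : List A, IsFactor w u → RichWord w

/-- `z` is a prefix of `x^ω = x x x ⋯`, where `x` is a non-empty word. -/
def IsPrefixOfPower {A : Type*} (z x : List A) : Prop :=
  x ≠ [] ∧ ∀ i : ℕ, i < z.length → z[i]? = x[i % x.length]?

/-- The minimum length of a non-empty word `x` such that `z` is a prefix of `x^ω`. -/
noncomputable def rootLength {A : Type*} (z : List A) : ℕ :=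
  sInf {q : ℕ | ∃ x : List A, IsPrefixOfPower z x ∧ x.length = q}

/-- The exponent of a non-empty word. -/
noncomputable def exponent {A : Type*} (z : List A) : ENNReal :=
  (z.length : ENNReal) / (rootLength z : ENNReal)

/-- The supremum of the exponents of the non-empty factors of `u` of length at least `n`. -/
noncomputable def expSup {A : Type*} (u : ℕ → A) (n : ℕ) : ENNReal :=
  ⨆ (z : List A) (_ : IsFactor z u ∧ z ≠ [] ∧ n ≤ z.length), exponent z

/-- The critical exponent `E(u)`, an element of `[0, ∞]`. -/
noncomputable def critExp {A : Type*} (u : ℕ → A) : ENNReal :=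
  expSup u 0

/-- The asymptotic critical exponent `E^*(u)`: the limit of the non-increasing sequence
`expSup u n`, which is its infimum. If `E(u) = ∞`, then every `expSup u n` is `∞` (words of
length less than `n` have exponents less than `n`), so `E^*(u) = ∞` as well. -/
noncomputable def asympCritExp {A : Type*} (u : ℕ → A) : ENNReal :=
  ⨅ n : ℕ, expSup u n

/-- The morphism `φ_k` on the letters `0, …, k-1`: `i ↦ 0 (i+1)` for `i < k - 1`, and
`k-1 ↦ 0 (k-1) (k-1)`. -/
def phi (k : ℕ) [NeZero k] (i : Fin k) : List (Fin k) :=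
  if h : (i : ℕ) + 1 < k then [0, ⟨(i : ℕ) + 1, h⟩] else [0, i, i]

/-- The vector `(1, …, 1, 2^0, 2^1, …, 2^d)` with `d` leading items `1`. -/
def weight (d : ℕ) (i : Fin (2 * d + 1)) : ℕ :=
  if (i : ℕ) < d then 1 else 2 ^ ((i : ℕ) - d)

/-- Weighted morphisms: `π(i)` is a palindrome of length `h_i` with the maximum number
`⌈h_i / 2⌉` of distinct letters, and distinct `i`, `j` have images without common letters. -/
structure IsWeighted {B : Type*} (d : ℕ) (π : Fin (2 * d + 1) → List B) : Prop where
  palindrome : ∀ i, (π i).Palindrome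
  length_eq : ∀ i, (π i).length = weight d i
  card_letters : ∀ i, {b : B | b ∈ π i}.ncard = (weight d i + 1) / 2
  disjoint : ∀ i j, i ≠ j → ∀ b, b ∈ π i → b ∉ π j

/-- `r` is the dominant root of the complex polynomial `p`: a root of modulus larger than that of
every other root. -/
def IsDominantRoot (p : Polynomial ℂ) (r : ℂ) : Prop :=
  p.IsRoot r ∧ ∀ z : ℂ, p.IsRoot z → z ≠ r → ‖z‖ < ‖r‖

end RichSeq

/-! Write e = 2d for the largest letter. Every image φ(i) starts with 0 and has no other 0, so the
zeros of the fixed point u mark the starts of images and every factor containing 0 can be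
desubstituted. Moreover φ(i)0 is a palindrome for every i, so w is a palindrome exactly when φ(w)0
is. Both halves of the theorem are inductions along desubstitution.

Richness. It suffices that each prefix has a palindromic suffix without an earlier occurrence
(`rich_of_unioccurrent`). For u this follows once complete return words of palindromes are
palindromes (`Subst.isPal_return`): a return of the longest palindromic suffix would give a longer
one. An occurrence of the desubstituted core need not lift to an occurrence of the original factor,
because the letters around it matter. The induction therefore treats returns among the occurrences
flanked by letters at least b, for all b at once. The code π has palindromic images with disjoint
letters, so the unioccurrent suffixes can be carried over, trimmed at both ends
(`Subst.coded_exists_unioccurrent`).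

Exponents. A repetition is a pair of positions i < j with equal factors of length r; its period is j
- i and its exponent is 1 + r / (j - i). The weights h make φ^n(e) as heavy as φ^(n+d)(0), so the
weights Z(n) of φ^n(0) satisfy Z(n+d+1) = 2 Z(n+d) + Z(n). The characteristic polynomial t^d (t-2) -
1 divides the polynomial of the theorem, and its root in (2,3) is Λ. The claim becomes: (3 - Λ)
times the weight of the overlap is at most the weight of the period.

Applying φ to a maximal repetition extends it by one 0 on the right. At either end, it also gains a
letter e whenever the two mismatching letters are e-1 and e, which recurs after 2d steps. These
future gains are `prefixSum` and `extLen`. With them added to the overlap, the bound is transported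
by desubstitution (`Subst.maximal_repetition_bound`) down to seeds whose overlap is empty or the
single letter e. The seeds need only inequalities between `excess` and Z. These hold because the
linear form `slack` satisfies slack(n+1) ≤ 3 slack(n) - 5/4 and yet grows at most linearly
(`slack_ge`). The images of ee show that the bound is sharp (`Subst.exists_long_repetition`).

Passing to π(u) turns weights into lengths. The new overlaps without the letter 0 are no longer than
their periods, so the bound covers all repetitions and gives E(π(u)). For E^*(u), lengths and
weights of long factors of u are nearly proportional (`Subst.exists_uniform_ratio`), so the same
constant appears. -/

namespace RichSeq

/-! ### Palindromic factors and richness -/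

section Words

variable {A B : Type*}

/-- The set of palindromic factors of a word. -/
def palFactors (w : List A) : Set (List A) :=
  {p : List A | p <:+: w ∧ p.Palindrome}

theorem palFactors_finite (w : List A) : (palFactors w).Finite := by
  refine (List.finite_toSet w.sublists).subset ?_
  rintro p ⟨hp, -⟩
  exact List.mem_sublists.2 hp.sublist

theorem palFactors_reverse (w : List A) : palFactors w.reverse = palFactors w := by
  ext p
  constructor
  · rintro ⟨h, hp⟩
    refine ⟨?_, hp⟩
    rw [← hp.reverse_eq] at h
    exact List.reverse_infix.1 h
  · rintro ⟨h, hp⟩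
    refine ⟨?_, hp⟩
    rw [← hp.reverse_eq]
    exact List.reverse_infix.2 h

/-- The shorter palindrome is a suffix of the longer one; reversal makes it a prefix as well, so it
also occurs before the last letter. -/
theorem infix_of_palindrome_suffix {w p q : List A} {a : A} (hp : p <:+ w ++ [a])
    (hq : q <:+ w ++ [a]) (pp : p.Palindrome) (pq : q.Palindrome) (h : p.length < q.length) :
    p <:+: w := by
  have h1 : p <:+ q := List.suffix_of_suffix_length_le hp hq h.le
  have h2 : p <+: q := by
    rw [← pp.reverse_eq, ← pq.reverse_eq]
    exact List.reverse_prefix.2 h1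
  obtain ⟨t, rfl⟩ := h2
  obtain ⟨s, hs⟩ := hq
  have ht : t ≠ [] := by
    rintro rfl
    simp at h
  obtain ⟨t', b, rfl⟩ := List.eq_nil_or_concat t |>.resolve_left ht
  have h3 : (s ++ p ++ t') ++ [b] = w ++ [a] := by simpa using hs
  have h4 := List.append_inj_left' h3 rfl
  exact ⟨s, t', h4⟩

/-- A new palindrome must be a suffix, and of two palindromic suffixes the shorter one has occurred
before, so at most one is new. -/
theorem ncard_palFactors_concat_le (w : List A) (a : A) :
    (palFactors (w ++ [a])).ncard ≤ (palFactors w).ncard + 1 := by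
  have hsub : palFactors w ⊆ palFactors (w ++ [a]) := fun p hp =>
    ⟨hp.1.trans (List.prefix_append _ _).isInfix, hp.2⟩
  have hss : (palFactors (w ++ [a]) \ palFactors w).Subsingleton := by
    have key : ∀ p ∈ palFactors (w ++ [a]) \ palFactors w, p <:+ w ++ [a] := by
      rintro p ⟨⟨h1, h2⟩, h3⟩
      rcases List.infix_concat_iff.1 h1 with h | h
      · exact h
      · exact absurd ⟨h, h2⟩ h3
    intro p hp q hq
    have kp := key p hp
    have kq := key q hq
    rcases lt_trichotomy p.length q.length with h | h | h
    · exact absurd ⟨infix_of_palindrome_suffix kp kq hp.1.2 hq.1.2 h, hp.1.2⟩ hp.2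
    · exact (List.suffix_of_suffix_length_le kp kq h.le).eq_of_length h
    · exact absurd ⟨infix_of_palindrome_suffix kq kp hq.1.2 hp.1.2 h, hq.1.2⟩ hq.2
  have h1 : (palFactors (w ++ [a]) \ palFactors w).ncard ≤ 1 :=
    (Set.ncard_le_one (hss.finite)).2 fun a ha b hb => hss ha hb
  have := Set.ncard_sdiff_add_ncard_of_subset hsub (palFactors_finite _)
  omega

theorem ncard_palFactors_cons_le (w : List A) (a : A) :
    (palFactors (a :: w)).ncard ≤ (palFactors w).ncard + 1 := by
  rw [← palFactors_reverse (a :: w), ← palFactors_reverse w, List.reverse_cons]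
  exact ncard_palFactors_concat_le _ _

theorem ncard_palFactors_append_le (x w : List A) :
    (palFactors (x ++ w)).ncard ≤ (palFactors w).ncard + x.length := by
  induction x with
  | nil => simp
  | cons a x ih =>
    have := ncard_palFactors_cons_le (x ++ w) a
    simp only [List.cons_append, List.length_cons]
    omega

theorem palFactors_nil : palFactors ([] : List A) = {[]} := by
  ext p
  constructor
  · rintro ⟨h, -⟩
    simpa using h
  · rintro rfl
    exact ⟨List.infix_rfl, .nil⟩

theorem ncard_palFactors_le (w : List A) : (palFactors w).ncard ≤ w.length + 1 := by
  have := ncard_palFactors_append_le w []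
  rw [palFactors_nil, Set.ncard_singleton, List.append_nil] at this
  omega

theorem ncard_palFactors_concat {w p : List A} {a : A} (hp : p <:+ w ++ [a]) (pp : p.Palindrome)
    (hn : ¬ p <:+: w) : (palFactors w).ncard + 1 ≤ (palFactors (w ++ [a])).ncard := by
  have hsub : insert p (palFactors w) ⊆ palFactors (w ++ [a]) := by
    rintro q (rfl | hq)
    · exact ⟨hp.isInfix, pp⟩
    · exact ⟨hq.1.trans (List.prefix_append _ _).isInfix, hq.2⟩
  rw [← Set.ncard_insert_of_notMem (fun h : p ∈ palFactors w => hn h.1) (palFactors_finite w)]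
  exact Set.ncard_le_ncard hsub (palFactors_finite _)

@[simp] theorem length_block (u : ℕ → A) (j n : ℕ) : (block u j n).length = n := by
  simp [block]

theorem getElem?_block (u : ℕ → A) (j n i : ℕ) (h : i < n) : (block u j n)[i]? = some (u (j + i)) := by
  simp [block, h]

@[simp] theorem getElem_block (u : ℕ → A) (j n i : ℕ) (h : i < (block u j n).length) :
    (block u j n)[i] = u (j + i) := by
  simp [block]

theorem block_add (u : ℕ → A) (j m n : ℕ) : block u j (m + n) = block u j m ++ block u (j + m) n := by
  simp [block, List.range_add, List.map_map, Function.comp_def, add_assoc]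

theorem block_succ (u : ℕ → A) (j n : ℕ) : block u j (n + 1) = block u j n ++ [u (j + n)] := by
  rw [block_add]
  simp [block]

theorem block_eq_block {u v : ℕ → A} {i j n : ℕ} (h : ∀ t < n, u (i + t) = v (j + t)) :
    block u i n = block v j n := by
  refine List.ext_getElem (by simp) fun t h1 h2 => ?_
  simpa using h t (by simpa using h1)

theorem palindrome_block {u : ℕ → A} {i n : ℕ}
    (h : ∀ t < n, u (i + t) = u (i + (n - 1 - t))) : (block u i n).Palindrome := by
  refine List.Palindrome.of_reverse_eq (List.ext_getElem (by simp) fun t h1 h2 => ?_)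
  have ht : t < n := by simpa using h2
  simp only [List.getElem_reverse, getElem_block, length_block]
  exact (h t ht).symm

theorem infix_block {u : ℕ → A} {i n N : ℕ} (h : block u i n <:+: block u 0 N) :
    ∃ i', i' + n ≤ N ∧ ∀ t < n, u (i' + t) = u (i + t) := by
  obtain ⟨s, t, h⟩ := h
  have hl := congrArg List.length h
  simp only [List.length_append, length_block] at hl
  refine ⟨s.length, by omega, fun r hr => ?_⟩
  have h1 := getElem?_block u 0 N (s.length + r) (by omega)
  rw [← h, List.append_assoc, List.getElem?_append_right (by omega),
    List.getElem?_append_left (by simp; omega), Nat.add_sub_cancel_left,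
    getElem?_block _ _ _ _ hr] at h1
  simpa using (Option.some_injective _ h1).symm

/-- If every prefix has a palindromic suffix that does not occur before, the sequence is rich. -/
theorem rich_of_unioccurrent {u : ℕ → A}
    (h : ∀ N, ∃ i ≤ N, (∀ t, i ≤ t → t ≤ N → u t = u (i + N - t)) ∧
      ∀ i' < i, ¬ ∀ t ≤ N - i, u (i' + t) = u (i + t)) : Rich u := by
  have hpre : ∀ N, N + 1 ≤ (palFactors (block u 0 N)).ncard := by
    intro N
    induction N with
    | zero => simp [block, palFactors_nil]
    | succ N ih =>
      obtain ⟨i, hi, hpal, hno⟩ := h N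
      have key := ncard_palFactors_concat (w := block u 0 N) (a := u (0 + N))
        (p := block u i (N + 1 - i)) ?_ ?_ ?_
      · rw [block_succ]
        omega
      · rw [← block_succ]
        refine ⟨block u 0 i, ?_⟩
        have := block_add u 0 i (N + 1 - i)
        rw [show i + (N + 1 - i) = N + 1 by omega, zero_add] at this
        exact this.symm
      · refine palindrome_block fun t ht => ?_
        rw [hpal (i + t) (by omega) (by omega)]
        congr 1
        omega
      · intro hin
        obtain ⟨i', h1, h2⟩ := infix_block hin
        exact hno i' (by omega) fun t ht => h2 t (by omega)
  -- Prefixes attain the maximal number of palindromes. Cutting off the first `j` letters loses at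
  -- most `j` of them, so the factor attains its maximum too.
  rintro w ⟨j, hw⟩
  have h1 := hpre (j + w.length)
  rw [block_add, zero_add, ← hw] at h1
  have h2 := ncard_palFactors_append_le (block u 0 j) w
  have h3 := ncard_palFactors_le w
  rw [length_block] at h2
  show (palFactors w).ncard = w.length + 1
  omega

end Words

/-! ### Infinite images under a morphism -/

section Images

variable {A B : Type*}

/-- The position at which the image of the letter number `n` starts. -/
def imagePos (ψ : A → List B) (u : ℕ → A) (n : ℕ) : ℕ :=
  ((block u 0 n).flatMap ψ).length

theorem imagePos_zero (ψ : A → List B) (u : ℕ → A) : imagePos ψ u 0 = 0 := by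
  simp [imagePos, block]

theorem flatMap_block_succ (ψ : A → List B) (u : ℕ → A) (n : ℕ) :
    (block u 0 (n + 1)).flatMap ψ = (block u 0 n).flatMap ψ ++ ψ (u n) := by
  simp [block_succ]

theorem imagePos_succ (ψ : A → List B) (u : ℕ → A) (n : ℕ) :
    imagePos ψ u (n + 1) = imagePos ψ u n + (ψ (u n)).length := by
  simp [imagePos, flatMap_block_succ]

theorem IsImage.apply {ψ : A → List B} {u : ℕ → A} {v : ℕ → B} (h : IsImage ψ u v) (n t : ℕ)
    (ht : t < (ψ (u n)).length) : (ψ (u n))[t]? = some (v (imagePos ψ u n + t)) := by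
  have h1 := h.1 (n + 1)
  have h2 := getElem?_block v 0 (imagePos ψ u (n + 1)) (imagePos ψ u n + t)
    (by rw [imagePos_succ]; omega)
  change _ = block v 0 (imagePos ψ u (n + 1)) at h1
  rw [← h1, flatMap_block_succ, List.getElem?_append_right (by simp [imagePos])] at h2
  simpa [imagePos] using h2

theorem le_imagePos {ψ : A → List B} (u : ℕ → A) (hne : ∀ a, ψ a ≠ []) (n : ℕ) :
    n ≤ imagePos ψ u n := by
  induction n with
  | zero => simp
  | succ n ih =>
    rw [imagePos_succ]
    have := List.length_pos_iff.2 (hne (u n))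
    omega

theorem isImage_of_apply {ψ : A → List B} {u : ℕ → A} {v : ℕ → B} (hne : ∀ a, ψ a ≠ [])
    (h : ∀ n t, t < (ψ (u n)).length → (ψ (u n))[t]? = some (v (imagePos ψ u n + t))) :
    IsImage ψ u v := by
  refine ⟨fun n => ?_, fun N => ⟨N, ?_⟩⟩
  · change _ = block v 0 (imagePos ψ u n)
    induction n with
    | zero => simp [block, imagePos]
    | succ n ih =>
      rw [flatMap_block_succ, imagePos_succ, block_add, ih, zero_add]
      congr 1
      refine List.ext_getElem? fun t => ?_
      by_cases ht : t < (ψ (u n)).length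
      · rw [h n t ht, getElem?_block _ _ _ _ ht]
      · rw [List.getElem?_eq_none (by omega), List.getElem?_eq_none (by simp; omega)]
  · exact le_imagePos u hne N

theorem exists_image [Inhabited B] {ψ : A → List B} (u : ℕ → A) (hne : ∀ a, ψ a ≠ []) :
    ∃ v, IsImage ψ u v := by
  have hpre : ∀ m n, m ≤ n → (block u 0 m).flatMap ψ <+: (block u 0 n).flatMap ψ := by
    intro m n hmn
    obtain ⟨k, rfl⟩ := Nat.exists_eq_add_of_le hmn
    rw [block_add, List.flatMap_append]
    exact List.prefix_append _ _
  refine ⟨fun p => (((block u 0 (p + 1)).flatMap ψ)[p]?).getD default, isImage_of_apply hne ?_⟩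
  intro n t ht
  set p := imagePos ψ u n + t with hp
  have h1 : ((block u 0 (n + 1)).flatMap ψ)[p]? = (ψ (u n))[t]? := by
    rw [flatMap_block_succ, List.getElem?_append_right (by simp [hp, imagePos])]
    simp [hp, imagePos]
  have hpn : n ≤ p := le_trans (le_imagePos u hne n) (by omega)
  have h2 : ((block u 0 (p + 1)).flatMap ψ)[p]? = ((block u 0 (n + 1)).flatMap ψ)[p]? := by
    obtain ⟨z, hz⟩ := hpre (n + 1) (p + 1) (by omega)
    rw [← hz, List.getElem?_append_left]
    change p < imagePos ψ u (n + 1)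
    rw [imagePos_succ]
    omega
  show _ = some ((((block u 0 (p + 1)).flatMap ψ)[p]?).getD default)
  rw [h2, h1, List.getElem?_eq_getElem ht]
  rfl

end Images

/-! ### Desubstitution of factors and palindromes -/

/-- Numerical form of a fixed point `U` of the morphism with the largest letter `e`: the image of
the letter number `n` starts at the position `s n`. -/
structure Subst (e : ℕ) (U s : ℕ → ℕ) : Prop where
  two_le : 2 ≤ e
  pos_zero : s 0 = 0
  pos_succ : ∀ n, s (n + 1) = s n + if U n = e then 3 else 2
  at_pos : ∀ n, U (s n) = 0
  at_succ : ∀ n, U (s n + 1) = min (U n + 1) e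
  at_two : ∀ n, U n = e → U (s n + 2) = e
  le : ∀ n, U n ≤ e

/-- The factor of `U` at the positions `i ≤ t < j` is a palindrome. -/
def IsPal (U : ℕ → ℕ) (i j : ℕ) : Prop :=
  ∀ t, i ≤ t → t < j → U t = U (i + j - 1 - t)

/-- The factors of length `r` at the positions `i` and `j` coincide. -/
def Agree (U : ℕ → ℕ) (i j r : ℕ) : Prop :=
  ∀ t < r, U (i + t) = U (j + t)

/-- Equal palindromes at the two ends mirror each other, so their outer `f` letters match; the rest
is the inner palindrome. The two occurrences may overlap. -/
theorem IsPal.extend {U : ℕ → ℕ} {i j r f : ℕ} (h : IsPal U (i + f) (j + r - f))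
    (hw : IsPal U i (i + r)) (ha : Agree U i j r) (hf : f ≤ r) (hij : i < j) :
    IsPal U i (j + r) := by
  have key : ∀ t < f, U (i + t) = U (j + r - 1 - t) := by
    intro t ht
    rw [hw (i + t) (by omega) (by omega), show i + (i + r) - 1 - (i + t) = i + (r - 1 - t) by omega,
      ha _ (by omega), show j + (r - 1 - t) = j + r - 1 - t by omega]
  intro t h1 h2
  by_cases h3 : t < i + f
  · have := key (t - i) (by omega)
    rw [show i + (t - i) = t by omega] at this
    rw [this]
    congr 1
    omega
  by_cases h4 : t < j + r - f
  · rw [h t (by omega) h4]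
    congr 1
    omega
  · have := key (j + r - 1 - t) (by omega)
    rw [show j + r - 1 - (j + r - 1 - t) = t by omega] at this
    rw [← this]
    congr 1
    omega

namespace Subst

variable {e : ℕ} {U s : ℕ → ℕ} (S : Subst e U s)
include S

theorem pos_succ_top {n : ℕ} (h : U n = e) : s (n + 1) = s n + 3 := by
  rw [S.pos_succ, if_pos h]

theorem pos_succ_ne {n : ℕ} (h : U n ≠ e) : s (n + 1) = s n + 2 := by
  rw [S.pos_succ, if_neg h]

theorem pos_succ_cases (n : ℕ) :
    (U n = e ∧ s (n + 1) = s n + 3) ∨ (U n < e ∧ s (n + 1) = s n + 2) := by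
  have := S.le n
  by_cases h : U n = e
  · exact .inl ⟨h, S.pos_succ_top h⟩
  · exact .inr ⟨by omega, S.pos_succ_ne h⟩

theorem strictMono : StrictMono s :=
  strictMono_nat_of_lt_succ fun n => by
    rcases S.pos_succ_cases n with h | h <;> omega

theorem lt_iff {m n : ℕ} : s m < s n ↔ m < n := S.strictMono.lt_iff_lt

theorem le_iff {m n : ℕ} : s m ≤ s n ↔ m ≤ n := S.strictMono.le_iff_le

theorem inj {m n : ℕ} (h : s m = s n) : m = n := S.strictMono.injective h

theorem add_two_le (m r : ℕ) : s m + 2 * r ≤ s (m + r) := by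
  induction r with
  | zero => simp
  | succ r ih =>
    rcases S.pos_succ_cases (m + r) with h | h <;> rw [← add_assoc] <;> omega

theorem cases_pos (p : ℕ) :
    ∃ n, p = s n ∨ p = s n + 1 ∨ (p = s n + 2 ∧ U n = e) := by
  induction p with
  | zero => exact ⟨0, .inl S.pos_zero.symm⟩
  | succ p ih =>
    obtain ⟨n, h⟩ := ih
    rcases S.pos_succ_cases n with ⟨h1, h2⟩ | ⟨h1, h2⟩
    · rcases h with h | h | h
      · exact ⟨n, by omega⟩
      · exact ⟨n, by omega⟩
      · exact ⟨n + 1, by omega⟩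
    · rcases h with h | h | h
      · exact ⟨n, by omega⟩
      · exact ⟨n + 1, by omega⟩
      · omega

theorem at_succ_pos (n : ℕ) : 1 ≤ U (s n + 1) := by
  have := S.at_succ n
  have := S.two_le
  omega

theorem exists_pos_of_eq_zero {p : ℕ} (h : U p = 0) : ∃ n, p = s n := by
  obtain ⟨n, rfl | rfl | ⟨rfl, h1⟩⟩ := S.cases_pos p
  · exact ⟨n, rfl⟩
  · have := S.at_succ_pos n
    omega
  · have := S.at_two n h1
    have := S.two_le
    omega

theorem at_last (n : ℕ) : U (s (n + 1) - 1) = min (U n + 1) e := by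
  rcases S.pos_succ_cases n with ⟨h1, h2⟩ | ⟨h1, h2⟩
  · rw [h2, show s n + 3 - 1 = s n + 2 by omega, S.at_two n h1]
    omega
  · rw [h2, show s n + 2 - 1 = s n + 1 by omega, S.at_succ n]

theorem at_two_eq_zero {n : ℕ} (h : U n < e) : U (s n + 2) = 0 := by
  rw [← S.pos_succ_ne (by omega)]
  exact S.at_pos _

/-- Nonzero letters are adjacent only inside φ(e) = 0ee. In particular three of them never follow
each other. -/
theorem top_of_two_nonzero {p : ℕ} (h1 : U p ≠ 0) (h2 : U (p + 1) ≠ 0) :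
    ∃ n, p = s n + 1 ∧ U n = e ∧ U p = e ∧ U (p + 1) = e ∧ p + 2 = s (n + 1) := by
  obtain ⟨n, rfl | rfl | ⟨rfl, h3⟩⟩ := S.cases_pos p
  · exact absurd (S.at_pos n) h1
  · rcases S.pos_succ_cases n with ⟨h4, h5⟩ | ⟨h4, h5⟩
    · refine ⟨n, rfl, h4, ?_, S.at_two n h4, by omega⟩
      rw [S.at_succ, h4]
      omega
    · exact absurd (S.at_two_eq_zero h4) h2
  · rw [show s n + 2 + 1 = s (n + 1) by rw [S.pos_succ_top h3]] at h2
    exact absurd (S.at_pos _) h2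

theorem nonzero_cases {p : ℕ} (h : U p ≠ 0) : ∃ n, U p = min (U n + 1) e ∧
    ((p = s n + 1) ∨ (p = s n + 2 ∧ U n = e)) := by
  obtain ⟨n, rfl | rfl | ⟨rfl, h3⟩⟩ := S.cases_pos p
  · exact absurd (S.at_pos n) h
  · exact ⟨n, S.at_succ n, .inl rfl⟩
  · refine ⟨n, ?_, .inr ⟨rfl, h3⟩⟩
    rw [S.at_two n h3]
    omega

/-- The second letter of the image determines the letter except for e-1 and e. The third letter,
which is 0 after 0e and e inside 0ee, separates these two. -/
theorem letter_eq_of_image {m n : ℕ} (h1 : U (s m + 1) = U (s n + 1))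
    (h2 : U (s m + 2) = U (s n + 2)) : U m = U n := by
  have := S.two_le
  rw [S.at_succ, S.at_succ] at h1
  rcases S.pos_succ_cases m with ⟨h3, -⟩ | ⟨h3, -⟩ <;>
    rcases S.pos_succ_cases n with ⟨h4, -⟩ | ⟨h4, -⟩
  · omega
  · rw [S.at_two m h3, S.at_two_eq_zero h4] at h2
    omega
  · rw [S.at_two n h4, S.at_two_eq_zero h3] at h2
    omega
  · omega

theorem pos_congr {m n : ℕ} (h : U m = U n) : s (m + 1) + s n = s (n + 1) + s m := by
  rw [S.pos_succ, S.pos_succ, h]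
  omega

theorem agree_pos {m n r : ℕ} (h : Agree U m n r) {t : ℕ} (ht : t ≤ r) :
    s (m + t) + s n = s (n + t) + s m := by
  induction t with
  | zero => simp only [add_zero]; omega
  | succ t ih =>
    have h1 := ih (by omega)
    have h2 := S.pos_congr (h t (by omega))
    rw [← add_assoc, ← add_assoc]
    omega

/-- The additional position is the 0 with which the next image starts, whatever the next letter is.
-/
theorem agree_image {m n r : ℕ} (h : Agree U m n r) :
    Agree U (s m) (s n) (s (m + r) + 1 - s m) := by
  intro x hx
  have hmr := S.le_iff.2 (show m ≤ m + r by omega)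
  obtain ⟨q, hq⟩ := S.cases_pos (s m + x)
  have hmq : m ≤ q := by
    by_contra hlt
    have h1 := S.le_iff.2 (show q + 1 ≤ m by omega)
    rcases S.pos_succ_cases q with h2 | h2 <;> omega
  have hqr : q ≤ m + r := by
    by_contra hlt
    have h1 := S.lt_iff.2 (show m + r < q by omega)
    omega
  obtain ⟨t, rfl⟩ := Nat.exists_eq_add_of_le hmq
  have h3 := S.agree_pos h (show t ≤ r by omega)
  rcases hq with hq | hq | ⟨hq, hq2⟩
  · rw [hq, S.at_pos, show s n + x = s (n + t) by omega, S.at_pos]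
  · have ht : t < r := by
      by_contra hlt
      obtain rfl : t = r := by omega
      omega
    rw [hq, show s n + x = s (n + t) + 1 by omega, S.at_succ, S.at_succ, h t ht]
  · have ht : t < r := by
      by_contra hlt
      obtain rfl : t = r := by omega
      omega
    rw [hq, show s n + x = s (n + t) + 2 by omega, S.at_two _ hq2, S.at_two]
    rw [← h t ht, hq2]

/-- The 0 that follows the last image belongs to the hypothesis: without it a final e-1 could not be
told from a final e. -/
theorem agree_preimage {m n r R : ℕ} (h : Agree U (s m) (s n) (R + 1)) (hR : s m + R = s (m + r)) :
    Agree U m n r ∧ s n + R = s (n + r) := by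
  have key : ∀ t ≤ r, Agree U m n t := by
    intro t
    induction t with
    | zero => intro _ x hx; omega
    | succ t ih =>
      intro ht x hx
      have h1 := ih (by omega)
      rcases Nat.lt_succ_iff_lt_or_eq.1 hx with hx | rfl
      · exact h1 x hx
      have h2 := S.agree_pos h1 le_rfl
      have h3 := S.le_iff.2 (show m + x + 1 ≤ m + r by omega)
      have h4 := S.add_two_le (m + x) 1
      have h5 := S.le_iff.2 (show m ≤ m + x by omega)
      refine S.letter_eq_of_image ?_ ?_
      · have := h (s (m + x) - s m + 1) (by omega)
        rwa [show s m + (s (m + x) - s m + 1) = s (m + x) + 1 by omega,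
          show s n + (s (m + x) - s m + 1) = s (n + x) + 1 by omega] at this
      · have := h (s (m + x) - s m + 2) (by omega)
        rwa [show s m + (s (m + x) - s m + 2) = s (m + x) + 2 by omega,
          show s n + (s (m + x) - s m + 2) = s (n + x) + 2 by omega] at this
  have h1 := key r le_rfl
  have h2 := S.agree_pos h1 le_rfl
  exact ⟨h1, by omega⟩

/-- Each of the words 0(i+1)0 and 0ee0 is a palindrome, so mirrored letters have mirrored images
once the closing 0 is included. -/
theorem isPal_image {i j : ℕ} (h : IsPal U i j) : IsPal U (s i) (s j + 1) := by
  have hpos : ∀ t, i + t ≤ j → s (i + t) + s (j - t) = s i + s j := by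
    intro t
    induction t with
    | zero => intro _; simp
    | succ t ih =>
      intro ht
      have h1 := ih (by omega)
      have h2 := S.pos_congr (h (i + t) (by omega) (by omega))
      rw [show i + j - 1 - (i + t) = j - (t + 1) by omega, show j - (t + 1) + 1 = j - t by omega]
        at h2
      rw [← add_assoc]
      omega
  intro x hx1 hx2
  obtain ⟨q, hq⟩ := S.cases_pos x
  have hiq : i ≤ q := by
    by_contra hlt
    have h1 := S.le_iff.2 (show q + 1 ≤ i by omega)
    rcases S.pos_succ_cases q with h2 | h2 <;> omega
  have hqj : q ≤ j := by
    by_contra hlt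
    have h1 := S.lt_iff.2 (show j < q by omega)
    omega
  obtain ⟨t, rfl⟩ := Nat.exists_eq_add_of_le hiq
  have h3 := hpos t hqj
  have hlt : x ≠ s (i + t) → i + t < j := by
    intro hne
    rcases hqj.lt_or_eq with h | h
    · exact h
    · rw [h] at hq hne
      omega
  rcases hq with hq | hq | ⟨hq, hq2⟩
  · rw [show s i + (s j + 1) - 1 - x = s (j - t) by omega, S.at_pos, hq, S.at_pos]
  · have h4 := hlt (by omega)
    have h5 := S.at_last (j - t - 1)
    rw [show j - t - 1 + 1 = j - t by omega] at h5
    rw [show s i + (s j + 1) - 1 - x = s (j - t) - 1 by omega, h5, hq, S.at_succ,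
      h (i + t) (by omega) h4, show i + j - 1 - (i + t) = j - t - 1 by omega]
  · have h4 := hlt (by omega)
    have h6 := h (i + t) (by omega) h4
    rw [show i + j - 1 - (i + t) = j - t - 1 by omega, hq2] at h6
    have h5 := S.at_succ (j - t - 1)
    have h7 := S.pos_succ_top h6.symm
    rw [show j - t - 1 + 1 = j - t by omega] at h7
    rw [show s i + (s j + 1) - 1 - x = s (j - t - 1) + 1 by omega, h5, hq, S.at_two _ hq2, ← h6]
    omega

/-- Image boundaries are peeled off from both ends simultaneously; the second and third letters of
an image identify the letter, as for equality of factors. -/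
theorem isPal_preimage {i j : ℕ} (h : IsPal U (s i) (s j + 1)) : IsPal U i j := by
  have step : ∀ t, i + t < j → s (i + t) + s (j - t) = s i + s j → U (i + t) = U (j - t - 1) := by
    intro t ht h1
    have h2 := S.le_iff.2 (show i + t + 1 ≤ j by omega)
    have h3 := S.add_two_le (i + t) 1
    have h4 := S.le_iff.2 (show i ≤ i + t by omega)
    have h5 := h (s (i + t) + 1) (by omega) (by omega)
    have h6 := h (s (i + t) + 2) (by omega) (by omega)
    have h7 := S.at_last (j - t - 1)
    rw [show j - t - 1 + 1 = j - t by omega] at h7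
    rw [show s i + (s j + 1) - 1 - (s (i + t) + 1) = s (j - t) - 1 by omega, h7, S.at_succ] at h5
    rw [show s i + (s j + 1) - 1 - (s (i + t) + 2) = s (j - t) - 2 by omega] at h6
    have h8 := S.two_le
    have h9 := S.at_succ (j - t - 1)
    rcases S.pos_succ_cases (j - t - 1) with ⟨ha, hb⟩ | ⟨ha, hb⟩ <;>
      rcases S.pos_succ_cases (i + t) with ⟨hc, -⟩ | ⟨hc, -⟩ <;>
      rw [show j - t - 1 + 1 = j - t by omega] at hb
    · omega
    · rw [S.at_two_eq_zero hc, show s (j - t) - 2 = s (j - t - 1) + 1 by omega] at h6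
      omega
    · rw [S.at_two _ hc, show s (j - t) - 2 = s (j - t - 1) by omega, S.at_pos] at h6
      omega
    · omega
  have hpos : ∀ t, i + t ≤ j → s (i + t) + s (j - t) = s i + s j := by
    intro t
    induction t with
    | zero => intro _; simp
    | succ t ih =>
      intro ht
      have h1 := ih (by omega)
      have h2 := S.pos_congr (step t (by omega) h1)
      rw [show j - t - 1 + 1 = j - t by omega] at h2
      rw [← add_assoc, show j - (t + 1) = j - t - 1 by omega]
      omega
  intro t h1 h2
  have := step (t - i) (by omega) (hpos _ (by omega))
  rw [show i + (t - i) = t by omega] at this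
  rw [this]
  congr 1
  omega

end Subst

/-! ### Complete return words of palindromes -/

theorem IsPal.shrink {U : ℕ → ℕ} {i j : ℕ} (h : IsPal U i j) (f : ℕ) :
    IsPal U (i + f) (j - f) := by
  intro t h1 h2
  rw [h t (by omega) (by omega)]
  congr 1
  omega

theorem IsPal.congr {U : ℕ → ℕ} {i j i' j' : ℕ} (h : IsPal U i j) (hi : i = i') (hj : j = j') :
    IsPal U i' j' := by
  subst hi hj
  exact h

theorem Agree.isPal {U : ℕ → ℕ} {i j r : ℕ} (h : Agree U i j r) (hp : IsPal U i (i + r)) :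
    IsPal U j (j + r) := by
  intro t h1 h2
  have := hp (i + (t - j)) (by omega) (by omega)
  rw [h _ (by omega), show i + (i + r) - 1 - (i + (t - j)) = i + (r - 1 - (t - j)) by omega,
    h _ (by omega), show j + (t - j) = t by omega] at this
  rw [this]
  congr 1
  omega

theorem Agree.symm {U : ℕ → ℕ} {i j r : ℕ} (h : Agree U i j r) : Agree U j i r :=
  fun t ht => (h t ht).symm

/-- The factor of length `r` at the position `i` has a letter at least `b` on both sides; there is
no condition for `b = 0`. -/
def Flank (U : ℕ → ℕ) (b i r : ℕ) : Prop :=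
  b = 0 ∨ (1 ≤ i ∧ b ≤ U (i - 1) ∧ b ≤ U (i + r))

namespace Subst

variable {e : ℕ} {U s : ℕ → ℕ} (S : Subst e U s)
include S

/-- Letters at least b+1 come from letters at least b. Hence a gap between consecutive ones is
φ(gap)0 for a gap one level below, unless the two letters are the pair ee and the gap is empty. -/
theorem isPal_gap_ge (b : ℕ) : b ≤ e → ∀ m m', m < m' → b ≤ U m → b ≤ U m' →
    (∀ l, m < l → l < m' → U l < b) → IsPal U (m + 1) m' := by
  induction b with
  | zero =>
    intro _ m m' h1 _ _ h2
    rcases Nat.lt_or_ge (m + 1) m' with h | h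
    · exact absurd (h2 (m + 1) (by omega) h) (by omega)
    · intro t _ _
      omega
  | succ b ih =>
    intro hb m m' hm h1 h2 h3
    by_cases h0 : U (m + 1) = 0
    · obtain ⟨q, hq⟩ := S.exists_pos_of_eq_zero h0
      have hq0 : q ≠ 0 := by
        rintro rfl
        rw [S.pos_zero] at hq
        omega
      obtain ⟨n, rfl⟩ : ∃ n, q = n + 1 := ⟨q - 1, by omega⟩
      obtain ⟨n', h4, h5⟩ := S.nonzero_cases (p := m') (by omega)
      have h6 : m' = s n' + 1 := by
        rcases h5 with h5 | ⟨h5, h6⟩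
        · exact h5
        · have h7 := S.at_succ n'
          have h8 : m ≠ s n' + 1 := by
            intro h
            have := S.at_two n' h6
            rw [show s n' + 2 = m + 1 by omega, h0] at this
            have := S.two_le
            omega
          have h9 : m ≠ s n' := by
            intro h
            rw [h, S.at_pos] at h1
            omega
          have := h3 (s n' + 1) (by omega) (by omega)
          omega
      have hn : n + 1 ≤ n' := S.le_iff.1 (by
        have h9 : m ≠ s n' := by
          intro h
          rw [h, S.at_pos] at h1
          omega
        omega)
      have hUn : b ≤ U n := by
        have := S.at_last n
        rw [← hq, show m + 1 - 1 = m by omega] at this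
        omega
      have := ih (by omega) n n' (by omega) hUn (by omega) (fun l hl1 hl2 => by
        have h10 := h3 (s l + 1) (by have := S.le_iff.2 (show n + 1 ≤ l by omega); omega)
          (by have := S.lt_iff.2 hl2; omega)
        rw [S.at_succ] at h10
        omega)
      exact (S.isPal_image this).congr hq.symm h6.symm
    · obtain ⟨n, -, -, -, h4, -⟩ := S.top_of_two_nonzero (p := m) (by omega) h0
      rcases Nat.lt_or_ge (m + 1) m' with h | h
      · exact absurd (h3 (m + 1) (by omega) h) (by omega)
      · intro t _ _
        omega

/-- A letter c+1 < e comes only from c, so its gaps are images of the gaps of c followed by 0. The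
letter e also comes from e-1 and needs `isPal_gap_ge` instead. -/
theorem isPal_gap_eq (c : ℕ) : c < e → ∀ m m', m < m' → U m = c → U m' = c →
    (∀ l, m < l → l < m' → U l ≠ c) → IsPal U (m + 1) m' := by
  induction c with
  | zero =>
    intro _ m m' hm h1 h2 h3
    obtain ⟨n, rfl⟩ := S.exists_pos_of_eq_zero h1
    obtain ⟨n', rfl⟩ := S.exists_pos_of_eq_zero h2
    have hn := S.lt_iff.1 hm
    obtain rfl : n' = n + 1 := by
      by_contra h
      exact h3 (s (n + 1)) (S.lt_iff.2 (by omega)) (S.lt_iff.2 (by omega)) (S.at_pos _)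
    have h4 : IsPal U n (n + 1) := fun t h5 h6 => by
      congr 1
      omega
    exact ((S.isPal_image h4).shrink 1).congr rfl (by omega)
  | succ c ih =>
    intro hc m m' hm h1 h2 h3
    have aux : ∀ p, U p = c + 1 → ∃ n, p = s n + 1 ∧ U n = c := by
      intro p hp
      obtain ⟨n, h4, h5 | ⟨h5, h6⟩⟩ := S.nonzero_cases (p := p) (by omega)
      · exact ⟨n, h5, by omega⟩
      · omega
    obtain ⟨n, rfl, h4⟩ := aux m h1
    obtain ⟨n', rfl, h5⟩ := aux m' h2
    have hn := S.lt_iff.1 (show s n < s n' by omega)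
    have := ih (by omega) n n' hn h4 h5 (fun l hl1 hl2 hl3 => by
      refine h3 (s l + 1) (by have := S.lt_iff.2 hl1; omega) (by have := S.lt_iff.2 hl2; omega) ?_
      rw [S.at_succ]
      omega)
    exact (S.isPal_image this).congr (by rw [S.pos_succ_ne (by omega)]) rfl

/-- Desubstitution of a palindromic factor that contains the letter `0`. -/
theorem exists_core {i r z : ℕ} (hp : IsPal U i (i + r)) (hz : z < r) (hz0 : U (i + z) = 0) :
    ∃ f i' r', i + f = s i' ∧ s (i' + r') + 1 + f = i + r ∧ (∀ t < f, U (i + t) ≠ 0) ∧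
      IsPal U i' (i' + r') := by
  classical
  have hex : ∃ t, U (i + t) = 0 := ⟨z, hz0⟩
  set f := Nat.find hex with hf
  have hf0 : U (i + f) = 0 := Nat.find_spec hex
  have hfz : f ≤ z := Nat.find_min' hex hz0
  have hfmin : ∀ t < f, U (i + t) ≠ 0 := fun t ht => Nat.find_min hex ht
  have h1 := hp (i + f) (by omega) (by omega)
  have hfr : i + f ≤ i + r - 1 - f := by
    by_contra hlt
    have h2 := hp (i + (r - 1 - f)) (by omega) (by omega)
    rw [show i + (i + r) - 1 - (i + (r - 1 - f)) = i + f by omega, hf0] at h2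
    exact hfmin _ (by omega) h2
  obtain ⟨i', hi'⟩ := S.exists_pos_of_eq_zero hf0
  rw [hf0, show i + (i + r) - 1 - (i + f) = i + r - 1 - f by omega] at h1
  obtain ⟨k, hk⟩ := S.exists_pos_of_eq_zero h1.symm
  have hik : i' ≤ k := S.le_iff.1 (by omega)
  obtain ⟨r', rfl⟩ := Nat.exists_eq_add_of_le hik
  exact ⟨f, i', r', hi', by omega, hfmin,
    S.isPal_preimage ((hp.shrink f).congr hi' (by omega))⟩

theorem exists_core_agree {i j r f i' r' : ℕ} (hi : i + f = s i') (hr : s (i' + r') + 1 + f = i + r)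
    (ha : Agree U i j r) :
    ∃ j', j + f = s j' ∧ s (j' + r') + 1 + f = j + r ∧ Agree U i' j' r' := by
  have hle := S.le_iff.2 (show i' ≤ i' + r' by omega)
  have h0 : U (j + f) = 0 := by
    rw [← ha f (by omega), hi, S.at_pos]
  obtain ⟨j', hj'⟩ := S.exists_pos_of_eq_zero h0
  have h1 : Agree U (s i') (s j') (s (i' + r') - s i' + 1) := by
    intro t ht
    have := ha (f + t) (by omega)
    rwa [← add_assoc, ← add_assoc, hi, hj'] at this
  obtain ⟨h2, h3⟩ := S.agree_preimage h1 (by omega : s i' + (s (i' + r') - s i') = s (i' + r'))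
  exact ⟨j', hj', by omega, h2⟩

theorem agree_of_core {i r f i' r' l' : ℕ} (hi : i + f = s i')
    (hr : s (i' + r') + 1 + f = i + r) (hl : f ≤ s l') (ha : Agree U i' l' r')
    (hleft : ∀ t < f, U (i + t) = U (s l' - f + t))
    (hright : ∀ t < f, U (s (i' + r') + 1 + t) = U (s (l' + r') + 1 + t)) :
    Agree U i (s l' - f) r := by
  have h1 := S.agree_image ha
  have h2 := S.agree_pos ha le_rfl
  have hle := S.le_iff.2 (show i' ≤ i' + r' by omega)
  intro t ht
  by_cases h3 : t < f
  · exact hleft t h3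
  by_cases h4 : t < r - f
  · have := h1 (t - f) (by omega)
    rwa [show s i' + (t - f) = i + t by omega, show s l' + (t - f) = s l' - f + t by omega] at this
  · have := hright (t - (r - f)) (by omega)
    rwa [show s (i' + r') + 1 + (t - (r - f)) = i + t by omega,
      show s (l' + r') + 1 + (t - (r - f)) = s l' - f + t by omega] at this

theorem at_pred {n : ℕ} (hn : 1 ≤ n) : U (s n - 1) = min (U (n - 1) + 1) e := by
  have := S.at_last (n - 1)
  rwa [show n - 1 + 1 = n by omega] at this

theorem at_pred_two {n : ℕ} (hn : 1 ≤ n) (h : U (n - 1) = e) : s n = s (n - 1) + 3 := by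
  have := S.pos_succ_top h
  rwa [show n - 1 + 1 = n by omega] at this

theorem one_le_pos {n : ℕ} (hn : 1 ≤ n) : 2 ≤ s n := by
  have := S.add_two_le 0 n
  rw [zero_add] at this
  omega

theorem exists_of_two_pred {n i : ℕ} (hi : i + 1 = s n) (h1 : 1 ≤ i) (h2 : U (i - 1) ≠ 0)
    (h3 : U i ≠ 0) : 1 ≤ n ∧ U (n - 1) = e := by
  obtain ⟨q, h4, h5, h6, h7, h8⟩ := S.top_of_two_nonzero (p := i - 1) h2
    (by rwa [show i - 1 + 1 = i by omega])
  have : n = q + 1 := S.inj (by omega)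
  subst this
  exact ⟨by omega, by simpa using h5⟩

set_option maxHeartbeats 2000000 in
/-- Complete return words of palindromic factors are palindromes. -/
theorem isPal_return (r : ℕ) : ∀ b ≤ e, ∀ i j, i < j → IsPal U i (i + r) → Agree U i j r →
    Flank U b i r → Flank U b j r →
    (∀ l, i < l → l < j → Agree U i l r → ¬ Flank U b l r) → IsPal U i (j + r) := by
  have he := S.two_le
  induction r using Nat.strong_induction_on with
  | _ r ih =>
  intro b hb i j hij hp ha hfi hfj hno
  by_cases hz : ∃ z < r, U (i + z) = 0
  · obtain ⟨z, hz, hz0⟩ := hz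
    obtain ⟨f, i', r', hi, hr, hf0, hp'⟩ := S.exists_core hp hz hz0
    obtain ⟨j', hj, hr2, ha'⟩ := S.exists_core_agree hi hr ha
    have hgrow := S.add_two_le i' r'
    have hij' : i' < j' := S.lt_iff.1 (by omega)
    -- The return word of the core, once a palindrome, is completed by the `f` nonzero letters at
    -- either end.
    suffices h : IsPal U i' (j' + r') by
      refine IsPal.extend (f := f) ((S.isPal_image h).congr hi.symm (by omega)) hp ha (by omega) hij
    -- The threshold `b'` has to be chosen so that flanked occurrences of the core are exactly those
    -- that lift to flanked occurrences of the factor. Then no intermediate one exists and the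
    -- induction hypothesis applies.
    have huse : ∀ b' ≤ e, Flank U b' i' r' → Flank U b' j' r' →
        (∀ l', i' < l' → l' < j' → Agree U i' l' r' → Flank U b' l' r' →
          f ≤ s l' ∧ (∀ t < f, U (i + t) = U (s l' - f + t)) ∧
          (∀ t < f, U (s (i' + r') + 1 + t) = U (s (l' + r') + 1 + t)) ∧
          Flank U b (s l' - f) r) → IsPal U i' (j' + r') := by
      intro b' hb' h1 h2 h3
      refine ih r' (by omega) b' hb' i' j' hij' hp' ha' h1 h2 fun l' hl1 hl2 hl3 hl4 => ?_
      obtain ⟨h4, h5, h6, h7⟩ := h3 l' hl1 hl2 hl3 hl4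
      have hl5 := S.lt_iff.2 hl1
      have hl6 := S.lt_iff.2 hl2
      exact hno (s l' - f) (by omega) (by omega) (S.agree_of_core hi hr h4 hl3 h5 h6) h7
    have hf2 : f ≤ 2 := by
      by_contra hlt
      obtain ⟨n, -, -, -, -, h1⟩ := S.top_of_two_nonzero (p := i) (hf0 0 (by omega))
        (hf0 1 (by omega))
      refine hf0 2 (by omega) ?_
      rw [h1, S.at_pos]
    have hR : ∀ t < f, U (s (i' + r') + 1 + t) = U (i + (f - 1 - t)) := by
      intro t ht
      rw [hp _ (by omega) (by omega)]
      congr 1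
      omega
    rcases Nat.eq_zero_or_pos f with rfl | hfpos
    · -- the factor starts with the letter `0`
      rcases Nat.eq_zero_or_pos b with rfl | hbpos
      · refine huse 0 (by omega) (.inl rfl) (.inl rfl) fun l' _ _ _ _ => ?_
        exact ⟨by omega, by omega, by omega, .inl rfl⟩
      -- A letter at least `b` next to the factor is the last or second letter of an image, hence
      -- corresponds to a letter at least `b - 1` next to the core.
      · have conv : ∀ l l', l = s l' → l + r = s (l' + r') + 1 → 1 ≤ l' →
            (Flank U b l r ↔ b - 1 ≤ U (l' - 1) ∧ b - 1 ≤ U (l' + r')) := by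
          intro l l' h1 h2 h3
          have h4 := S.at_pred h3
          have h5 := S.at_succ (l' + r')
          have h6 := S.one_le_pos h3
          unfold Flank
          rw [h2, h1]
          omega
        have hpos : ∀ l l', l = s l' → Flank U b l r → 1 ≤ l' := by
          intro l l' h1 h2
          by_contra h3
          obtain rfl : l' = 0 := by omega
          rw [S.pos_zero] at h1
          rcases h2 with h2 | h2 <;> omega
        have h1 := hpos i i' (by omega) hfi
        have h2 := (conv i i' (by omega) (by omega) h1).1 hfi
        have h3 := (conv j j' (by omega) (by omega) (by omega)).1 hfj
        refine huse (b - 1) (by omega) (.inr ⟨h1, h2⟩) (.inr ⟨by omega, h3⟩) fun l' h4 h5 h6 h7 => ?_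
        have h8 := S.agree_pos h6 le_rfl
        refine ⟨by omega, by omega, by omega, (conv _ l' (by omega) (by omega) (by omega)).2 ?_⟩
        rcases h7 with h7 | h7
        · omega
        · exact h7.2
    have hi1 : 1 ≤ i' := by
      by_contra h1
      obtain rfl : i' = 0 := by omega
      rw [S.pos_zero] at hi
      omega
    have hj1 : 1 ≤ j' := by omega
    have hmatch : ∀ l', 1 ≤ l' → U (l' - 1) = e → U (l' + r') = e →
        U (s l' - 1) = e ∧ U (s l' - 2) = e ∧ U (s (l' + r') + 1) = e ∧
          U (s (l' + r') + 2) = e := by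
      intro l' h1 h2 h3
      have h4 := S.at_pred_two h1 h2
      refine ⟨?_, ?_, ?_, S.at_two _ h3⟩
      · rw [S.at_pred h1]
        omega
      · rw [show s l' - 2 = s (l' - 1) + 1 by omega, S.at_succ]
        omega
      · rw [S.at_succ]
        omega
    rcases Nat.eq_zero_or_pos b with rfl | hbpos
    · rcases (by omega : f = 1 ∨ f = 2) with rfl | rfl
      · have e1 := S.at_pred hi1
        have e2 := S.at_pred hj1
        have e3 := S.at_succ (i' + r')
        have e4 := S.at_succ (j' + r')
        have e5 := ha 0 (by omega)
        have e6 := hp i (by omega) (by omega)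
        have e7 := ha (r - 1) (by omega)
        rw [show s i' - 1 = i by omega] at e1
        rw [show s j' - 1 = j by omega] at e2
        rw [show s (i' + r') + 1 = i + (r - 1) by omega] at e3
        rw [show s (j' + r') + 1 = j + (r - 1) by omega] at e4
        rw [show i + (i + r) - 1 - i = i + (r - 1) by omega] at e6
        simp only [add_zero] at e5
        have hL : ∀ l', 1 ≤ l' → min (U (l' - 1) + 1) e = U i → min (U (l' + r') + 1) e = U i →
            1 ≤ s l' ∧ (∀ t < 1, U (i + t) = U (s l' - 1 + t)) ∧
            (∀ t < 1, U (s (i' + r') + 1 + t) = U (s (l' + r') + 1 + t)) ∧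
            Flank U 0 (s l' - 1) r := by
          intro l' h1 h2 h3
          have h4 := S.one_le_pos h1
          refine ⟨by omega, ?_, ?_, .inl rfl⟩
          · intro t ht
            obtain rfl : t = 0 := by omega
            rw [add_zero, add_zero, S.at_pred h1, h2]
          · intro t ht
            obtain rfl : t = 0 := by omega
            rw [hR 0 (by omega), add_zero, S.at_succ, h3]
            rfl
        -- An outer letter e comes from e-1 or e, so the core is taken with threshold e-1. A smaller
        -- outer letter has a unique preimage letter, which can be added to the core.
        by_cases hc : U i = e
        · refine huse (e - 1) (by omega) (.inr ⟨hi1, by omega, by omega⟩)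
            (.inr ⟨hj1, by omega, by omega⟩) fun l' h4 h5 h6 h7 => ?_
          have h8 : e - 1 ≤ U (l' - 1) ∧ e - 1 ≤ U (l' + r') := by
            rcases h7 with h7 | h7
            · omega
            · exact h7.2
          exact hL l' (by omega) (by omega) (by omega)
        · have hci := S.le i
          have hU : U i = U (i' - 1) + 1 := by omega
          have hag : ∀ l', 1 ≤ l' → Agree U i' l' r' → U (l' - 1) = U (i' - 1) →
              U (l' + r') = U (i' - 1) → Agree U (i' - 1) (l' - 1) (r' + 2) := by
            intro l' h1 h2 h3 h4 t ht
            rcases Nat.eq_zero_or_pos t with rfl | h5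
            · exact h3.symm
            · by_cases h6 : t = r' + 1
              · subst h6
                rw [show i' - 1 + (r' + 1) = i' + r' by omega,
                  show l' - 1 + (r' + 1) = l' + r' by omega]
                omega
              · have := h2 (t - 1) (by omega)
                rwa [show i' + (t - 1) = i' - 1 + t by omega,
                  show l' + (t - 1) = l' - 1 + t by omega] at this
          have hp2 : IsPal U (i' - 1) (i' - 1 + (r' + 2)) := by
            intro t h1 h2
            by_cases h3 : t = i' - 1
            · subst h3
              rw [show i' - 1 + (i' - 1 + (r' + 2)) - 1 - (i' - 1) = i' + r' by omega]
              omega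
            · by_cases h4 : t = i' + r'
              · subst h4
                rw [show i' - 1 + (i' - 1 + (r' + 2)) - 1 - (i' + r') = i' - 1 by omega]
                omega
              · rw [hp' t (by omega) (by omega)]
                congr 1
                omega
          -- The enlarged core is still shorter than the factor: r ≥ 2 r' + 3. Its outer letters
          -- make a flank condition unnecessary.
          have := ih (r' + 2) (by omega) 0 (by omega) (i' - 1) (j' - 1) (by omega) hp2
            (hag j' hj1 ha' (by omega) (by omega)) (.inl rfl) (.inl rfl)
            fun l h1 h2 h3 _ => by
              have h4 := h3 0 (by omega)
              have h5 := h3 (r' + 1) (by omega)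
              rw [add_zero, add_zero] at h4
              rw [show i' - 1 + (r' + 1) = i' + r' by omega,
                show l + (r' + 1) = l + 1 + r' by omega] at h5
              have h6 := hL (l + 1) (by omega) (by rw [show l + 1 - 1 = l by omega]; omega)
                (by omega)
              have h7 : Agree U i' (l + 1) r' := by
                intro t ht
                have := h3 (t + 1) (by omega)
                rwa [show i' - 1 + (t + 1) = i' + t by omega,
                  show l + (t + 1) = l + 1 + t by omega] at this
              refine hno (s (l + 1) - 1) ?_ ?_ (S.agree_of_core hi hr h6.1 h7 h6.2.1 h6.2.2.1)
                (.inl rfl)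
              · have := S.lt_iff.2 (show i' < l + 1 by omega)
                omega
              · have := S.lt_iff.2 (show l + 1 < j' by omega)
                omega
          exact (this.shrink 1).congr (by omega) (by omega)
      -- Outer pairs ee arise only from φ(e), so the core is flanked by letters e on both sides.
      · have key : ∀ l l', l + 2 = s l' → s (l' + r') + 1 + 2 = l + r → Agree U i l r →
            1 ≤ l' → U (l' - 1) = e ∧ U (l' + r') = e := by
          intro l l' h1 h2 h3 h4
          constructor
          · obtain ⟨n, h5, h6, -, -, h7⟩ := S.top_of_two_nonzero (p := l)
              (by have := h3 0 (by omega); have := hf0 0 (by omega); simp_all)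
              (by have := h3 1 (by omega); have := hf0 1 (by omega); simp_all)
            have : l' = n + 1 := S.inj (by omega)
            subst this
            exact h6
          · have h9 : ∀ t < 2, U (s (l' + r') + 1 + t) ≠ 0 := by
              intro t ht
              have := h3 (r - 2 + t) (by omega)
              rw [show l + (r - 2 + t) = s (l' + r') + 1 + t by omega,
                show i + (r - 2 + t) = s (i' + r') + 1 + t by omega, hR t ht] at this
              rw [← this]
              exact hf0 _ (by omega)
            rcases S.pos_succ_cases (l' + r') with ⟨h5, -⟩ | ⟨h5, -⟩
            · exact h5
            · exact absurd (S.at_two_eq_zero h5) (h9 1 (by omega))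
        have h1 := key i i' hi (by omega) (fun t _ => rfl) hi1
        have h2 := key j j' hj (by omega) ha hj1
        refine huse e le_rfl (.inr ⟨hi1, h1.1.ge, h1.2.ge⟩) (.inr ⟨hj1, h2.1.ge, h2.2.ge⟩)
          fun l' h4 h5 h6 h7 => ?_
        have h8 : U (l' - 1) = e ∧ U (l' + r') = e := by
          have := S.le (l' - 1)
          have := S.le (l' + r')
          rcases h7 with h7 | h7 <;> omega
        obtain ⟨m1, m2, m3, m4⟩ := hmatch l' (by omega) h8.1 h8.2
        obtain ⟨w1, w2, w3, w4⟩ := hmatch i' (by omega) h1.1 h1.2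
        have h9 := S.one_le_pos (show 1 ≤ l' by omega)
        refine ⟨h9, ?_, ?_, .inl rfl⟩
        · intro t ht
          interval_cases t
          · rw [add_zero, add_zero, m2, show i = s i' - 2 by omega, w2]
          · rw [show s l' - 2 + 1 = s l' - 1 by omega, m1, show i + 1 = s i' - 1 by omega, w1]
        · intro t ht
          interval_cases t
          · rw [add_zero, add_zero, m3, w3]
          · rw [add_assoc, add_assoc, m4, w4]
    · have hfl : ∀ l, Flank U b l r → 1 ≤ l ∧ U (l - 1) ≠ 0 ∧ U (l + r) ≠ 0 := by
        intro l h
        rcases h with h | ⟨h1, h2, h3⟩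
        · omega
        · exact ⟨h1, by omega, by omega⟩
      obtain ⟨k1, k2, k3⟩ := hfl i hfi
      obtain ⟨k4, k5, k6⟩ := hfl j hfj
      -- The left flank and the first letter are both nonzero, hence form ee and are followed by 0.
      -- So the core is again flanked by letters e.
      have hf1 : f = 1 := by
        obtain ⟨n, -, -, -, -, h1⟩ := S.top_of_two_nonzero (p := i - 1) k2
          (by have := hf0 0 (by omega); rwa [show i - 1 + 1 = i + 0 by omega])
        by_contra h2
        refine hf0 1 (by omega) ?_
        rw [show i + 1 = i - 1 + 2 by omega, h1, S.at_pos]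
      subst hf1
      have key : ∀ l l', l + 1 = s l' → s (l' + r') + 1 + 1 = l + r → Agree U i l r →
          1 ≤ l → U (l - 1) ≠ 0 → U (l + r) ≠ 0 → U (l' - 1) = e ∧ U (l' + r') = e := by
        intro l l' h1 h2 h3 h4 h5 h6
        constructor
        · refine (S.exists_of_two_pred h1 h4 h5 ?_).2
          have := h3 0 (by omega)
          have := hf0 0 (by omega)
          simp_all
        · rcases S.pos_succ_cases (l' + r') with ⟨h7, -⟩ | ⟨h7, -⟩
          · exact h7
          · exact absurd (S.at_two_eq_zero h7) (by rwa [show s (l' + r') + 2 = l + r by omega])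
      have h1 := key i i' hi (by omega) (fun t _ => rfl) k1 k2 k3
      have h2 := key j j' hj (by omega) ha k4 k5 k6
      refine huse e le_rfl (.inr ⟨hi1, h1.1.ge, h1.2.ge⟩) (.inr ⟨hj1, h2.1.ge, h2.2.ge⟩)
        fun l' h4 h5 h6 h7 => ?_
      have h8 : U (l' - 1) = e ∧ U (l' + r') = e := by
        have := S.le (l' - 1)
        have := S.le (l' + r')
        rcases h7 with h7 | h7 <;> omega
      obtain ⟨m1, m2, m3, m4⟩ := hmatch l' (by omega) h8.1 h8.2
      obtain ⟨w1, w2, w3, w4⟩ := hmatch i' (by omega) h1.1 h1.2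
      have h9 := S.one_le_pos (show 1 ≤ l' by omega)
      have h10 := S.agree_pos h6 le_rfl
      refine ⟨by omega, ?_, ?_, .inr ⟨by omega, ?_, ?_⟩⟩
      · intro t ht
        obtain rfl : t = 0 := by omega
        rw [add_zero, add_zero, m1, show i = s i' - 1 by omega, w1]
      · intro t ht
        obtain rfl : t = 0 := by omega
        rw [add_zero, add_zero, m3, w3]
      · rw [show s l' - 1 - 1 = s l' - 2 by omega, m2]
        exact hb
      · rw [show s l' - 1 + r = s (l' + r') + 2 by omega, m4]
        exact hb
  · push Not at hz
    have hr2 : r ≤ 2 := by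
      by_contra hlt
      obtain ⟨n, -, -, -, -, h1⟩ := S.top_of_two_nonzero (p := i) (hz 0 (by omega))
        (hz 1 (by omega))
      refine hz 2 (by omega) ?_
      rw [h1, S.at_pos]
    rcases Nat.eq_zero_or_pos b with rfl | hbpos
    · interval_cases r
      · obtain rfl : j = i + 1 := by
          by_contra h
          exact hno (i + 1) (by omega) (by omega) (fun t ht => by omega) (.inl rfl)
        intro t h1 h2
        congr 1
        omega
      · have h1 := ha 0 (by omega)
        rw [add_zero, add_zero] at h1
        have hgap : IsPal U (i + 1) j := by
          have hno' : ∀ l, i < l → l < j → U l ≠ U i := by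
            intro l h2 h3 h4
            refine hno l h2 h3 (fun t ht => ?_) (.inl rfl)
            obtain rfl : t = 0 := by omega
            exact h4.symm
          have h2 := S.le i
          rcases h2.lt_or_eq with h3 | h3
          · exact S.isPal_gap_eq (U i) h3 i j hij rfl h1.symm hno'
          · refine S.isPal_gap_ge e le_rfl i j hij h3.ge (h1 ▸ h3.ge) fun l h4 h5 => ?_
            have := hno' l h4 h5
            have := S.le l
            omega
        exact IsPal.extend (f := 1) hgap hp ha le_rfl hij
      · obtain ⟨n, h1, h2, h3, h4, h5⟩ := S.top_of_two_nonzero (p := i) (hz 0 (by omega))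
          (hz 1 (by omega))
        have a0 := ha 0 (by omega)
        have a1 := ha 1 (by omega)
        rw [add_zero, add_zero] at a0
        obtain ⟨n', h6, h7, -, -, -⟩ := S.top_of_two_nonzero (p := j) (by omega) (by omega)
        have hgap := S.isPal_gap_ge e le_rfl n n' (S.lt_iff.1 (by omega)) h2.ge h7.ge
          fun l h8 h9 => by
            by_contra h10
            have h11 := S.le l
            have h12 := S.lt_iff.2 h8
            have h13 := S.lt_iff.2 h9
            refine hno (s l + 1) (by omega) (by omega) (fun t ht => ?_) (.inl rfl)
            interval_cases t
            · rw [add_zero, add_zero, h3, S.at_succ]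
              omega
            · rw [h4, add_assoc, S.at_two l (by omega)]
        exact IsPal.extend (f := 2) ((S.isPal_image hgap).congr h5.symm (by omega)) hp ha le_rfl hij
    · have hfl : ∀ l, Flank U b l r → 1 ≤ l ∧ U (l - 1) ≠ 0 ∧ U (l + r) ≠ 0 := by
        intro l h
        rcases h with h | ⟨h1, h2, h3⟩
        · omega
        · exact ⟨h1, by omega, by omega⟩
      obtain ⟨k1, k2, k3⟩ := hfl i hfi
      obtain ⟨k4, k5, k6⟩ := hfl j hfj
      -- A nonempty factor would form ee with its left flank, and the 0 after ee would lie in the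
      -- factor or be its right flank. What remains is the empty word inside ee.
      have hr0 : r = 0 := by
        by_contra h0
        obtain ⟨n, -, -, -, -, h1⟩ := S.top_of_two_nonzero (p := i - 1) k2
          (by have := hz 0 (by omega); rwa [show i - 1 + 1 = i + 0 by omega])
        rw [show i - 1 + 2 = i + 1 by omega] at h1
        have h2 : U (i + 1) = 0 := by rw [h1, S.at_pos]
        rcases (by omega : r = 1 ∨ r = 2) with rfl | rfl
        · exact k3 h2
        · exact hz 1 (by omega) h2
      subst hr0
      rw [add_zero] at k3 k6
      obtain ⟨n, h1, h2, h3, h4, h5⟩ := S.top_of_two_nonzero (p := i - 1) k2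
        (by rwa [show i - 1 + 1 = i by omega])
      obtain ⟨n', h6, h7, h8, h9, h10⟩ := S.top_of_two_nonzero (p := j - 1) k5
        (by rwa [show j - 1 + 1 = j by omega])
      have hgap := S.isPal_gap_ge e le_rfl n n' (S.lt_iff.1 (by omega)) h2.ge h7.ge
        fun l hl1 hl2 => by
          by_contra h11
          have h12 := S.le l
          have h13 := S.lt_iff.2 hl1
          have h14 := S.lt_iff.2 hl2
          refine hno (s l + 2) (by omega) (by omega) (fun t ht => by omega)
            (.inr ⟨by omega, ?_, ?_⟩)
          · rw [show s l + 2 - 1 = s l + 1 by omega, S.at_succ]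
            omega
          · rw [add_zero, S.at_two l (by omega)]
            exact hb
      have a2 : Agree U (i - 1) (j - 1) 2 := by
        intro t ht
        interval_cases t
        · rw [add_zero, add_zero, h3, h8]
        · rw [h4, h9]
      have p2 : IsPal U (i - 1) (i - 1 + 2) := by
        intro t ht1 ht2
        rcases (by omega : t = i - 1 ∨ t = i - 1 + 1) with rfl | rfl
        · rw [show i - 1 + (i - 1 + 2) - 1 - (i - 1) = i - 1 + 1 by omega, h3, h4]
        · rw [show i - 1 + (i - 1 + 2) - 1 - (i - 1 + 1) = i - 1 by omega, h3, h4]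
      have := IsPal.extend (f := 2) ((S.isPal_image hgap).congr h5.symm (by omega)) p2 a2 le_rfl
        (by omega)
      exact (this.shrink 1).congr (by omega) (by omega)

/-- Every prefix has a palindromic suffix that does not occur before. -/
theorem exists_unioccurrent (N : ℕ) :
    ∃ i ≤ N, IsPal U i (N + 1) ∧ ∀ i' < i, ¬ Agree U i' i (N + 1 - i) := by
  classical
  have hex : ∃ i, i ≤ N ∧ IsPal U i (N + 1) := ⟨N, le_rfl, fun t h1 h2 => by congr 1; omega⟩
  obtain ⟨h1, h2⟩ := Nat.find_spec hex
  set i := Nat.find hex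
  refine ⟨i, h1, h2, fun i' hi' ha => ?_⟩
  -- Here `i` starts the longest palindromic suffix. The least `k` gives its last earlier
  -- occurrence; the complete return word from there would be a longer palindromic suffix.
  have hex' : ∃ k, k < i ∧ Agree U (i - 1 - k) i (N + 1 - i) :=
    ⟨i - 1 - i', by omega, by rwa [show i - 1 - (i - 1 - i') = i' by omega]⟩
  obtain ⟨h3, h4⟩ := Nat.find_spec hex'
  set k := Nat.find hex'
  set l := i - 1 - k
  have hmax : ∀ x, l < x → x < i → ¬ Agree U x i (N + 1 - i) := by
    intro x hx1 hx2 hx3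
    refine Nat.find_min hex' (m := i - 1 - x) (by omega) ⟨by omega, ?_⟩
    rwa [show i - 1 - (i - 1 - x) = x by omega]
  have hpal : IsPal U l (l + (N + 1 - i)) := h4.symm.isPal (h2.congr rfl (by omega))
  have := S.isPal_return (N + 1 - i) 0 (by omega) l i (by omega) hpal h4 (.inl rfl) (.inl rfl)
    fun x hx1 hx2 hx3 _ => hmax x hx1 hx2 fun t ht => (hx3 t ht).symm.trans (h4 t ht)
  exact Nat.find_min hex (m := l) (by omega) ⟨by omega, this.congr rfl (by omega)⟩

end Subst

/-! ### Weighted lengths and their recurrences -/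

/-- The sum of the weighted lengths of the words `φ^j(0)` for `j < n`. -/
def prefixSum (d : ℕ) : ℕ → ℕ
  | 0 => 0
  | n + 1 => 2 * prefixSum d n + 1 + prefixSum d (n - d)

/-- The weighted length of the image of the letter `i` under the `n`-th power of the morphism. -/
def imageLen (d n i : ℕ) : ℕ :=
  1 + prefixSum d n + prefixSum d (n + i - d)

/-- The weighted length of the image of the letter `0` under the `n`-th power of the morphism. -/
def zeroLen (d n : ℕ) : ℕ :=
  imageLen d n 0

/-- The total weighted length of the top letters added by one-sided extensions of a repetition. -/
def extLen (d n : ℕ) : ℕ :=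
  if _h : n < 2 * d ∨ d = 0 then 0 else zeroLen d (n - d) + extLen d (n - 2 * d)
termination_by n
decreasing_by omega

/-- The weighted length of the two-sided extension of `φ^n(e e)` as a repetition, with `e` the
largest letter. -/
def excess (d n : ℕ) : ℕ :=
  prefixSum d n + 2 * extLen d n

section Lengths

variable (d : ℕ)

theorem prefixSum_zero : prefixSum d 0 = 0 := by
  rw [prefixSum]

theorem prefixSum_succ (n : ℕ) :
    prefixSum d (n + 1) = 2 * prefixSum d n + 1 + prefixSum d (n - d) := by
  rw [prefixSum]

theorem zeroLen_eq (n : ℕ) : zeroLen d n = 1 + prefixSum d n + prefixSum d (n - d) := rfl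

theorem prefixSum_succ' (n : ℕ) : prefixSum d (n + 1) = prefixSum d n + zeroLen d n := by
  rw [prefixSum_succ, zeroLen_eq]
  omega

theorem prefixSum_add_one {n : ℕ} (hn : n ≤ d) : prefixSum d n + 1 = 2 ^ n := by
  induction n with
  | zero => simp [prefixSum_zero]
  | succ n ih =>
    rw [prefixSum_succ, show n - d = 0 by omega, prefixSum_zero, pow_succ, ← ih (by omega)]
    ring

theorem zeroLen_of_le {n : ℕ} (hn : n ≤ d) : zeroLen d n = 2 ^ n := by
  rw [zeroLen_eq, show n - d = 0 by omega, prefixSum_zero, ← prefixSum_add_one d hn]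
  omega

theorem zeroLen_succ (n : ℕ) :
    zeroLen d (n + 1) = 2 * zeroLen d n + if n < d then 0 else zeroLen d (n - d) := by
  rw [zeroLen_eq d (n + 1), prefixSum_succ']
  have := zeroLen_eq d n
  split_ifs with h
  · rw [show n + 1 - d = 0 by omega, prefixSum_zero]
    rw [show n - d = 0 by omega, prefixSum_zero] at this
    omega
  · rw [show n + 1 - d = n - d + 1 by omega, prefixSum_succ']
    omega

theorem zeroLen_add_succ (n : ℕ) : zeroLen d (n + d + 1) = 2 * zeroLen d (n + d) + zeroLen d n := by
  rw [zeroLen_succ, if_neg (by omega), Nat.add_sub_cancel]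

/-- This is what the weights are made for: a power of φ gives e the weight of 0 under the power d
steps higher, which closes the recurrence for `zeroLen` at order d+1. -/
theorem imageLen_top (n : ℕ) : imageLen d n (2 * d) = zeroLen d (n + d) := by
  rw [zeroLen_eq, imageLen, show n + 2 * d - d = n + d by omega, Nat.add_sub_cancel]
  omega

theorem prefixSum_mono : Monotone (prefixSum d) :=
  monotone_nat_of_le_succ fun n => by
    rw [prefixSum_succ']
    omega

theorem zeroLen_mono : Monotone (zeroLen d) :=
  monotone_nat_of_le_succ fun n => by
    rw [zeroLen_succ]
    omega

theorem one_le_zeroLen (n : ℕ) : 1 ≤ zeroLen d n := by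
  rw [zeroLen_eq]
  omega

theorem zeroLen_le_imageLen (n i : ℕ) : zeroLen d n ≤ imageLen d n i := by
  rw [zeroLen_eq, imageLen]
  have := prefixSum_mono d (show n - d ≤ n + i - d by omega)
  omega

theorem imageLen_le_top (n : ℕ) {i : ℕ} (hi : i ≤ 2 * d) :
    imageLen d n i ≤ imageLen d n (2 * d) := by
  rw [imageLen, imageLen]
  have := prefixSum_mono d (show n + i - d ≤ n + 2 * d - d by omega)
  omega

theorem imageLen_succ (n i : ℕ) :
    imageLen d (n + 1) i = zeroLen d n + imageLen d n (i + 1) := by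
  rw [imageLen, imageLen, prefixSum_succ', show n + 1 + i - d = n + (i + 1) - d by omega]
  omega

theorem imageLen_succ_top (n : ℕ) :
    imageLen d (n + 1) (2 * d) = zeroLen d n + 2 * imageLen d n (2 * d) := by
  rw [imageLen_top, imageLen_top, show n + 1 + d = n + d + 1 by omega, zeroLen_add_succ]
  omega

theorem imageLen_zero {i : ℕ} (hi : i ≤ 2 * d) :
    imageLen d 0 i = if i < d then 1 else 2 ^ (i - d) := by
  rw [imageLen, prefixSum_zero, zero_add]
  split_ifs with h
  · rw [show i - d = 0 by omega, prefixSum_zero]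
  · have := prefixSum_add_one d (show i - d ≤ d by omega)
    omega

theorem two_pow_le_zeroLen (n : ℕ) : 2 ^ n ≤ zeroLen d n := by
  induction n with
  | zero => exact one_le_zeroLen d 0
  | succ n ih =>
    rw [zeroLen_succ, pow_succ]
    omega

theorem extLen_of_lt {n : ℕ} (h : n < 2 * d) : extLen d n = 0 := by
  rw [extLen, dif_pos (.inl h)]

theorem extLen_add (hd : 1 ≤ d) (n : ℕ) :
    extLen d (n + 2 * d) = zeroLen d (n + d) + extLen d n := by
  rw [extLen, dif_neg (by omega), Nat.add_sub_cancel, show n + 2 * d - d = n + d by omega]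

theorem extLen_mono (hd : 1 ≤ d) : Monotone (extLen d) := by
  refine monotone_nat_of_le_succ fun n => ?_
  induction n using Nat.strong_induction_on with
  | _ n ih =>
  rcases Nat.lt_or_ge n (2 * d) with h | h
  · rw [extLen_of_lt d h]
    omega
  · obtain ⟨m, rfl⟩ := Nat.exists_eq_add_of_le' h
    rw [extLen_add d hd, show m + 2 * d + 1 = m + 1 + 2 * d by omega, extLen_add d hd]
    have := ih m (by omega)
    have := zeroLen_mono d (show m + d ≤ m + 1 + d by omega)
    omega

theorem extLen_add_le (hd : 1 ≤ d) (n : ℕ) {b : ℕ} (hb : b ≤ 2 * d) :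
    extLen d (n + b) ≤ zeroLen d (n + d) + extLen d n := by
  rw [← extLen_add d hd]
  exact extLen_mono d hd (by omega)

/-- In steps of 2d the error term reproduces itself: with Z = `zeroLen`, the recurrence gives 3
Z(m+d) - Z(m+d+1) = Z(m+d) - Z(m), the difference of the prefix sums at m+d and m-d. -/
theorem three_mul_extLen_le (hd : 1 ≤ d) (n : ℕ) :
    3 * extLen d n ≤ extLen d (n + 1) + prefixSum d (n - d) := by
  induction n using Nat.strong_induction_on with
  | _ n ih =>
  rcases Nat.lt_or_ge n (2 * d) with h | h
  · rw [extLen_of_lt d h]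
    omega
  · obtain ⟨m, rfl⟩ := Nat.exists_eq_add_of_le' h
    have h1 := ih m (by omega)
    have h2 := zeroLen_add_succ d m
    have h3 := zeroLen_eq d (m + d)
    have h4 := zeroLen_eq d m
    rw [Nat.add_sub_cancel] at h3
    rw [extLen_add d hd, show m + 2 * d + 1 = m + 1 + 2 * d by omega, extLen_add d hd,
      show m + 2 * d - d = m + d by omega, show m + 1 + d = m + d + 1 by omega]
    omega

theorem excess_succ_ge (hd : 1 ≤ d) (n : ℕ) :
    3 * excess d n + 2 ≤ excess d (n + 1) + zeroLen d n := by
  have h1 := three_mul_extLen_le d hd n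
  have h2 := zeroLen_eq d n
  have h3 := prefixSum_succ' d n
  unfold excess
  omega

theorem excess_add (hd : 1 ≤ d) (n : ℕ) :
    excess d (n + 2 * d) = excess d n + zeroLen d (n + 2 * d) + zeroLen d (n + d) := by
  have h1 := extLen_add d hd n
  have h2 := zeroLen_eq d (n + 2 * d)
  have h3 := zeroLen_eq d (n + d)
  rw [show n + 2 * d - d = n + d by omega] at h2
  rw [Nat.add_sub_cancel] at h3
  unfold excess
  omega

end Lengths

/-! ### Bounded deviations and the slack inequality -/

section Analysis

/-- The deviation of the weighted lengths from a geometric progression with ratio `x`, where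
`x ^ d * (x - 2) = 1`. -/
noncomputable def deviation (d : ℕ) (x : ℝ) (n : ℕ) : ℝ :=
  (if n < d then 0 else (zeroLen d (n - d) : ℝ)) - (x - 2) * zeroLen d n

variable {d : ℕ} {x : ℝ} (hd : 3 ≤ d) (hx : 2 < x) (hroot : x ^ d * (x - 2) = 1)

/-- Both terms satisfy the recurrence of `zeroLen`; the value 0 for the shifted term below `d` is
the one that fits. -/
theorem deviation_add_succ (d : ℕ) (x : ℝ) (n : ℕ) :
    deviation d x (n + d + 1) = 2 * deviation d x (n + d) + deviation d x n := by
  unfold deviation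
  rw [if_neg (by omega), if_neg (by omega), zeroLen_add_succ, Nat.add_sub_cancel,
    show n + d + 1 - d = n + 1 by omega, zeroLen_succ]
  push_cast
  split_ifs <;> ring

/-- Since x^(-d) = x - 2, the combination cancels the part growing like x^n. What is left obeys the
recurrence of the quotient of t^d (t-2) - 1 by t - x, whose coefficients below the leading one are
(x-2) x^(d-1-i). -/
theorem deviation_deflated (hroot : x ^ d * (x - 2) = 1) (n : ℕ) :
    deviation d x (n + d) +
      (x - 2) * ∑ i ∈ Finset.range d, deviation d x (n + i) * x ^ (d - 1 - i) = 0 := by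
  induction n with
  | zero =>
    have h1 : ∑ i ∈ Finset.range d, deviation d x (0 + i) * x ^ (d - 1 - i) =
        -(x - 2) * ∑ i ∈ Finset.range d, (2 : ℝ) ^ i * x ^ (d - 1 - i) := by
      rw [Finset.mul_sum]
      refine Finset.sum_congr rfl fun i hi => ?_
      have hi' := Finset.mem_range.1 hi
      rw [zero_add, deviation, if_pos hi', zeroLen_of_le d hi'.le]
      push_cast
      ring
    have h2 := (Commute.all (2 : ℝ) x).geom_sum₂_mul d
    have h3 : deviation d x (0 + d) = 1 - (x - 2) * 2 ^ d := by
      rw [zero_add, deviation, if_neg (by omega), Nat.sub_self, zeroLen_of_le d le_rfl,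
        zeroLen_of_le d (Nat.zero_le d)]
      push_cast
      ring
    rw [h1, h3]
    linear_combination (x - 2) * h2 - hroot
  | succ n ih =>
    have h1 := Finset.sum_range_succ (fun i => deviation d x (n + i) * x ^ (d - i)) d
    rw [Finset.sum_range_succ'] at h1
    have h2 : ∑ i ∈ Finset.range d, deviation d x (n + i) * x ^ (d - i) =
        x * ∑ i ∈ Finset.range d, deviation d x (n + i) * x ^ (d - 1 - i) := by
      rw [Finset.mul_sum]
      refine Finset.sum_congr rfl fun i hi => ?_
      have hi' := Finset.mem_range.1 hi
      rw [show d - i = d - 1 - i + 1 by omega, pow_succ]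
      ring
    have h3 : ∑ i ∈ Finset.range d, deviation d x (n + (i + 1)) * x ^ (d - (i + 1)) =
        ∑ i ∈ Finset.range d, deviation d x (n + 1 + i) * x ^ (d - 1 - i) := by
      refine Finset.sum_congr rfl fun i _ => ?_
      rw [show n + (i + 1) = n + 1 + i by omega, show d - (i + 1) = d - 1 - i by omega]
    have h4 := deviation_add_succ d x n
    rw [h2, h3] at h1
    simp only [add_zero, Nat.sub_zero, Nat.sub_self, pow_zero, mul_one] at h1
    rw [show n + 1 + d = n + d + 1 by omega]
    linear_combination x * ih + (x - 2) * h1 + h4 - deviation d x n * hroot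

include hx hroot

theorem root_sub_two_le (hd : 3 ≤ d) : x - 2 ≤ 1 / 8 := by
  have h1 : (2 : ℝ) ^ d ≤ x ^ d := pow_le_pow_left₀ (by norm_num) hx.le d
  have h2 : (2 : ℝ) ^ 3 ≤ 2 ^ d := pow_le_pow_right₀ (by norm_num) hd
  nlinarith

/-- The coefficients of the deflated recurrence add up to (x-2)(x^d - 1)/(x-1) = (3-x)/(x-1) ≤ 1, so
a bound on d consecutive terms persists. Initially (x-2) 2^n ≤ 1/2, because 2^(n+1) ≤ x^d for n < d.
-/
theorem abs_deviation_le (n : ℕ) : |deviation d x n| ≤ 1 / 2 := by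
  have hb : 0 < x - 2 := by linarith
  induction n using Nat.strong_induction_on with
  | _ n ih =>
  rcases Nat.lt_or_ge n d with h | h
  · rw [deviation, if_pos h, zeroLen_of_le d h.le]
    have h1 : (x : ℝ) - 2 > 0 := hb
    have h2 : (2 : ℝ) ^ (n + 1) ≤ x ^ d :=
      (pow_le_pow_right₀ (by norm_num) (by omega : n + 1 ≤ d)).trans
        (pow_le_pow_left₀ (by norm_num) hx.le d)
    push_cast
    rw [zero_sub, abs_neg, abs_of_pos (by positivity)]
    rw [pow_succ] at h2
    nlinarith
  · obtain ⟨m, rfl⟩ := Nat.exists_eq_add_of_le' h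
    have h1 := deviation_deflated hroot m
    have h2 : |∑ i ∈ Finset.range d, deviation d x (m + i) * x ^ (d - 1 - i)| ≤
        ∑ i ∈ Finset.range d, 1 / 2 * ((1 : ℝ) ^ i * x ^ (d - 1 - i)) := by
      refine (Finset.abs_sum_le_sum_abs _ _).trans (Finset.sum_le_sum fun i hi => ?_)
      have hi' := Finset.mem_range.1 hi
      have hp : (0 : ℝ) < x ^ (d - 1 - i) := by positivity
      rw [abs_mul, abs_of_pos hp, one_pow, one_mul]
      exact mul_le_mul_of_nonneg_right (ih _ (by omega)) hp.le
    rw [← Finset.mul_sum] at h2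
    have h3 := (Commute.all (1 : ℝ) x).geom_sum₂_mul d
    set T := ∑ i ∈ Finset.range d, deviation d x (m + i) * x ^ (d - 1 - i)
    set R := ∑ i ∈ Finset.range d, (1 : ℝ) ^ i * x ^ (d - 1 - i)
    rw [one_pow] at h3
    have h4 : deviation d x (m + d) = -((x - 2) * T) := by linarith
    have h5 : (x - 2) * R ≤ 1 := by
      have h6 : (x - 2) * R * (x - 1) = 1 - (x - 2) := by linear_combination -(x - 2) * h3 + hroot
      nlinarith
    rw [h4, abs_neg, abs_mul, abs_of_pos hb]
    nlinarith

/-- The slack in the inequality between the extension of a repetition and its period. -/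
noncomputable def slack (d : ℕ) (x : ℝ) (n : ℕ) : ℝ :=
  (x - 2) * zeroLen d (n + d) - (3 - x) * excess d n

omit hx hroot in
theorem deviation_add (d : ℕ) (x : ℝ) (n : ℕ) :
    deviation d x (n + d) = zeroLen d n - (x - 2) * zeroLen d (n + d) := by
  rw [deviation, if_neg (by omega), Nat.add_sub_cancel]

/-- Inserting `excess_succ_ge` gives 3 times the slack, plus a deviation of at most 1/2, minus
2(3-x) ≥ 7/4. -/
theorem slack_succ_le (hd : 3 ≤ d) (n : ℕ) : slack d x (n + 1) ≤ 3 * slack d x n - 5 / 4 := by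
  have h1 := excess_succ_ge d (by omega : 1 ≤ d) n
  have h1' : (3 * excess d n + 2 : ℝ) ≤ excess d (n + 1) + zeroLen d n := by exact_mod_cast h1
  have h2 := zeroLen_add_succ d n
  have h2' : (zeroLen d (n + 1 + d) : ℝ) = 2 * zeroLen d (n + d) + zeroLen d n := by
    rw [show n + 1 + d = n + d + 1 by omega]
    exact_mod_cast h2
  have h3 := (abs_le.1 (abs_deviation_le hx hroot (n + d))).2
  rw [deviation_add] at h3
  have h4 := root_sub_two_le hx hroot hd
  unfold slack
  rw [h2']
  nlinarith

/-- Over 2d steps the growth of `excess` cancels that of `zeroLen` up to two deviations. -/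
theorem abs_slack_add_sub_le (hd : 1 ≤ d) (n : ℕ) : |slack d x (n + 2 * d) - slack d x n| ≤ 1 := by
  have h1 := abs_deviation_le hx hroot (n + d + d)
  have h2 := abs_deviation_le hx hroot (n + 2 * d + d)
  have h3 := excess_add d hd n
  have h3' : (excess d (n + 2 * d) : ℝ) =
      excess d n + zeroLen d (n + 2 * d) + zeroLen d (n + d) := by exact_mod_cast h3
  have h4 : slack d x (n + 2 * d) - slack d x n =
      -(deviation d x (n + d + d)) - deviation d x (n + 2 * d + d) := by
    rw [deviation_add, deviation_add, slack, slack, h3', show n + d + d = n + 2 * d by omega]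
    ring
  rw [h4]
  rw [abs_le] at *
  constructor <;> linarith

theorem exists_abs_slack_le (hd : 1 ≤ d) : ∃ C : ℝ, 0 ≤ C ∧ ∀ n, |slack d x n| ≤ C + n := by
  refine ⟨∑ m ∈ Finset.range (2 * d), |slack d x m|, Finset.sum_nonneg fun _ _ => abs_nonneg _,
    fun n => ?_⟩
  induction n using Nat.strong_induction_on with
  | _ n ih =>
  rcases Nat.lt_or_ge n (2 * d) with h | h
  · have := Finset.single_le_sum (f := fun m => |slack d x m|) (fun _ _ => abs_nonneg _)
      (Finset.mem_range.2 h)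
    have h2 : (0 : ℝ) ≤ n := by positivity
    linarith
  · obtain ⟨m, rfl⟩ := Nat.exists_eq_add_of_le' h
    have h1 := ih m (by omega)
    have h2 := abs_slack_add_sub_le hx hroot hd m
    have h3 := abs_sub_abs_le_abs_sub (slack d x (m + 2 * d)) (slack d x m)
    have h4 : (1 : ℝ) ≤ 2 * d := by exact_mod_cast (by omega : 1 ≤ 2 * d)
    push_cast
    linarith

omit hx hroot in
theorem exists_three_pow_gt {ε : ℝ} (hε : 0 < ε) (K : ℝ) : ∃ r : ℕ, K + r < 3 ^ r * ε := by
  obtain ⟨t, ht⟩ := exists_nat_gt (max K (1 / ε))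
  have h1 : K < t := (le_max_left _ _).trans_lt ht
  have h2 : 1 / ε < t := (le_max_right _ _).trans_lt ht
  rw [div_lt_iff₀ hε] at h2
  refine ⟨2 * t, ?_⟩
  have h3 : 1 + (t : ℝ) * 2 ≤ (1 + 2) ^ t := one_add_mul_le_pow (by norm_num) t
  have h4 : (3 : ℝ) ^ (2 * t) = (1 + 2) ^ t * (1 + 2) ^ t := by
    rw [two_mul, pow_add]
    norm_num
  have ht0 : (0 : ℝ) ≤ t := by positivity
  have h5 : (1 + (t : ℝ) * 2) * (1 + (t : ℝ) * 2) ≤ 3 ^ (2 * t) := by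
    rw [h4]
    exact mul_le_mul h3 h3 (by positivity) (by positivity)
  push_cast
  nlinarith [mul_le_mul_of_nonneg_right h5 hε.le]

/-- The number 5/8 is the fixed point of y ↦ 3y - 5/4. Below it the recursion would drive the slack
to -∞ at rate 3^r, against its linear bound. -/
theorem slack_ge (hd : 3 ≤ d) (n : ℕ) : 5 / 8 ≤ slack d x n := by
  by_contra hlt
  push Not at hlt
  have h1 : ∀ r : ℕ, slack d x (n + r) ≤ 5 / 8 - 3 ^ r * (5 / 8 - slack d x n) := by
    intro r
    induction r with
    | zero => simp
    | succ r ih =>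
      have := slack_succ_le hx hroot hd (n + r)
      rw [← add_assoc, pow_succ]
      linarith
  obtain ⟨C, hC, hle⟩ := exists_abs_slack_le hx hroot (by omega : 1 ≤ d)
  obtain ⟨r, hr⟩ := exists_three_pow_gt (sub_pos.2 hlt) (5 / 8 + C + n)
  have h2 := h1 r
  have h3 := (abs_le.1 (hle (n + r))).1
  push_cast at h3
  linarith

theorem excess_le_top (hd : 3 ≤ d) (n : ℕ) :
    (3 - x) * excess d n ≤ (x - 2) * zeroLen d (n + d) := by
  have := slack_ge hx hroot hd n
  unfold slack at this
  linarith

/-- Replacing (x-2) Z(n+d) by Z(n) costs at most 1/2, which the margin 5/8 of the slack covers. -/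
theorem excess_le_zeroLen (hd : 3 ≤ d) (n : ℕ) : (3 - x) * excess d n ≤ zeroLen d n := by
  have h1 := slack_ge hx hroot hd n
  have h2 := (abs_le.1 (abs_deviation_le hx hroot (n + d))).1
  rw [deviation_add] at h2
  unfold slack at h1
  linarith

/-- The slack grows at most linearly and the weights at least like 2^n, so the inequality is
asymptotically sharp. -/
theorem exists_excess_ge (hd : 3 ≤ d) {ε : ℝ} (hε : 0 < ε) (N : ℕ) :
    ∃ n ≥ N, (x - 2 - ε) * zeroLen d (n + d) ≤ (3 - x) * excess d n := by
  obtain ⟨C, hC, hle⟩ := exists_abs_slack_le hx hroot (by omega : 1 ≤ d)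
  have key : Filter.Tendsto (fun n : ℕ => (C + (n : ℝ)) / 2 ^ n) Filter.atTop (nhds 0) := by
    have h1 := tendsto_pow_const_div_const_pow_of_one_lt 1 (r := (2 : ℝ)) (by norm_num)
    have h2 := tendsto_pow_const_div_const_pow_of_one_lt 0 (r := (2 : ℝ)) (by norm_num)
    have h3 := (h2.const_mul C).add h1
    simp only [mul_zero, add_zero] at h3
    refine h3.congr fun n => ?_
    simp only [pow_zero, pow_one]
    ring
  obtain ⟨n, h1, h2⟩ := ((key.eventually (gt_mem_nhds hε)).and
    (Filter.eventually_ge_atTop N)).exists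
  refine ⟨n, h2, ?_⟩
  have h3 := (abs_le.1 (hle n)).2
  have h4 : (2 : ℝ) ^ n ≤ zeroLen d (n + d) := by
    have := two_pow_le_zeroLen d (n + d)
    have h5 : (2 : ℕ) ^ n ≤ 2 ^ (n + d) := Nat.pow_le_pow_right (by norm_num) (by omega)
    exact_mod_cast h5.trans this
  rw [div_lt_iff₀ (by positivity)] at h1
  unfold slack at h3
  nlinarith

end Analysis

/-! ### Weights of prefixes and extensions of repetitions -/

/-- The weighted length of the image of the prefix of length `p` of `U` under the `n`-th power of
the morphism. -/
def prefixWeight (d : ℕ) (U : ℕ → ℕ) (n p : ℕ) : ℕ :=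
  ∑ t ∈ Finset.range p, imageLen d n (U t)

section Weight

variable {d : ℕ} {U s : ℕ → ℕ}

theorem prefixWeight_zero (n : ℕ) : prefixWeight d U n 0 = 0 := by
  simp [prefixWeight]

theorem prefixWeight_succ (n p : ℕ) :
    prefixWeight d U n (p + 1) = prefixWeight d U n p + imageLen d n (U p) := by
  rw [prefixWeight, Finset.sum_range_succ]
  rfl

theorem prefixWeight_mono (n : ℕ) : Monotone (prefixWeight d U n) :=
  monotone_nat_of_le_succ fun p => by
    rw [prefixWeight_succ]
    omega

theorem Agree.prefixWeight {i j r : ℕ} (h : Agree U i j r) (n : ℕ) {t : ℕ} (ht : t ≤ r) :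
    prefixWeight d U n (i + t) + prefixWeight d U n j =
      prefixWeight d U n (j + t) + prefixWeight d U n i := by
  induction t with
  | zero => simp only [add_zero]; omega
  | succ t ih =>
    have := ih (by omega)
    rw [← add_assoc, ← add_assoc, prefixWeight_succ, prefixWeight_succ, h t (by omega)]
    omega

theorem imageLen_le_of_mem {n i j t : ℕ} (h1 : i ≤ t) (h2 : t < j) :
    imageLen d n (U t) + prefixWeight d U n i ≤ prefixWeight d U n j := by
  have h3 := prefixWeight_mono (d := d) (U := U) n h1
  have h4 := prefixWeight_mono (d := d) (U := U) n (show t + 1 ≤ j by omega)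
  rw [prefixWeight_succ] at h4
  omega

theorem imageLen_add_le_of_mem {n i j t t' : ℕ} (h1 : i ≤ t) (h2 : t < t') (h3 : t' < j) :
    imageLen d n (U t) + imageLen d n (U t') + prefixWeight d U n i ≤ prefixWeight d U n j := by
  have h4 := imageLen_le_of_mem (d := d) (U := U) (n := n) h1 h2
  have h5 := imageLen_le_of_mem (d := d) (U := U) (n := n) (le_refl t') h3
  omega

end Weight

theorem exists_left_maximal (U : ℕ → ℕ) {i j : ℕ} (hij : i < j) : ∃ a ≤ i, Agree U a (j - (i - a)) (i - a) ∧
    (a = 0 ∨ U (a - 1) ≠ U (j - (i - a) - 1)) := by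
  classical
  have hexl : ∃ a, a ≤ i ∧ Agree U a (j - (i - a)) (i - a) :=
    ⟨i, le_rfl, fun t ht => by omega⟩
  obtain ⟨hl1, hl2⟩ := Nat.find_spec hexl
  have hl3 : ∀ a < Nat.find hexl, ¬ (a ≤ i ∧ Agree U a (j - (i - a)) (i - a)) :=
    fun a ht => Nat.find_min hexl ht
  generalize Nat.find hexl = a at *
  refine ⟨a, hl1, hl2, ?_⟩
  by_contra hcon
  push Not at hcon
  refine hl3 (a - 1) (by omega) ⟨by omega, fun t ht => ?_⟩
  rcases Nat.eq_zero_or_pos t with rfl | h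
  · rw [add_zero, add_zero, show j - (i - (a - 1)) = j - (i - a) - 1 by omega]
    exact hcon.2
  · have := hl2 (t - 1) (by omega)
    rwa [show a + (t - 1) = a - 1 + t by omega,
      show j - (i - a) + (t - 1) = j - (i - (a - 1)) + t by omega] at this

namespace Subst

variable {d : ℕ} {U s : ℕ → ℕ} (S : Subst (2 * d) U s)
include S

theorem prefixWeight_pos (n m : ℕ) : prefixWeight d U n (s m) = prefixWeight d U (n + 1) m := by
  induction m with
  | zero => rw [S.pos_zero, prefixWeight_zero, prefixWeight_zero]
  | succ m ih =>
    rw [prefixWeight_succ]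
    rcases S.pos_succ_cases m with ⟨h1, h2⟩ | ⟨h1, h2⟩
    · rw [h2, prefixWeight_succ, prefixWeight_succ, prefixWeight_succ, ih, S.at_pos, S.at_succ,
        S.at_two m h1, h1, imageLen_succ_top, show min (2 * d + 1) (2 * d) = 2 * d by omega]
      change _ + zeroLen d n + _ + _ = _
      omega
    · rw [h2, prefixWeight_succ, prefixWeight_succ, ih, S.at_pos, S.at_succ, imageLen_succ,
        show min (U m + 1) (2 * d) = U m + 1 by omega]
      change _ + zeroLen d n + _ = _
      omega

/-- Extension to the right of a repetition under the morphism. -/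
theorem right_extension (hd : 1 ≤ d) {m m' : ℕ} (h : U m ≠ U m') :
    ∃ q, 1 ≤ q ∧ (∀ t < q, U (s m + t) = U (s m' + t)) ∧ U (s m + q) ≠ U (s m' + q) ∧
      ∀ n, prefixWeight d U n (s m + q) + extLen d (n + min (U (s m + q)) (U (s m' + q))) =
        prefixWeight d U n (s m) + zeroLen d n + extLen d (n + 1 + min (U m) (U m')) := by
  have h1 := S.le m
  have h2 := S.le m'
  have h3 := S.at_succ m
  have h4 := S.at_succ m'
  have h5 := S.at_pos m
  have h6 := S.at_pos m'
  -- Only the images 0e and 0ee of e-1 and e share more than the letter 0. The common e has the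
  -- weight split off from `extLen`, and the next mismatch is between 0 and e.
  by_cases hq : min (U m) (U m') = 2 * d - 1
  · refine ⟨2, by omega, fun t ht => ?_, ?_, fun n => ?_⟩
    · interval_cases t
      · rw [add_zero, add_zero, h5, h6]
      · omega
    · rcases h.lt_or_gt with h | h
      · rw [S.at_two_eq_zero (by omega), S.at_two m' (by omega)]
        omega
      · rw [S.at_two_eq_zero (n := m') (by omega), S.at_two m (by omega)]
        omega
    · have h7 : min (U (s m + 2)) (U (s m' + 2)) = 0 := by
        rcases h.lt_or_gt with h | h
        · rw [S.at_two_eq_zero (by omega)]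
          omega
        · rw [S.at_two_eq_zero (n := m') (by omega)]
          omega
      rw [h7, hq, show s m + 2 = s m + 1 + 1 by omega, prefixWeight_succ, prefixWeight_succ, h5, h3,
        show min (U m + 1) (2 * d) = 2 * d by omega, imageLen_top,
        show n + 1 + (2 * d - 1) = n + 2 * d by omega, extLen_add d hd, add_zero]
      change _ + zeroLen d n + _ + _ = _
      omega
  · refine ⟨1, by omega, fun t ht => ?_, by omega, fun n => ?_⟩
    · obtain rfl : t = 0 := by omega
      rw [add_zero, add_zero, h5, h6]
    · rw [h3, h4, prefixWeight_succ, h5, zeroLen,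
        show n + min (min (U m + 1) (2 * d)) (min (U m' + 1) (2 * d)) = n + 1 + min (U m) (U m') by
          omega]

/-- Extension to the left of a repetition under the morphism. -/
theorem left_extension (hd : 1 ≤ d) {m m' : ℕ} (hm : 1 ≤ m) (hm' : 1 ≤ m')
    (h : U (m - 1) ≠ U (m' - 1)) :
    ∃ q, q ≤ 1 ∧ (∀ t < q, U (s m - 1 - t) = U (s m' - 1 - t)) ∧
      U (s m - q - 1) ≠ U (s m' - q - 1) ∧
      ∀ n, prefixWeight d U n (s m) +
          extLen d (n + min (U (s m - q - 1)) (U (s m' - q - 1))) =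
        prefixWeight d U n (s m - q) + extLen d (n + 1 + min (U (m - 1)) (U (m' - 1))) := by
  have h1 := S.le (m - 1)
  have h2 := S.le (m' - 1)
  have h3 := S.at_pred hm
  have h4 := S.at_pred hm'
  have h5 := S.one_le_pos hm
  have h6 := S.one_le_pos hm'
  have hlow : ∀ k, 1 ≤ k → U (k - 1) < 2 * d → U (s k - 1 - 1) = 0 := by
    intro k hk hk2
    have := S.pos_succ_ne hk2.ne
    rw [show k - 1 + 1 = k by omega] at this
    rw [show s k - 1 - 1 = s (k - 1) by omega, S.at_pos]
  have htop : ∀ k, 1 ≤ k → U (k - 1) = 2 * d → U (s k - 1 - 1) = 2 * d := by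
    intro k hk hk2
    have := S.at_pred_two hk hk2
    rw [show s k - 1 - 1 = s (k - 1) + 1 by omega, S.at_succ]
    omega
  -- Only e-1 and e have images with the same last letter; before this common e stand 0 and e.
  by_cases hq : min (U (m - 1)) (U (m' - 1)) = 2 * d - 1
  · have h7 : U (s m - 1 - 1) ≠ U (s m' - 1 - 1) ∧ min (U (s m - 1 - 1)) (U (s m' - 1 - 1)) = 0 := by
      rcases h.lt_or_gt with h | h
      · rw [hlow m hm (by omega), htop m' hm' (by omega)]
        omega
      · rw [hlow m' hm' (by omega), htop m hm (by omega)]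
        omega
    refine ⟨1, le_rfl, fun t ht => ?_, h7.1, fun n => ?_⟩
    · obtain rfl : t = 0 := by omega
      rw [Nat.sub_zero, Nat.sub_zero, h3, h4]
      omega
    · rw [h7.2, hq, show n + 1 + (2 * d - 1) = n + 2 * d by omega, extLen_add d hd]
      have h8 := prefixWeight_succ (d := d) (U := U) n (s m - 1)
      rw [h3, show min (U (m - 1) + 1) (2 * d) = 2 * d by omega, imageLen_top,
        show s m - 1 + 1 = s m by omega] at h8
      rw [h8, add_zero]
      omega
  · refine ⟨0, by omega, fun t ht => by omega, ?_, fun n => ?_⟩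
    · rw [Nat.sub_zero, Nat.sub_zero, h3, h4]
      omega
    · rw [Nat.sub_zero, Nat.sub_zero, h3, h4, show n + min (min (U (m - 1) + 1) (2 * d))
        (min (U (m' - 1) + 1) (2 * d)) = n + 1 + min (U (m - 1)) (U (m' - 1)) by omega]

/-- The sequence `U` is not eventually periodic. -/
theorem not_eventually_periodic {i j : ℕ} (hij : i < j) : ∃ t, U (i + t) ≠ U (j + t) := by
  by_contra hcon
  push Not at hcon
  obtain ⟨q, hq⟩ : ∃ q, q = j - i := ⟨_, rfl⟩
  induction q using Nat.strong_induction_on generalizing i j with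
  | _ q ih =>
  -- Infinite descent: images have length at least 2, so desubstitution at least halves the period.
  obtain ⟨i', hi'⟩ : ∃ i', i ≤ s i' := ⟨i, by simpa using (S.strictMono.le_apply : i ≤ s i)⟩
  have h0 : U (j + (s i' - i)) = 0 := by
    rw [← hcon, show i + (s i' - i) = s i' by omega, S.at_pos]
  obtain ⟨j', hj'⟩ := S.exists_pos_of_eq_zero h0
  have hij' : i' < j' := S.lt_iff.1 (by omega)
  obtain ⟨k, rfl⟩ := Nat.exists_eq_add_of_lt hij'
  have h1 := S.add_two_le i' (k + 1)
  rw [← add_assoc] at h1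
  refine ih (i' + k + 1 - i') (by omega) hij' (fun t => ?_) rfl
  have hle := S.le_iff.2 (show i' ≤ i' + (t + 1) by omega)
  have h2 := (S.agree_preimage (m := i') (n := i' + k + 1) (r := t + 1)
    (R := s (i' + (t + 1)) - s i') (fun y _ => ?_) (by omega)).1
  · exact h2 t (by omega)
  · have := hcon (s i' - i + y)
    rwa [← add_assoc, ← add_assoc, show i + (s i' - i) = s i' by omega, hj'] at this

/-- Desubstitution of a repetition whose overlap contains the letter `0`. -/
theorem exists_core_of_repetition {i j r z : ℕ} (ha : Agree U i j r) (hz : z < r)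
    (hz0 : U (i + z) = 0) : ∃ f g i' j' r', f ≤ g ∧ g < r ∧ i + f = s i' ∧ j + f = s j' ∧
      i + g = s (i' + r') ∧ j + g = s (j' + r') ∧ Agree U i' j' r' ∧
      (∀ t < f, U (i + t) ≠ 0) ∧ ∀ t, g < t → t < r → U (i + t) ≠ 0 := by
  classical
  have hex : ∃ t, U (i + t) = 0 := ⟨z, hz0⟩
  have hf0 : U (i + Nat.find hex) = 0 := Nat.find_spec hex
  have hfz : Nat.find hex ≤ z := Nat.find_min' hex hz0
  have hfmin : ∀ t < Nat.find hex, U (i + t) ≠ 0 := fun t ht => Nat.find_min hex ht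
  generalize Nat.find hex = f at *
  have hex' : ∃ t, t < r ∧ U (i + (r - 1 - t)) = 0 :=
    ⟨r - 1 - z, by omega, by rwa [show r - 1 - (r - 1 - z) = z by omega]⟩
  obtain ⟨hk1, hk2⟩ := Nat.find_spec hex'
  have hkz : Nat.find hex' ≤ r - 1 - z :=
    Nat.find_min' hex' ⟨by omega, by rwa [show r - 1 - (r - 1 - z) = z by omega]⟩
  have hkmin : ∀ t < Nat.find hex', ¬ (t < r ∧ U (i + (r - 1 - t)) = 0) :=
    fun t ht => Nat.find_min hex' ht
  generalize Nat.find hex' = k at *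
  obtain ⟨i', hi'⟩ := S.exists_pos_of_eq_zero hf0
  obtain ⟨m, hm⟩ := S.exists_pos_of_eq_zero hk2
  have him : i' ≤ m := S.le_iff.1 (by omega)
  obtain ⟨r', rfl⟩ := Nat.exists_eq_add_of_le him
  obtain ⟨j', hj'⟩ := S.exists_pos_of_eq_zero (p := j + f) (by rw [← ha f (by omega), hf0])
  have h1 : Agree U (s i') (s j') (r - 1 - k - f + 1) := by
    intro t ht
    have := ha (f + t) (by omega)
    rwa [← add_assoc, ← add_assoc, hi', hj'] at this
  obtain ⟨h2, h3⟩ := S.agree_preimage h1 (r := r') (by omega)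
  refine ⟨f, r - 1 - k, i', j', r', by omega, by omega, hi', hj', hm, by omega, h2, hfmin,
    fun t ht1 ht2 h0 => ?_⟩
  exact hkmin (r - 1 - t) (by omega) ⟨by omega, by rwa [show r - 1 - (r - 1 - t) = t by omega]⟩

/-! ### The upper bound for repetitions -/

/-- The smaller one of the letters that precede the positions `i` and `j`. -/
def leftMin (U : ℕ → ℕ) (i j : ℕ) : ℕ :=
  if i = 0 then 0 else min (U (i - 1)) (U (j - 1))

/-- A positive minimum on one side, unless it involves ee directly, is refuted by zeros alternating
with nonzero letters. Where ee does appear, one of its letters e lies in the period beside another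
letter, and this extra weight pays for the larger extension. -/
theorem seed_bound {i j : ℕ} (hij : i < j) (hr : U i ≠ U j)
    (hl : i = 0 ∨ U (i - 1) ≠ U (j - 1)) :
    (leftMin U i j = 0 ∧ min (U i) (U j) = 0) ∨
      ((leftMin U i j = 0 ∨ min (U i) (U j) = 0) ∧ ∀ n, zeroLen d n + zeroLen d (n + d) +
        prefixWeight d U n i ≤ prefixWeight d U n j) := by
  have he := S.two_le
  have hU0 : U 0 = 0 := by
    have := S.at_pos 0
    rwa [S.pos_zero] at this
  have hweight : (∃ t t', i ≤ t ∧ t < t' ∧ t' < j ∧ (U t = 2 * d ∨ U t' = 2 * d)) →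
      ∀ n, zeroLen d n + zeroLen d (n + d) + prefixWeight d U n i ≤ prefixWeight d U n j := by
    rintro ⟨t, t', h1, h2, h3, h4⟩ n
    have h5 := imageLen_add_le_of_mem (d := d) (U := U) (n := n) h1 h2 h3
    have h6 := zeroLen_le_imageLen d n (U t)
    have h7 := zeroLen_le_imageLen d n (U t')
    have h8 := imageLen_top d n
    rcases h4 with h4 | h4 <;> rw [h4] at h5 <;> omega
  rcases Nat.eq_zero_or_pos i with rfl | hi
  · left
    simp [leftMin, hU0]
  have hl' : U (i - 1) ≠ U (j - 1) := by omega
  have hlm : leftMin U i j = min (U (i - 1)) (U (j - 1)) := by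
    rw [leftMin, if_neg (by omega)]
  have ti : U (i - 1) ≠ 0 → U i ≠ 0 → U (i - 1) = 2 * d ∧ U i = 2 * d := by
    intro h1 h2
    obtain ⟨n, -, -, h3, h4, -⟩ := S.top_of_two_nonzero h1 (by rwa [show i - 1 + 1 = i by omega])
    rw [show i - 1 + 1 = i by omega] at h4
    exact ⟨h3, h4⟩
  have tj : U (j - 1) ≠ 0 → U j ≠ 0 → U (j - 1) = 2 * d ∧ U j = 2 * d := by
    intro h1 h2
    obtain ⟨n, -, -, h3, h4, -⟩ := S.top_of_two_nonzero h1 (by rwa [show j - 1 + 1 = j by omega])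
    rw [show j - 1 + 1 = j by omega] at h4
    exact ⟨h3, h4⟩
  have hne : U i ≠ U (j - 1) → i < j - 1 := by
    intro h
    rcases (by omega : i < j - 1 ∨ i = j - 1) with h1 | h1
    · exact h1
    · exact absurd (by rw [← h1]) h
  rw [hlm]
  by_cases h0 : min (U (i - 1)) (U (j - 1)) = 0 ∧ min (U i) (U j) = 0
  · exact .inl h0
  right
  by_cases a1 : U (i - 1) = 0
  · by_cases a2 : U i = 0
    · omega
    · have := tj (by omega) (by omega)
      exact ⟨by omega, hweight ⟨i, j - 1, le_rfl, hne (by omega), by omega, .inr this.1⟩⟩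
  · by_cases a2 : U i = 0
    · have := tj (by omega) (by omega)
      exact ⟨by omega, hweight ⟨i, j - 1, le_rfl, hne (by omega), by omega, .inr this.1⟩⟩
    · have h1 := ti a1 a2
      exact ⟨by omega, hweight ⟨i, j - 1, le_rfl, hne (by omega), by omega, .inl h1.2⟩⟩

/-- Distinct right neighbours of a nonzero letter force one occurrence to be the first e of ee,
which has 0 on its left. As the left neighbours differ too, the other occurrence has 0 on its right.
-/
theorem single_letter_seed {i j : ℕ} (ha : U i = U j) (h0 : U i ≠ 0) (hr : U (i + 1) ≠ U (j + 1))
    (hl : i = 0 ∨ U (i - 1) ≠ U (j - 1)) :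
    U i = 2 * d ∧ leftMin U i j = 0 ∧ min (U (i + 1)) (U (j + 1)) = 0 := by
  have hU0 : U 0 = 0 := by
    have := S.at_pos 0
    rwa [S.pos_zero] at this
  have hi : i ≠ 0 := by
    rintro rfl
    exact h0 hU0
  rw [leftMin, if_neg hi]
  by_cases h1 : U (i + 1) = 0
  · obtain ⟨n, h2, h3, h4, h5, -⟩ := S.top_of_two_nonzero (p := j) (by omega) (by omega)
    have : U (j - 1) = 0 := by rw [show j - 1 = s n by omega, S.at_pos]
    omega
  · obtain ⟨n, h2, h3, h4, h5, -⟩ := S.top_of_two_nonzero h0 h1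
    have h6 : U (i - 1) = 0 := by rw [show i - 1 = s n by omega, S.at_pos]
    have h7 : U (j + 1) = 0 := by
      by_contra h7
      obtain ⟨n', -, -, -, h8, -⟩ := S.top_of_two_nonzero (p := j) (by omega) h7
      omega
    omega

variable {x : ℝ}

/-- The extension of a maximal repetition is bounded by its period, in all weighted lengths. -/
theorem maximal_repetition_bound (hd : 3 ≤ d) (hx : 2 < x) (hroot : x ^ d * (x - 2) = 1) (r : ℕ) :
    ∀ n i j, i < j → Agree U i j r → U (i + r) ≠ U (j + r) → (i = 0 ∨ U (i - 1) ≠ U (j - 1)) →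
      (3 - x) * ((prefixWeight d U n (i + r) : ℝ) - prefixWeight d U n i + prefixSum d n +
        extLen d (n + leftMin U i j) + extLen d (n + min (U (i + r)) (U (j + r)))) ≤
      prefixWeight d U n j - prefixWeight d U n i := by
  have he := S.two_le
  have hx3 : 0 < 3 - x := by
    have := root_sub_two_le hx hroot hd
    linarith
  have hd1 : 1 ≤ d := by omega
  induction r using Nat.strong_induction_on with
  | _ r ih =>
  intro n i j hij ha hr hl
  by_cases hz : ∃ z < r, U (i + z) = 0
  · obtain ⟨z, hz, hz0⟩ := hz
    obtain ⟨f, g, i', j', r', hfg, hgr, hi, hj, hi2, hj2, ha', hf0, hg0⟩ :=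
      S.exists_core_of_repetition ha hz hz0
    have hgrow := S.add_two_le i' r'
    have hij' : i' < j' := S.lt_iff.1 (by omega)
    have hr' : U (i' + r') ≠ U (j' + r') := by
      intro heq
      have ha2 : Agree U i' j' (r' + 1) := by
        intro t ht
        rcases Nat.lt_succ_iff_lt_or_eq.1 ht with h | rfl
        · exact ha' t h
        · exact heq
      have h1 := S.agree_image ha2
      rw [← add_assoc] at h1
      have h2 := S.lt_iff.2 (show i' + r' < i' + r' + 1 by omega)
      rcases Nat.lt_or_ge (s (i' + r' + 1)) (i + r) with h3 | h3
      · refine hg0 (s (i' + r' + 1) - i) (by omega) (by omega) ?_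
        rw [show i + (s (i' + r' + 1) - i) = s (i' + r' + 1) by omega, S.at_pos]
      · have := h1 (r - f) (by omega)
        rw [show s i' + (r - f) = i + r by omega, show s j' + (r - f) = j + r by omega] at this
        exact hr this
    obtain ⟨q, hq1, hq2, hq3, hq4⟩ := S.right_extension hd1 hr'
    have hrq : g + q = r := by
      rcases lt_trichotomy (g + q) r with h | h | h
      · refine absurd (ha (g + q) h) ?_
        rwa [← add_assoc, ← add_assoc, hi2, hj2]
      · exact h
      · refine absurd (hq2 (r - g) (by omega)) ?_
        rwa [← hi2, ← hj2, show i + g + (r - g) = i + r by omega,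
          show j + g + (r - g) = j + r by omega]
    have hq4' := hq4 n
    rw [← hi2, ← hj2, add_assoc i, add_assoc j, hrq, hi2] at hq4'
    have hperiod := ha.prefixWeight (d := d) n (show f ≤ r by omega)
    rw [hi, hj, S.prefixWeight_pos, S.prefixWeight_pos] at hperiod
    rw [S.prefixWeight_pos] at hq4'
    have hsum := prefixSum_succ' d n
    -- The right end, the prefix sum and the period pass to level `n + 1` exactly; only the left end
    -- is open. There equality holds too, except at the beginning of the sequence, where `leftMin`
    -- is 0 by convention and monotonicity of `extLen` suffices.
    suffices hleft : (i' = 0 ∨ U (i' - 1) ≠ U (j' - 1)) ∧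
        prefixWeight d U (n + 1) i' + extLen d (n + leftMin U i j) ≤
          prefixWeight d U n i + extLen d (n + 1 + leftMin U i' j') by
      have h1 := ih r' (by omega) (n + 1) i' j' hij' ha' hr' hleft.1
      have h2 : (prefixWeight d U (n + 1) i' + extLen d (n + leftMin U i j) : ℝ) ≤
          prefixWeight d U n i + extLen d (n + 1 + leftMin U i' j') := by exact_mod_cast hleft.2
      have h3 : (prefixWeight d U n (i + r) + extLen d (n + min (U (i + r)) (U (j + r))) : ℝ) =
          prefixWeight d U (n + 1) (i' + r') + zeroLen d n +
            extLen d (n + 1 + min (U (i' + r')) (U (j' + r'))) := by exact_mod_cast hq4'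
      have h4 : (prefixWeight d U (n + 1) i' + prefixWeight d U n j : ℝ) =
          prefixWeight d U (n + 1) j' + prefixWeight d U n i := by exact_mod_cast hperiod
      have h5 : (prefixSum d (n + 1) : ℝ) = prefixSum d n + zeroLen d n := by exact_mod_cast hsum
      nlinarith
    rcases Nat.eq_zero_or_pos i with rfl | hipos
    · have hU0 : U 0 = 0 := by
        have := S.at_pos 0
        rwa [S.pos_zero] at this
      have hf : f = 0 := by
        by_contra hne
        exact hf0 0 (by omega) hU0
      subst hf
      have hi0 : i' = 0 := S.inj (by rw [S.pos_zero]; omega)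
      subst hi0
      refine ⟨.inl rfl, ?_⟩
      have := extLen_mono d hd1 (show n + leftMin U 0 j ≤ n + 1 + leftMin U 0 j' by
        simp [leftMin])
      rw [prefixWeight_zero, prefixWeight_zero]
      omega
    · have hl' : U (i - 1) ≠ U (j - 1) := by omega
      have hi1 : 1 ≤ i' := by
        by_contra h1
        obtain rfl : i' = 0 := by omega
        rw [S.pos_zero] at hi
        omega
      have hne : U (i' - 1) ≠ U (j' - 1) := by
        intro heq
        have ha2 : Agree U (i' - 1) (j' - 1) 1 := by
          intro t ht
          obtain rfl : t = 0 := by omega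
          exact heq
        have h1 := S.agree_image ha2
        have h2 := S.agree_pos ha2 le_rfl
        rw [show i' - 1 + 1 = i' by omega] at h1 h2
        rw [show j' - 1 + 1 = j' by omega] at h2
        have h3 := S.lt_iff.2 (show i' - 1 < i' by omega)
        rcases Nat.lt_or_ge (s (i' - 1)) i with h4 | h4
        · have := h1 (i - 1 - s (i' - 1)) (by omega)
          rw [show s (i' - 1) + (i - 1 - s (i' - 1)) = i - 1 by omega,
            show s (j' - 1) + (i - 1 - s (i' - 1)) = j - 1 by omega] at this
          exact hl' this
        · refine hf0 (s (i' - 1) - i) (by omega) ?_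
          rw [show i + (s (i' - 1) - i) = s (i' - 1) by omega, S.at_pos]
      obtain ⟨q', hp1, hp2, hp3, hp4⟩ := S.left_extension hd1 hi1 (by omega) hne
      have hfq : f = q' := by
        rcases lt_trichotomy f q' with h | h | h
        · refine absurd (hp2 f h) ?_
          rwa [show s i' - 1 - f = i - 1 by omega, show s j' - 1 - f = j - 1 by omega]
        · exact h
        · refine absurd (ha (f - q' - 1) (by omega)) ?_
          rwa [show i + (f - q' - 1) = s i' - q' - 1 by omega,
            show j + (f - q' - 1) = s j' - q' - 1 by omega]
      have h6 := hp4 n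
      rw [← hfq, show s i' - f = i by omega, show s j' - f = j by omega, S.prefixWeight_pos] at h6
      refine ⟨.inr hne, ?_⟩
      rw [leftMin, leftMin, if_neg (by omega), if_neg (by omega)]
      omega
  · push Not at hz
    have hr2 : r ≤ 1 := by
      by_contra hlt
      obtain ⟨m, -, -, h0, h00, h1⟩ := S.top_of_two_nonzero (p := i) (hz 0 (by omega))
        (hz 1 (by omega))
      rcases (by omega : r = 2 ∨ 2 < r) with rfl | h2
      · have e0 := ha 0 (by omega)
        have e1 := ha 1 (by omega)
        rw [add_zero, add_zero] at e0
        obtain ⟨m', -, -, -, -, h3⟩ := S.top_of_two_nonzero (p := j) (by omega) (by omega)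
        refine hr ?_
        rw [h1, h3, S.at_pos, S.at_pos]
      · exact hz 2 h2 (by rw [h1, S.at_pos])
    rcases (by omega : r = 0 ∨ r = 1) with rfl | rfl
    -- Empty overlap: with both minima 0, one letter in the period outweighs the excess. Otherwise
    -- one end may add up to Z(n+d), which the letter e in the period provides since 3 - x < 1.
    · rw [add_zero, add_zero] at hr ⊢
      rw [sub_self, zero_add]
      have h1 : (prefixSum d n + 2 * extLen d n : ℝ) = excess d n := by
        rw [excess]
        push_cast
        ring
      have h2 := excess_le_zeroLen hx hroot hd n
      rcases S.seed_bound hij hr hl with ⟨h3, h4⟩ | ⟨h3, h4⟩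
      · rw [h3, h4, add_zero]
        have h5 := imageLen_le_of_mem (d := d) (U := U) (n := n) (le_refl i) hij
        have h6 := zeroLen_le_imageLen d n (U i)
        have h7 : (zeroLen d n + prefixWeight d U n i : ℝ) ≤ prefixWeight d U n j := by
          exact_mod_cast (by omega)
        nlinarith
      · have h5 : (zeroLen d n + zeroLen d (n + d) + prefixWeight d U n i : ℝ) ≤
            prefixWeight d U n j := by exact_mod_cast h4 n
        have h6 : extLen d (n + leftMin U i j) + extLen d (n + min (U i) (U j)) ≤
            2 * extLen d n + zeroLen d (n + d) := by
          have hlm : leftMin U i j ≤ 2 * d := by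
            unfold leftMin
            have := S.le (i - 1)
            split_ifs <;> omega
          have hrm : min (U i) (U j) ≤ 2 * d := by
            have := S.le i
            omega
          have b1 := extLen_add_le d hd1 n hlm
          have b2 := extLen_add_le d hd1 n hrm
          rcases h3 with h3 | h3 <;> rw [h3] at * <;> rw [add_zero] at * <;> omega
        have h7 : (extLen d (n + leftMin U i j) + extLen d (n + min (U i) (U j)) : ℝ) ≤
            2 * extLen d n + zeroLen d (n + d) := by exact_mod_cast h6
        have h8 : (0 : ℝ) ≤ zeroLen d (n + d) := by positivity
        have h9 := mul_le_mul_of_nonneg_left h7 hx3.le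
        nlinarith
    -- Overlap e: the period weighs at least Z(n+d), and the claim is the slack inequality. The
    -- adjacent pair ee is the extremal seed.
    · have e0 := ha 0 (by omega)
      have e1 := hz 0 (by omega)
      rw [add_zero] at e0 e1
      rw [add_zero] at e0
      obtain ⟨h1, h2, h3⟩ := S.single_letter_seed e0 e1 hr hl
      rw [h2, h3, add_zero, prefixWeight_succ, h1, imageLen_top]
      have h4 := imageLen_le_of_mem (d := d) (U := U) (n := n) (le_refl i) hij
      rw [h1, imageLen_top] at h4
      have h5 : (zeroLen d (n + d) + prefixWeight d U n i : ℝ) ≤ prefixWeight d U n j := by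
        exact_mod_cast h4
      have h6 := excess_le_top hx hroot hd n
      have h7 : (prefixSum d n + 2 * extLen d n : ℝ) = excess d n := by
        rw [excess]
        push_cast
        ring
      push_cast
      nlinarith

/-- The overlap of a repetition is bounded by its period, in all weighted lengths. -/
theorem repetition_bound (hd : 3 ≤ d) (hx : 2 < x) (hroot : x ^ d * (x - 2) = 1) (n : ℕ)
    {i j r : ℕ} (hij : i < j) (ha : Agree U i j r) :
    (3 - x) * ((prefixWeight d U n (i + r) : ℝ) - prefixWeight d U n i) ≤
      prefixWeight d U n j - prefixWeight d U n i := by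
  classical
  have hx3 : 0 < 3 - x := by
    have := root_sub_two_le hx hroot hd
    linarith
  have hexr := S.not_eventually_periodic hij
  have hr1 := Nat.find_spec hexr
  have hr2 : ∀ t < Nat.find hexr, U (i + t) = U (j + t) := fun t ht => by
    have := Nat.find_min hexr ht
    push Not at this
    exact this
  generalize Nat.find hexr = R at *
  have hRr : r ≤ R := by
    by_contra h
    exact hr1 (ha R (by omega))
  obtain ⟨a, hl1, hl2, hleft⟩ := exists_left_maximal U hij
  have hagree : Agree U a (j - (i - a)) (i - a + R) := by
    intro t ht
    by_cases h : t < i - a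
    · exact hl2 t h
    · have := hr2 (t - (i - a)) (by omega)
      rwa [show i + (t - (i - a)) = a + t by omega,
        show j + (t - (i - a)) = j - (i - a) + t by omega] at this
  have h1 := S.maximal_repetition_bound hd hx hroot (i - a + R) n a (j - (i - a)) (by omega) hagree
    (by rwa [show a + (i - a + R) = i + R by omega,
      show j - (i - a) + (i - a + R) = j + R by omega]) hleft
  have h2 := hl2.prefixWeight (d := d) n le_rfl
  rw [show a + (i - a) = i by omega, show j - (i - a) + (i - a) = j by omega] at h2
  have h2' : (prefixWeight d U n i + prefixWeight d U n (j - (i - a)) : ℝ) =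
      prefixWeight d U n j + prefixWeight d U n a := by exact_mod_cast h2
  rw [show a + (i - a + R) = i + R by omega] at h1
  have h3 : (prefixWeight d U n (i + r) : ℝ) ≤ prefixWeight d U n (i + R) := by
    exact_mod_cast prefixWeight_mono n (by omega)
  have h4 : (prefixWeight d U n a : ℝ) ≤ prefixWeight d U n i := by
    exact_mod_cast prefixWeight_mono n hl1
  have h5 : (0 : ℝ) ≤ prefixSum d n := by positivity
  have h6 : (0 : ℝ) ≤ extLen d (n + leftMin U a (j - (i - a))) := by positivity
  have h7 : (0 : ℝ) ≤
      extLen d (n + min (U (i + R)) (U (j - (i - a) + (i - a + R)))) := by positivity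
  nlinarith

/-! ### Repetitions attaining the bound asymptotically -/

theorem exists_letter (c : ℕ) (hc : c ≤ 2 * d) : ∃ m, U m = c := by
  induction c with
  | zero => exact ⟨s 0, S.at_pos 0⟩
  | succ c ih =>
    obtain ⟨m, hm⟩ := ih (by omega)
    refine ⟨s m + 1, ?_⟩
    rw [S.at_succ]
    omega

/-- The repetitions with the largest exponents. -/
theorem exists_long_repetition (hd : 1 ≤ d) (n : ℕ) :
    ∃ i j r, 1 ≤ i ∧ i < j ∧ Agree U i j r ∧
      U (i - 1) = n % (2 * d) ∧ U (j - 1) = 2 * d ∧ U (i + r) = 2 * d ∧ U (j + r) = n % (2 * d) ∧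
      ∀ m, prefixWeight d U m j = prefixWeight d U m i + zeroLen d (n + m + d) ∧
        prefixWeight d U m (i + r) + prefixSum d m + 2 * extLen d (m + n % (2 * d)) =
          prefixWeight d U m i + zeroLen d (n + m + d) + excess d (n + m) := by
  induction n with
  | zero =>
    -- The seed is the pair ee in φ(e)0 = 0ee0, with mismatches 0, e on the left and e, 0 on the
    -- right.
    obtain ⟨q, hq⟩ := S.exists_letter (2 * d) le_rfl
    have h1 := S.at_succ q
    have h2 := S.at_two q hq
    have h3 := S.pos_succ_top hq
    rw [show min (U q + 1) (2 * d) = 2 * d by omega] at h1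
    refine ⟨s q + 1, s q + 2, 1, by omega, by omega, fun t ht => ?_, ?_, h1, h2, ?_, fun m => ?_⟩
    · obtain rfl : t = 0 := by omega
      rw [add_zero, add_zero, h1, h2]
    · rw [Nat.add_sub_cancel, S.at_pos, Nat.zero_mod]
    · rw [add_assoc, ← h3, S.at_pos, Nat.zero_mod]
    · rw [show s q + 2 = s q + 1 + 1 by omega, prefixWeight_succ, h1, imageLen_top, Nat.zero_mod,
        zero_add, add_zero, excess]
      omega
  | succ n ih =>
    obtain ⟨i', j', r', hi1, hij', ha', l1, l2, r1, r2, hw⟩ := ih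
    have hmod := Nat.mod_lt n (show 0 < 2 * d by omega)
    have hij := S.lt_iff.2 hij'
    have him := S.agree_image ha'
    have hpos := S.agree_pos ha' le_rfl
    have hle := S.le_iff.2 (show i' ≤ i' + r' by omega)
    have p1 := S.at_pred hi1
    have p2 := S.at_pred (show 1 ≤ j' by omega)
    have p3 := S.at_succ (i' + r')
    have p4 := S.at_succ (j' + r')
    have p5 := S.one_le_pos hi1
    rw [l1] at p1
    rw [l2, show min (2 * d + 1) (2 * d) = 2 * d by omega] at p2
    rw [r1, show min (2 * d + 1) (2 * d) = 2 * d by omega] at p3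
    rw [r2] at p4
    -- The smaller mismatching letter at both ends is `n % (2 * d)`. When it is e-1, the image gains
    -- an e at each end and the letter returns to 0.
    by_cases hm : n % (2 * d) = 2 * d - 1
    · have hm' : (n + 1) % (2 * d) = 0 := by
        rw [Nat.add_mod, hm, Nat.mod_eq_of_lt (show 1 < 2 * d by omega),
          show 2 * d - 1 + 1 = 2 * d by omega, Nat.mod_self]
      have q1 := S.pos_succ_ne (n := i' - 1) (by omega)
      have q2 := S.at_pred_two (show 1 ≤ j' by omega) l2
      have q3 := S.at_two _ r1
      have q4 := S.at_two_eq_zero (n := j' + r') (by omega)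
      rw [hm, show min (2 * d - 1 + 1) (2 * d) = 2 * d by omega] at p1 p4
      rw [show i' - 1 + 1 = i' by omega] at q1
      refine ⟨s i' - 1, s j' - 1, s (i' + r') + 1 - s i' + 2, by omega, by omega, fun t ht => ?_,
        ?_, ?_, ?_, ?_, fun m => ?_⟩
      · rcases Nat.eq_zero_or_pos t with rfl | h1
        · rw [add_zero, add_zero, p1, p2]
        · by_cases h2 : t = s (i' + r') - s i' + 2
          · rw [show s i' - 1 + t = s (i' + r') + 1 by omega,
              show s j' - 1 + t = s (j' + r') + 1 by omega, p3, p4]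
          · have := him (t - 1) (by omega)
            rwa [show s i' + (t - 1) = s i' - 1 + t by omega,
              show s j' + (t - 1) = s j' - 1 + t by omega] at this
      · rw [show s i' - 1 - 1 = s (i' - 1) by omega, S.at_pos, hm']
      · rw [show s j' - 1 - 1 = s (j' - 1) + 1 by omega, S.at_succ]
        omega
      · rw [show s i' - 1 + (s (i' + r') + 1 - s i' + 2) = s (i' + r') + 2 by omega, q3]
      · rw [show s j' - 1 + (s (i' + r') + 1 - s i' + 2) = s (j' + r') + 2 by omega, q4, hm']
      · obtain ⟨w1, w2⟩ := hw (m + 1)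
        have w3 := prefixWeight_succ (d := d) (U := U) m (s i' - 1)
        have w4 := prefixWeight_succ (d := d) (U := U) m (s j' - 1)
        have w5 := prefixWeight_succ (d := d) (U := U) m (s (i' + r'))
        have w6 := prefixWeight_succ (d := d) (U := U) m (s (i' + r') + 1)
        rw [show s i' - 1 + 1 = s i' by omega, S.prefixWeight_pos, p1, imageLen_top] at w3
        rw [show s j' - 1 + 1 = s j' by omega, S.prefixWeight_pos, p2, imageLen_top] at w4
        rw [S.prefixWeight_pos, S.at_pos] at w5
        change _ = _ + zeroLen d m at w5
        rw [p3, imageLen_top] at w6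
        have w7 := extLen_add d hd m
        have w8 := prefixSum_succ' d m
        rw [hm, show m + 1 + (2 * d - 1) = m + 2 * d by omega] at w2
        rw [show n + (m + 1) = n + 1 + m by omega] at w1 w2
        rw [show s i' - 1 + (s (i' + r') + 1 - s i' + 2) = s (i' + r') + 1 + 1 by omega, hm',
          add_zero]
        omega
    · have hm' : (n + 1) % (2 * d) = n % (2 * d) + 1 := by
        rw [Nat.add_mod, Nat.mod_eq_of_lt (show 1 < 2 * d by omega), Nat.mod_eq_of_lt (by omega)]
      refine ⟨s i', s j', s (i' + r') + 1 - s i', by omega, by omega, him, by omega, p2, ?_, ?_,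
        fun m => ?_⟩
      · rw [show s i' + (s (i' + r') + 1 - s i') = s (i' + r') + 1 by omega, p3]
      · rw [show s j' + (s (i' + r') + 1 - s i') = s (j' + r') + 1 by omega, p4]
        omega
      · obtain ⟨w1, w2⟩ := hw (m + 1)
        have w5 := prefixWeight_succ (d := d) (U := U) m (s (i' + r'))
        rw [S.prefixWeight_pos, S.at_pos] at w5
        change _ = _ + zeroLen d m at w5
        have w8 := prefixSum_succ' d m
        rw [show m + 1 + n % (2 * d) = m + (n % (2 * d) + 1) by omega] at w2
        rw [show n + (m + 1) = n + 1 + m by omega] at w1 w2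
        rw [show s i' + (s (i' + r') + 1 - s i') = s (i' + r') + 1 by omega, hm',
          S.prefixWeight_pos, S.prefixWeight_pos]
        omega

end Subst

/-! ### Comparison of lengths and weighted lengths -/

theorem exists_between_of_strictMono {f : ℕ → ℕ} (hf : StrictMono f) (h0 : f 0 = 0) (i : ℕ) :
    ∃ p, f p ≤ i ∧ i < f (p + 1) := by
  induction i with
  | zero =>
    have := hf (show 0 < 1 by omega)
    exact ⟨0, by omega, by simpa [h0] using this⟩
  | succ i ih =>
    obtain ⟨p, h1, h2⟩ := ih
    by_cases h : i + 1 < f (p + 1)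
    · exact ⟨p, by omega, h⟩
    · have := hf (show p + 1 < p + 1 + 1 by omega)
      exact ⟨p + 1, by omega, by omega⟩

/-- The length of the image of the letter `a` under the `n`-th power of the morphism with the
largest letter `e`. -/
def plainLen (e : ℕ) : ℕ → ℕ → ℕ
  | 0, _ => 1
  | n + 1, a => plainLen e n 0 + if a = e then 2 * plainLen e n e else plainLen e n (a + 1)

theorem one_le_plainLen (e n a : ℕ) : 1 ≤ plainLen e n a := by
  induction n generalizing a with
  | zero => simp [plainLen]
  | succ n ih =>
    have := ih 0
    rw [plainLen]
    omega

theorem zeroLen_succ_le (d n : ℕ) : zeroLen d (n + 1) ≤ 3 * zeroLen d n := by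
  rw [zeroLen_succ]
  have := zeroLen_mono d (Nat.sub_le n d)
  split_ifs <;> omega

theorem zeroLen_add_le (d n k : ℕ) : zeroLen d (n + k) ≤ 3 ^ k * zeroLen d n := by
  induction k with
  | zero => simp
  | succ k ih =>
    have := zeroLen_succ_le d (n + k)
    rw [← add_assoc, pow_succ]
    linarith

theorem imageLen_succ_le (d n : ℕ) {a : ℕ} (ha : a ≤ 2 * d) :
    imageLen d (n + 1) a ≤ 3 ^ (d + 1) * zeroLen d n := by
  have h1 := imageLen_le_top d (n + 1) ha
  rw [imageLen_top, show n + 1 + d = n + (d + 1) by omega] at h1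
  exact h1.trans (zeroLen_add_le d n (d + 1))

/-- The ratios of lengths and weighted lengths of the images of letters converge uniformly. -/
theorem exists_ratio_bounds (d : ℕ) (n : ℕ) : ∃ lo hi : ℝ, 1 / 2 ^ d ≤ lo ∧ lo ≤ hi ∧
    hi - lo ≤ (1 - 1 / (2 * 3 ^ (d + 1))) ^ n ∧
    ∀ a ≤ 2 * d, lo * imageLen d n a ≤ plainLen (2 * d) n a ∧
      plainLen (2 * d) n a ≤ hi * imageLen d n a := by
  induction n with
  | zero =>
    have h2 : (1 : ℝ) ≤ 2 ^ d := one_le_pow₀ (by norm_num)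
    refine ⟨1 / 2 ^ d, 1, le_rfl, ?_, ?_, fun a ha => ?_⟩
    · rw [div_le_one (by positivity)]
      exact h2
    · rw [pow_zero]
      have : (0 : ℝ) < 1 / 2 ^ d := by positivity
      linarith
    · have h3 : 1 ≤ imageLen d 0 a ∧ imageLen d 0 a ≤ 2 ^ d := by
        rw [imageLen_zero d ha]
        split_ifs
        · exact ⟨le_rfl, Nat.one_le_two_pow⟩
        · exact ⟨Nat.one_le_two_pow, Nat.pow_le_pow_right (by norm_num) (by omega)⟩
      have h4 : (1 : ℝ) ≤ imageLen d 0 a := by exact_mod_cast h3.1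
      have h5 : (imageLen d 0 a : ℝ) ≤ 2 ^ d := by exact_mod_cast h3.2
      rw [plainLen, Nat.cast_one, one_mul, div_mul_eq_mul_div, one_mul, div_le_one (by positivity)]
      exact ⟨h5, h4⟩
  | succ n ih =>
    obtain ⟨lo, hi, h1, h2, h3, h4⟩ := ih
    -- Every φ^(n+1)(a) starts with φ^n(0), which carries at least the proportion θ of its weight.
    set θ : ℝ := 1 / 3 ^ (d + 1) with hθ
    have hθ0 : 0 < θ := by positivity
    have hθ1 : θ ≤ 1 := by
      rw [hθ, div_le_one (by positivity)]
      exact one_le_pow₀ (by norm_num)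
    have hθ2 : (1 : ℝ) / (2 * 3 ^ (d + 1)) = θ / 2 := by
      rw [hθ]
      field_simp
    rw [hθ2] at h3 ⊢
    have hG : ∀ a ≤ 2 * d, θ * imageLen d (n + 1) a ≤ zeroLen d n := by
      intro a ha
      have h5 : (imageLen d (n + 1) a : ℝ) ≤ 3 ^ (d + 1) * zeroLen d n := by
        exact_mod_cast imageLen_succ_le d n ha
      rw [hθ, div_mul_eq_mul_div, one_mul, div_le_iff₀ (by positivity)]
      linarith
    have hrec : ∀ a ≤ 2 * d, ∃ F G : ℝ, (plainLen (2 * d) (n + 1) a : ℝ) = plainLen (2 * d) n 0 + F ∧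
        (imageLen d (n + 1) a : ℝ) = zeroLen d n + G ∧ lo * G ≤ F ∧ F ≤ hi * G := by
      intro a ha
      by_cases hae : a = 2 * d
      · subst hae
        have h5 := h4 (2 * d) le_rfl
        refine ⟨2 * plainLen (2 * d) n (2 * d), 2 * imageLen d n (2 * d), ?_, ?_, by linarith,
          by linarith⟩
        · rw [plainLen, if_pos rfl]
          push_cast
          ring
        · rw [imageLen_succ_top]
          push_cast
          ring
      · have h5 := h4 (a + 1) (by omega)
        refine ⟨plainLen (2 * d) n (a + 1), imageLen d n (a + 1), ?_, ?_, h5.1, h5.2⟩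
        · rw [plainLen, if_neg hae]
          push_cast
          ring
        · rw [imageLen_succ]
          push_cast
          ring
    have h0 := h4 0 (by omega)
    change lo * (zeroLen d n : ℝ) ≤ _ ∧ _ ≤ hi * (zeroLen d n : ℝ) at h0
    have hshrink : (hi - lo) * (1 - θ / 2) ≤ (1 - θ / 2) ^ (n + 1) := by
      rw [pow_succ]
      exact mul_le_mul_of_nonneg_right h3 (by linarith)
    have hδ : 0 ≤ (hi - lo) / 2 := by linarith
    -- If the ratio for φ^n(0) lies in the upper half of the interval, this common prefix raises all
    -- new ratios by θ(hi - lo)/2 above `lo`; otherwise it lowers them below `hi` by as much.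
    rcases le_total ((lo + hi) / 2 * zeroLen d n) (plainLen (2 * d) n 0) with h5 | h5
    · refine ⟨lo + (hi - lo) / 2 * θ, hi, by nlinarith, by nlinarith, by nlinarith, fun a ha => ?_⟩
      obtain ⟨F, G, e1, e2, e3, e4⟩ := hrec a ha
      have h6 := mul_le_mul_of_nonneg_left (hG a ha) hδ
      rw [e2] at h6 ⊢
      rw [e1]
      constructor <;> nlinarith
    · refine ⟨lo, hi - (hi - lo) / 2 * θ, h1, by nlinarith, by nlinarith, fun a ha => ?_⟩
      obtain ⟨F, G, e1, e2, e3, e4⟩ := hrec a ha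
      have h6 := mul_le_mul_of_nonneg_left (hG a ha) hδ
      rw [e2] at h6 ⊢
      rw [e1]
      constructor <;> nlinarith

/-- The length of the image of the prefix of length `p` of `U` under the `n`-th power of the
morphism with the largest letter `e`. -/
def prefixLen (e : ℕ) (U : ℕ → ℕ) (n p : ℕ) : ℕ :=
  ∑ t ∈ Finset.range p, plainLen e n (U t)

theorem prefixLen_succ (e : ℕ) (U : ℕ → ℕ) (n p : ℕ) :
    prefixLen e U n (p + 1) = prefixLen e U n p + plainLen e n (U p) := by
  rw [prefixLen, Finset.sum_range_succ]
  rfl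

theorem prefixLen_zero (e : ℕ) (U : ℕ → ℕ) (n : ℕ) : prefixLen e U n 0 = 0 := by
  simp [prefixLen]

theorem prefixLen_strictMono (e : ℕ) (U : ℕ → ℕ) (n : ℕ) : StrictMono (prefixLen e U n) :=
  strictMono_nat_of_lt_succ fun p => by
    have := one_le_plainLen e n (U p)
    rw [prefixLen_succ]
    omega

namespace Subst

variable {d : ℕ} {U s : ℕ → ℕ} (S : Subst (2 * d) U s)
include S

theorem prefixLen_pos (n m : ℕ) : prefixLen (2 * d) U n (s m) = prefixLen (2 * d) U (n + 1) m := by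
  induction m with
  | zero => rw [S.pos_zero, prefixLen_zero, prefixLen_zero]
  | succ m ih =>
    rw [prefixLen_succ, plainLen]
    rcases S.pos_succ_cases m with ⟨h1, h2⟩ | ⟨h1, h2⟩
    · rw [h2, prefixLen_succ, prefixLen_succ, prefixLen_succ, ih, S.at_pos, S.at_succ,
        S.at_two m h1, h1, if_pos rfl, show min (2 * d + 1) (2 * d) = 2 * d by omega]
      omega
    · rw [h2, prefixLen_succ, prefixLen_succ, ih, S.at_pos, S.at_succ, if_neg (by omega),
        show min (U m + 1) (2 * d) = U m + 1 by omega]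
      omega

theorem prefixWeight_prefixLen (n p : ℕ) :
    prefixWeight d U 0 (prefixLen (2 * d) U n p) = prefixWeight d U n p := by
  induction n generalizing p with
  | zero => simp [prefixLen, plainLen]
  | succ n ih => rw [← S.prefixLen_pos, ih, S.prefixWeight_pos]

theorem imageLen_zero_letter (t : ℕ) :
    1 ≤ imageLen d 0 (U t) ∧ imageLen d 0 (U t) ≤ 2 ^ d := by
  rw [imageLen_zero d (S.le t)]
  have := S.le t
  split_ifs
  · exact ⟨le_rfl, Nat.one_le_two_pow⟩
  · exact ⟨Nat.one_le_two_pow, Nat.pow_le_pow_right (by norm_num) (by omega)⟩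

theorem prefixWeight_add_le (i k : ℕ) :
    prefixWeight d U 0 i + k ≤ prefixWeight d U 0 (i + k) ∧
      prefixWeight d U 0 (i + k) ≤ prefixWeight d U 0 i + 2 ^ d * k := by
  induction k with
  | zero => simp
  | succ k ih =>
    have := S.imageLen_zero_letter (i + k)
    rw [← add_assoc i k 1, prefixWeight_succ, mul_add, mul_one]
    omega

/-- Long factors have almost proportional lengths and weighted lengths. -/
theorem exists_uniform_ratio {ε : ℝ} (hε : 0 < ε) (hε1 : ε ≤ 1) : ∃ m : ℝ, 0 < m ∧ ∃ N : ℕ,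
    ∀ i k : ℕ, N ≤ k →
      m * ((prefixWeight d U 0 (i + k) : ℝ) - prefixWeight d U 0 i) ≤ k ∧
      (k : ℝ) ≤ m * (1 + ε) * ((prefixWeight d U 0 (i + k) : ℝ) - prefixWeight d U 0 i) := by
  have hlim : Filter.Tendsto (fun n : ℕ => (1 - 1 / (2 * 3 ^ (d + 1)) : ℝ) ^ n) Filter.atTop
      (nhds 0) := by
    have h1 : (1 : ℝ) ≤ 3 ^ (d + 1) := one_le_pow₀ (by norm_num)
    have h2 : (1 : ℝ) / (2 * 3 ^ (d + 1)) ≤ 1 := by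
      rw [div_le_one (by positivity)]
      linarith
    have h3 : (0 : ℝ) < 1 / (2 * 3 ^ (d + 1)) := by positivity
    exact tendsto_pow_atTop_nhds_zero_of_lt_one (by linarith) (by linarith)
  -- Chosen so that 1 + 2δ ≤ (1 - δ)(1 + ε), with room for the boundary errors.
  set δ := ε / 8 with hδ
  have hδ0 : 0 < δ := by positivity
  obtain ⟨n, hn⟩ := (hlim.eventually (gt_mem_nhds
    (show (0 : ℝ) < 1 / 2 ^ d * δ by positivity))).exists
  obtain ⟨lo, hi, h1, h2, h3, h4⟩ := exists_ratio_bounds d n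
  have hlo : 0 < lo := lt_of_lt_of_le (by positivity) h1
  have hhi : hi ≤ lo + lo * δ := by
    have := mul_le_mul_of_nonneg_right h1 hδ0.le
    linarith
  obtain ⟨C, hC⟩ : ∃ C : ℕ, ∀ a ≤ 2 * d, plainLen (2 * d) n a ≤ C :=
    ⟨∑ a ∈ Finset.range (2 * d + 1), plainLen (2 * d) n a, fun a ha =>
      Finset.single_le_sum (f := fun a => plainLen (2 * d) n a) (fun _ _ => Nat.zero_le _)
        (Finset.mem_range.2 (by omega))⟩
  set P := prefixLen (2 * d) U n with hP
  have hPm : StrictMono P := prefixLen_strictMono _ _ _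
  have hP0 : P 0 = 0 := prefixLen_zero _ _ _
  have hPs : ∀ p, P (p + 1) ≤ P p + C := by
    intro p
    have := hC _ (S.le p)
    rw [hP, prefixLen_succ]
    omega
  have hPW : ∀ p q, lo * ((prefixWeight d U 0 (P (p + q)) : ℝ) - prefixWeight d U 0 (P p)) ≤
      P (p + q) - P p ∧ (P (p + q) - P p : ℝ) ≤
      hi * ((prefixWeight d U 0 (P (p + q)) : ℝ) - prefixWeight d U 0 (P p)) := by
    intro p q
    rw [hP, S.prefixWeight_prefixLen, S.prefixWeight_prefixLen]
    induction q with
    | zero => simp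
    | succ q ih =>
      have h5 := h4 _ (S.le (p + q))
      rw [← add_assoc, prefixWeight_succ, prefixLen_succ]
      push_cast
      constructor <;> nlinarith
  -- A bound for the error from rounding both ends of a factor down to boundaries of images under
  -- the `n`-th power. Long factors make it negligible.
  set K : ℝ := (hi * 2 ^ d + 1) * C with hK
  obtain ⟨N, hN⟩ := exists_nat_gt (K / (lo * δ))
  rw [div_lt_iff₀ (by positivity)] at hN
  refine ⟨lo * (1 - δ), mul_pos hlo (by linarith), N, fun i k hk => ?_⟩
  obtain ⟨p, hp1, hp2⟩ := exists_between_of_strictMono hPm hP0 i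
  obtain ⟨q', hq1, hq2⟩ := exists_between_of_strictMono hPm hP0 (i + k)
  have hpq : p ≤ q' := by
    have := hPm.lt_iff_lt.1 (show P p < P (q' + 1) by omega)
    omega
  obtain ⟨q, rfl⟩ := Nat.exists_eq_add_of_le hpq
  obtain ⟨a, ha⟩ := Nat.exists_eq_add_of_le hp1
  obtain ⟨b, hb⟩ := Nat.exists_eq_add_of_le hq1
  have hp3 := hPs p
  have hq3 := hPs (p + q)
  obtain ⟨w1, w2⟩ := hPW p q
  have v1 := S.prefixWeight_add_le (P p) a
  have v2 := S.prefixWeight_add_le (P (p + q)) b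
  have v3 := (S.prefixWeight_add_le i k).1
  rw [← ha] at v1
  rw [← hb] at v2
  have haC : a ≤ C := by omega
  have hbC : b ≤ C := by omega
  have v1b : prefixWeight d U 0 i ≤ prefixWeight d U 0 (P p) + 2 ^ d * C :=
    v1.2.trans (by gcongr)
  have v2b : prefixWeight d U 0 (i + k) ≤ prefixWeight d U 0 (P (p + q)) + 2 ^ d * C :=
    v2.2.trans (by gcongr)
  have r1 : (prefixWeight d U 0 i : ℝ) ≤ prefixWeight d U 0 (P p) + 2 ^ d * C := by
    exact_mod_cast v1b
  have r2 : (prefixWeight d U 0 (i + k) : ℝ) ≤ prefixWeight d U 0 (P (p + q)) + 2 ^ d * C := by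
    exact_mod_cast v2b
  have r3 : (prefixWeight d U 0 (P p) : ℝ) ≤ prefixWeight d U 0 i := by
    exact_mod_cast (by omega)
  have r4 : (prefixWeight d U 0 (P (p + q)) : ℝ) ≤ prefixWeight d U 0 (i + k) := by
    exact_mod_cast (by omega)
  have r5 : (prefixWeight d U 0 i : ℝ) + k ≤ prefixWeight d U 0 (i + k) := by exact_mod_cast v3
  have r6 : (i : ℝ) + k = P (p + q) + b := by exact_mod_cast hb
  have r7 : (i : ℝ) = P p + a := by exact_mod_cast ha
  have r8 : (a : ℝ) ≤ C := by exact_mod_cast haC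
  have r9 : (b : ℝ) ≤ C := by exact_mod_cast hbC
  have r10 : (N : ℝ) ≤ k := by exact_mod_cast hk
  have r11 : (0 : ℝ) ≤ a := by positivity
  have r12 : (0 : ℝ) ≤ b := by positivity
  set h : ℝ := (prefixWeight d U 0 (i + k) : ℝ) - prefixWeight d U 0 i with hh
  have hbig : K ≤ lo * δ * h := by
    have : (N : ℝ) ≤ h := by linarith
    have := mul_le_mul_of_nonneg_right this (show 0 ≤ lo * δ by positivity)
    linarith
  have hD : (0 : ℝ) ≤ 2 ^ d * C := by positivity
  have hhi0 : 0 < hi := by linarith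
  constructor
  · have t1 : lo * (h - 2 ^ d * C) ≤ k + C := by
      have : lo * (h - 2 ^ d * C) ≤
          lo * ((prefixWeight d U 0 (P (p + q)) : ℝ) - prefixWeight d U 0 (P p)) :=
        mul_le_mul_of_nonneg_left (by linarith) hlo.le
      linarith
    have t2 : lo * (2 ^ d * C) ≤ hi * (2 ^ d * C) := mul_le_mul_of_nonneg_right h2 hD
    calc lo * (1 - δ) * h = lo * h - lo * δ * h := by ring
      _ ≤ lo * h - K := by linarith
      _ ≤ k := by rw [hK]; linarith
  · have t1 : (k : ℝ) ≤ hi * (h + 2 ^ d * C) + C := by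
      have : hi * ((prefixWeight d U 0 (P (p + q)) : ℝ) - prefixWeight d U 0 (P p)) ≤
          hi * (h + 2 ^ d * C) := mul_le_mul_of_nonneg_left (by linarith) hhi0.le
      linarith
    have hh0 : 0 ≤ h := by
      have : (0 : ℝ) ≤ k := by positivity
      linarith
    have t2 : hi * h ≤ (lo + lo * δ) * h := mul_le_mul_of_nonneg_right hhi hh0
    have t3 : lo * (1 + 2 * δ) * h ≤ lo * (1 - δ) * (1 + ε) * h := by
      refine mul_le_mul_of_nonneg_right ?_ hh0
      rw [mul_assoc lo (1 - δ)]
      refine mul_le_mul_of_nonneg_left ?_ hlo.le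
      have : ε = 8 * δ := by rw [hδ]; ring
      nlinarith
    calc (k : ℝ) ≤ hi * h + K := by rw [hK]; linarith
      _ ≤ lo * (1 + 2 * δ) * h := by linarith
      _ ≤ lo * (1 - δ) * (1 + ε) * h := t3

end Subst

/-! ### The palindromic code -/

/-- The smallest letter in the palindrome that replaces the letter `i`. -/
def codeBase (d i : ℕ) : ℕ :=
  if i < d then i else d + 2 ^ (i - d) / 2

/-- The letter number `t` of the palindrome that replaces the letter `i`. -/
def codeLetter (d i t : ℕ) : ℕ :=
  codeBase d i + min t (imageLen d 0 i - 1 - t)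

section Code

variable {d : ℕ}

theorem codeBase_succ {i : ℕ} (hi : i ≤ 2 * d) :
    codeBase d (i + 1) = codeBase d i + (imageLen d 0 i + 1) / 2 := by
  rw [imageLen_zero d hi]
  unfold codeBase
  rcases lt_trichotomy (i + 1) d with h | h | h
  · rw [if_pos h, if_pos (by omega), if_pos (by omega)]
  · rw [if_neg (by omega), if_pos (by omega), if_pos (by omega), show i + 1 - d = 0 by omega]
    omega
  · rw [if_neg (by omega), if_neg (by omega), if_neg (by omega),
      show i + 1 - d = i - d + 1 by omega, pow_succ]
    omega

theorem codeBase_add_le {i j : ℕ} (hij : i < j) (hj : j ≤ 2 * d + 1) :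
    codeBase d i + (imageLen d 0 i + 1) / 2 ≤ codeBase d j := by
  induction j with
  | zero => omega
  | succ j ih =>
    rcases Nat.lt_succ_iff_lt_or_eq.1 hij with h | rfl
    · have := ih h (by omega)
      have := codeBase_succ (d := d) (i := j) (by omega)
      omega
    · rw [codeBase_succ (by omega)]

theorem one_le_imageLen (n i : ℕ) : 1 ≤ imageLen d n i := by
  rw [imageLen]
  omega

theorem codeLetter_inj {i j t t' : ℕ} (hi : i ≤ 2 * d) (hj : j ≤ 2 * d) (ht : t < imageLen d 0 i)
    (ht' : t' < imageLen d 0 j) (h : codeLetter d i t = codeLetter d j t') :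
    i = j ∧ (t = t' ∨ t + t' + 1 = imageLen d 0 i) := by
  unfold codeLetter at h
  rcases lt_trichotomy i j with hlt | rfl | hlt
  · have := codeBase_add_le (d := d) hlt (by omega)
    omega
  · omega
  · have := codeBase_add_le (d := d) hlt (by omega)
    omega

theorem codeLetter_symm {i t : ℕ} (ht : t < imageLen d 0 i) :
    codeLetter d i (imageLen d 0 i - 1 - t) = codeLetter d i t := by
  unfold codeLetter
  omega

theorem codeLetter_zero (hd : 1 ≤ d) : codeLetter d 0 0 = 0 := by
  unfold codeLetter codeBase
  rw [if_pos (by omega)]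
  omega

theorem codeLetter_lt {i t : ℕ} (hi : i ≤ 2 * d) (ht : t < imageLen d 0 i) :
    codeLetter d i t < d + 2 ^ d := by
  have h1 := codeBase_add_le (d := d) (show i < 2 * d + 1 by omega) le_rfl
  have h2 : codeBase d (2 * d + 1) = d + 2 ^ d := by
    rw [codeBase, if_neg (by omega), show 2 * d + 1 - d = d + 1 by omega, pow_succ]
    omega
  unfold codeLetter
  omega

theorem exists_codeLetter {b : ℕ} (hb : b < d + 2 ^ d) :
    ∃ i ≤ 2 * d, ∃ t < imageLen d 0 i, codeLetter d i t = b := by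
  have key : ∀ j ≤ 2 * d + 1, b < codeBase d j → ∃ i < j, ∃ t < imageLen d 0 i,
      codeLetter d i t = b := by
    intro j
    induction j with
    | zero =>
      intro _ h
      unfold codeBase at h
      rcases Nat.eq_zero_or_pos d with rfl | h0
      · simp at h
      · rw [if_pos h0] at h
        omega
    | succ j ih =>
      intro hj h
      by_cases hbj : b < codeBase d j
      · obtain ⟨i, h1, h2⟩ := ih (by omega) hbj
        exact ⟨i, by omega, h2⟩
      · rw [codeBase_succ (by omega)] at h
        have := one_le_imageLen (d := d) 0 j
        refine ⟨j, by omega, b - codeBase d j, by omega, ?_⟩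
        unfold codeLetter
        omega
  have h2 : codeBase d (2 * d + 1) = d + 2 ^ d := by
    rw [codeBase, if_neg (by omega), show 2 * d + 1 - d = d + 1 by omega, pow_succ]
    omega
  obtain ⟨i, h3, h4⟩ := key (2 * d + 1) le_rfl (by omega)
  exact ⟨i, by omega, h4⟩

end Code

/-! ### Repetitions and palindromes in the coded sequence -/

/-- `V` arises from `U` by replacing the letters with palindromes. -/
def Coded (d : ℕ) (U V : ℕ → ℕ) : Prop :=
  ∀ m t, t < imageLen d 0 (U m) → V (prefixWeight d U 0 m + t) = codeLetter d (U m) t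

theorem prefixWeight_strictMono (d : ℕ) (U : ℕ → ℕ) : StrictMono (prefixWeight d U 0) :=
  strictMono_nat_of_lt_succ fun m => by
    have := one_le_imageLen (d := d) 0 (U m)
    rw [prefixWeight_succ]
    omega

theorem exists_code_pos (d : ℕ) (U : ℕ → ℕ) (p : ℕ) :
    ∃ m t, p = prefixWeight d U 0 m + t ∧ t < imageLen d 0 (U m) := by
  obtain ⟨m, h1, h2⟩ := exists_between_of_strictMono (prefixWeight_strictMono d U)
    (prefixWeight_zero 0) p
  rw [prefixWeight_succ] at h2
  exact ⟨m, p - prefixWeight d U 0 m, by omega, by omega⟩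

namespace Subst

variable {d : ℕ} {U s V : ℕ → ℕ} (S : Subst (2 * d) U s) (hV : Coded d U V) (hd : 3 ≤ d)
include S hV

/-- A coded letter reveals the original letter and, up to reflection, the position inside its
palindrome. -/
theorem coded_inj {m m' t t' : ℕ} (ht : t < imageLen d 0 (U m)) (ht' : t' < imageLen d 0 (U m'))
    (h : V (prefixWeight d U 0 m + t) = V (prefixWeight d U 0 m' + t')) :
    U m = U m' ∧ (t = t' ∨ t + t' + 1 = imageLen d 0 (U m)) := by
  rw [hV m t ht, hV m' t' ht'] at h
  exact codeLetter_inj (S.le m) (S.le m') ht ht' h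

theorem coded_letter_eq {m m' : ℕ} (h : V (prefixWeight d U 0 m) = V (prefixWeight d U 0 m')) :
    U m = U m' :=
  (S.coded_inj hV (t := 0) (t' := 0) (one_le_imageLen _ _) (one_le_imageLen _ _) h).1

theorem coded_last_eq {m m' : ℕ}
    (h : V (prefixWeight d U 0 (m + 1) - 1) = V (prefixWeight d U 0 (m' + 1) - 1)) :
    U m = U m' := by
  have h1 := one_le_imageLen (d := d) 0 (U m)
  have h2 := one_le_imageLen (d := d) 0 (U m')
  rw [prefixWeight_succ, prefixWeight_succ, Nat.add_sub_assoc h1, Nat.add_sub_assoc h2] at h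
  exact (S.coded_inj hV (by omega) (by omega) h).1

include hd

omit S hV in
theorem imageLen_letter_zero : imageLen d 0 0 = 1 := by
  rw [imageLen_zero d (by omega), if_pos (by omega)]

omit S in
theorem coded_zero {m : ℕ} (h : U m = 0) : V (prefixWeight d U 0 m) = 0 := by
  have := hV m 0 (one_le_imageLen _ _)
  rwa [h, codeLetter_zero (by omega), add_zero] at this

theorem exists_of_coded_zero {p : ℕ} (h : V p = 0) : ∃ m, p = prefixWeight d U 0 m ∧ U m = 0 := by
  obtain ⟨m, t, rfl, ht⟩ := exists_code_pos d U p
  have h0 := coded_zero hV hd (S.at_pos 0)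
  have h1 := S.coded_inj hV (t' := 0) ht (one_le_imageLen 0 (U (s 0)))
    (by rw [h, add_zero, h0])
  rw [S.at_pos] at h1
  rw [h1.1, imageLen_letter_zero hd] at ht
  exact ⟨m, by omega, h1.1⟩

/-- An overlap without the letter `0` is not longer than the period. -/
theorem overlap_le_of_nonzero {i j r : ℕ} (hij : i < j) (ha : Agree V i j r)
    (h0 : ∀ z < r, V (i + z) ≠ 0) : r ≤ j - i := by
  by_contra hlt
  obtain ⟨q, rfl⟩ := Nat.exists_eq_add_of_lt hij
  have hnz : ∀ p, i ≤ p → p ≤ i + q + 1 + (q + 1) → V p ≠ 0 := by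
    intro p h1 h2
    by_cases h3 : p < i + r
    · have := h0 (p - i) (by omega)
      rwa [show i + (p - i) = p by omega] at this
    · have := ha (p - (i + q + 1)) (by omega)
      rw [show i + q + 1 + (p - (i + q + 1)) = p by omega] at this
      rw [← this]
      exact h0 _ (by omega)
  -- A longer overlap yields three equal letters at equal distances. No 0 lies between them, so they
  -- fall into the code of one letter or of ee.
  have e1 := ha 0 (by omega)
  have e2 := ha (q + 1) (by omega)
  rw [add_zero, add_zero] at e1
  rw [show i + (q + 1) = i + q + 1 by omega] at e2
  obtain ⟨m, t, hm, ht⟩ := exists_code_pos d U i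
  obtain ⟨m1, t1, hm1, ht1⟩ := exists_code_pos d U (i + q + 1)
  obtain ⟨m2, t2, hm2, ht2⟩ := exists_code_pos d U (i + q + 1 + (q + 1))
  have hmono := prefixWeight_strictMono d U
  have hnext : ∀ k, prefixWeight d U 0 (k + 1) = prefixWeight d U 0 k + imageLen d 0 (U k) :=
    fun k => prefixWeight_succ 0 k
  have hstep : ∀ k k', prefixWeight d U 0 k < prefixWeight d U 0 (k' + 1) → k ≤ k' := by
    intro k k' h
    have := hmono.lt_iff_lt.1 h
    omega
  have o1 : m ≤ m1 := hstep _ _ (by rw [hnext]; omega)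
  have o2 : m1 ≤ m2 := hstep _ _ (by rw [hnext]; omega)
  have hU : ∀ k, m < k → k ≤ m2 → U k ≠ 0 := by
    intro k h1 h2 h3
    have h4 := coded_zero hV hd h3
    have h5 := hmono.monotone (show m + 1 ≤ k by omega)
    have h6 := hmono.monotone h2
    rw [hnext] at h5
    exact hnz _ (by omega) (by omega) h4
  have hUm : U m ≠ 0 := by
    intro h
    rw [h, imageLen_letter_zero hd] at ht
    have h4 := coded_zero hV hd h
    exact hnz _ (by omega) (by omega) h4
  rw [hm2, hm1] at e2
  rw [hm1] at e1
  nth_rw 1 [hm] at e1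
  obtain ⟨f1, f2⟩ := S.coded_inj hV ht ht1 e1
  obtain ⟨f3, f4⟩ := S.coded_inj hV ht1 ht2 e2
  have hle : m2 ≤ m + 1 := by
    by_contra h
    obtain ⟨n, -, -, -, -, h1⟩ := S.top_of_two_nonzero (p := m) hUm (hU _ (by omega) (by omega))
    exact hU (m + 2) (by omega) (by omega) (by rw [h1, S.at_pos])
  rw [← f1] at f4 ht1 f3
  rw [← f3] at ht2
  rcases (by omega : m2 = m ∨ m2 = m + 1) with rfl | rfl
  · obtain rfl : m1 = m2 := by omega
    omega
  -- In the code of ee, with blocks of length H, equal letters at equal distances would force H = 4t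
  -- + 2. But H = 2^d is divisible by 4, as the form 8 * 2^(d-3) records.
  · obtain ⟨n, -, -, h1, -, -⟩ := S.top_of_two_nonzero (p := m) hUm (hU _ (by omega) (by omega))
    have hH : imageLen d 0 (U m) = 8 * 2 ^ (d - 3) := by
      rw [h1, imageLen_zero d le_rfl, if_neg (by omega), show 2 * d - d = 3 + (d - 3) by omega,
        pow_add]
      norm_num
    have hnm := hnext m
    rcases (by omega : m1 = m ∨ m1 = m + 1) with rfl | rfl <;> omega

variable {x : ℝ}

/-- The letter 0 codes only the original 0, so an overlap containing it aligns the blocks.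
Mismatching letters have disjoint codes, so the overlap cannot enter their blocks and lies in the
code of an overlap in `U`. -/
theorem coded_repetition_bound (hx : 2 < x) (hroot : x ^ d * (x - 2) = 1) {i j r : ℕ} (hij : i < j)
    (ha : Agree V i j r) : (3 - x) * r ≤ (j : ℝ) - i := by
  have hx3 : 0 < 3 - x := by
    have := root_sub_two_le hx hroot hd
    linarith
  by_cases hz : ∃ z < r, V (i + z) = 0
  · obtain ⟨z, hz, hz0⟩ := hz
    obtain ⟨m, hm, hm0⟩ := S.exists_of_coded_zero hV hd hz0
    obtain ⟨m', hm', hm0'⟩ := S.exists_of_coded_zero hV hd (p := j + z) (by rw [← ha z hz, hz0])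
    have hmono := prefixWeight_strictMono d U
    have hmm : m < m' := hmono.lt_iff_lt.1 (by omega)
    have hexr := S.not_eventually_periodic hmm
    classical
    have hr1 := Nat.find_spec hexr
    have hr2 : Agree U m m' (Nat.find hexr) := fun t ht => by
      have := Nat.find_min hexr ht
      push Not at this
      exact this
    generalize Nat.find hexr = R at *
    obtain ⟨a, ha1, ha2, ha3⟩ := exists_left_maximal U hmm
    have w1 := hr2.prefixWeight (d := d) 0 le_rfl
    have w2 := ha2.prefixWeight (d := d) 0 le_rfl
    rw [show a + (m - a) = m by omega, show m' - (m - a) + (m - a) = m' by omega] at w2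
    have hright : i + r ≤ prefixWeight d U 0 (m + R) := by
      by_contra hlt
      have h1 := hmono.monotone (show m ≤ m + R by omega)
      have h2 := ha (prefixWeight d U 0 (m + R) - i) (by omega)
      rw [show i + (prefixWeight d U 0 (m + R) - i) = prefixWeight d U 0 (m + R) by omega,
        show j + (prefixWeight d U 0 (m + R) - i) = prefixWeight d U 0 (m' + R) by omega] at h2
      exact hr1 (S.coded_letter_eq hV h2)
    have hleft : prefixWeight d U 0 a ≤ i := by
      by_contra hlt
      rcases ha3 with rfl | ha3
      · rw [prefixWeight_zero] at hlt
        omega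
      · have h0 : a ≠ 0 := by
          rintro rfl
          rw [prefixWeight_zero] at hlt
          omega
        have h1 := hmono.monotone ha1
        have h2 := ha (prefixWeight d U 0 a - 1 - i) (by omega)
        rw [show i + (prefixWeight d U 0 a - 1 - i) = prefixWeight d U 0 a - 1 by omega,
          show j + (prefixWeight d U 0 a - 1 - i) = prefixWeight d U 0 (m' - (m - a)) - 1 by omega]
          at h2
        refine ha3 (S.coded_last_eq hV ?_)
        rwa [show a - 1 + 1 = a by omega, show m' - (m - a) - 1 + 1 = m' - (m - a) by omega]
    have hagree : Agree U a (m' - (m - a)) (m - a + R) := by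
      intro t ht
      by_cases h : t < m - a
      · exact ha2 t h
      · have := hr2 (t - (m - a)) (by omega)
        rwa [show m + (t - (m - a)) = a + t by omega,
          show m' + (t - (m - a)) = m' - (m - a) + t by omega] at this
    have key := S.repetition_bound hd hx hroot 0 (by omega) hagree
    rw [show a + (m - a + R) = m + R by omega] at key
    have k1 : (i : ℝ) + r ≤ prefixWeight d U 0 (m + R) := by exact_mod_cast hright
    have k2 : (prefixWeight d U 0 a : ℝ) ≤ i := by exact_mod_cast hleft
    have k3 : (prefixWeight d U 0 m + prefixWeight d U 0 (m' - (m - a)) : ℝ) =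
        prefixWeight d U 0 m' + prefixWeight d U 0 a := by exact_mod_cast w2
    have k4 : (i : ℝ) + z = prefixWeight d U 0 m := by exact_mod_cast hm
    have k5 : (j : ℝ) + z = prefixWeight d U 0 m' := by exact_mod_cast hm'
    nlinarith
  · push Not at hz
    have h1 := S.overlap_le_of_nonzero hV hd hij ha hz
    have h2 : (i : ℝ) + r ≤ j := by exact_mod_cast (by omega)
    have h3 : (0 : ℝ) ≤ r := by positivity
    nlinarith

omit S hd in
theorem coded_isPal {l m : ℕ} (h : IsPal U l (m + 1)) :
    IsPal V (prefixWeight d U 0 l) (prefixWeight d U 0 (m + 1)) := by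
  have hmono := prefixWeight_strictMono d U
  have hpos : ∀ t, l + t ≤ m + 1 → prefixWeight d U 0 (l + t) + prefixWeight d U 0 (m + 1 - t) =
      prefixWeight d U 0 l + prefixWeight d U 0 (m + 1) := by
    intro t
    induction t with
    | zero => intro _; simp
    | succ t ih =>
      intro ht
      have h1 := ih (by omega)
      have h2 := h (l + t) (by omega) (by omega)
      have h3 := prefixWeight_succ (d := d) (U := U) 0 (m + 1 - (t + 1))
      rw [← add_assoc, prefixWeight_succ, h2,
        show l + (m + 1) - 1 - (l + t) = m + 1 - (t + 1) by omega]
      rw [show m + 1 - (t + 1) + 1 = m + 1 - t by omega] at h3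
      omega
  intro p h1 h2
  obtain ⟨k, t, rfl, ht⟩ := exists_code_pos d U p
  have hlk : l ≤ k := by
    have := hmono.lt_iff_lt.1 (show prefixWeight d U 0 l < prefixWeight d U 0 (k + 1) by
      rw [prefixWeight_succ]; omega)
    omega
  have hkm : k < m + 1 := hmono.lt_iff_lt.1 (by omega)
  obtain ⟨y, rfl⟩ := Nat.exists_eq_add_of_le hlk
  have h3 := hpos y (by omega)
  have h4 := h (l + y) (by omega) hkm
  rw [show l + (m + 1) - 1 - (l + y) = m - y by omega] at h4
  have h5 := prefixWeight_succ (d := d) (U := U) 0 (m - y)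
  rw [show m - y + 1 = m + 1 - y by omega, ← h4] at h5
  rw [show prefixWeight d U 0 l + prefixWeight d U 0 (m + 1) - 1 - (prefixWeight d U 0 (l + y) + t) =
    prefixWeight d U 0 (m - y) + (imageLen d 0 (U (l + y)) - 1 - t) by omega, hV _ _ ht,
    hV _ _ (by rw [← h4]; omega), ← h4, codeLetter_symm ht]

omit hd in
theorem coded_agree_right {k k' w : ℕ}
    (h : Agree V (prefixWeight d U 0 k) (prefixWeight d U 0 k') w) (t : ℕ)
    (ht : prefixWeight d U 0 (k + t) < prefixWeight d U 0 k + w) :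
    U (k + t) = U (k' + t) ∧ prefixWeight d U 0 (k + t) + prefixWeight d U 0 k' =
      prefixWeight d U 0 (k' + t) + prefixWeight d U 0 k := by
  have hmono := prefixWeight_strictMono d U
  have aux : ∀ t, prefixWeight d U 0 (k + t) < prefixWeight d U 0 k + w →
      prefixWeight d U 0 (k + t) + prefixWeight d U 0 k' =
        prefixWeight d U 0 (k' + t) + prefixWeight d U 0 k → U (k + t) = U (k' + t) := by
    intro t h1 h2
    have h3 := hmono.monotone (show k ≤ k + t by omega)
    have h4 := h (prefixWeight d U 0 (k + t) - prefixWeight d U 0 k) (by omega)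
    refine S.coded_letter_eq hV ?_
    rwa [show prefixWeight d U 0 k + (prefixWeight d U 0 (k + t) - prefixWeight d U 0 k) =
      prefixWeight d U 0 (k + t) by omega,
      show prefixWeight d U 0 k' + (prefixWeight d U 0 (k + t) - prefixWeight d U 0 k) =
      prefixWeight d U 0 (k' + t) by omega] at h4
  induction t with
  | zero => exact ⟨aux 0 ht (by rw [add_zero, add_zero]; omega), by rw [add_zero, add_zero]; omega⟩
  | succ t ih =>
    have h1 := hmono (show k + t < k + (t + 1) by omega)
    obtain ⟨h2, h3⟩ := ih (by omega)
    have h4 : prefixWeight d U 0 (k + (t + 1)) + prefixWeight d U 0 k' =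
        prefixWeight d U 0 (k' + (t + 1)) + prefixWeight d U 0 k := by
      rw [← add_assoc, ← add_assoc, prefixWeight_succ, prefixWeight_succ, h2]
      omega
    exact ⟨aux _ ht h4, h4⟩

omit hd in
theorem coded_agree_left {k k' w : ℕ} (hw : w ≤ prefixWeight d U 0 k')
    (h : ∀ y < w, V (prefixWeight d U 0 k - 1 - y) = V (prefixWeight d U 0 k' - 1 - y)) (t : ℕ)
    (htk : t < k) (ht : prefixWeight d U 0 k ≤ prefixWeight d U 0 (k - t) - 1 + w) :
    t < k' ∧ U (k - t - 1) = U (k' - t - 1) ∧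
      prefixWeight d U 0 (k - t) + prefixWeight d U 0 k' =
        prefixWeight d U 0 (k' - t) + prefixWeight d U 0 k := by
  have hmono := prefixWeight_strictMono d U
  have aux : ∀ t < k, prefixWeight d U 0 k ≤ prefixWeight d U 0 (k - t) - 1 + w → t ≤ k' →
      prefixWeight d U 0 (k - t) + prefixWeight d U 0 k' =
        prefixWeight d U 0 (k' - t) + prefixWeight d U 0 k →
      t < k' ∧ U (k - t - 1) = U (k' - t - 1) := by
    intro t h0 h1 h2 h3
    have h5 := hmono.monotone (show k - t ≤ k by omega)
    have h6 := hmono (show 0 < k - t by omega)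
    rw [prefixWeight_zero] at h6
    have htk' : t < k' := by
      by_contra hlt
      obtain rfl : t = k' := by omega
      rw [Nat.sub_self, prefixWeight_zero] at h3
      omega
    have h7 := h (prefixWeight d U 0 k - prefixWeight d U 0 (k - t)) (by omega)
    refine ⟨htk', S.coded_last_eq hV ?_⟩
    rw [show k - t - 1 + 1 = k - t by omega, show k' - t - 1 + 1 = k' - t by omega]
    rwa [show prefixWeight d U 0 k - 1 - (prefixWeight d U 0 k - prefixWeight d U 0 (k - t)) =
      prefixWeight d U 0 (k - t) - 1 by omega,
      show prefixWeight d U 0 k' - 1 - (prefixWeight d U 0 k - prefixWeight d U 0 (k - t)) =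
      prefixWeight d U 0 (k' - t) - 1 by omega] at h7
  induction t with
  | zero =>
    have h1 := aux 0 htk ht (by omega) (by rw [Nat.sub_zero, Nat.sub_zero]; omega)
    exact ⟨h1.1, h1.2, by rw [Nat.sub_zero, Nat.sub_zero]; omega⟩
  | succ t ih =>
    have h1 := hmono (show k - (t + 1) < k - t by omega)
    obtain ⟨h2, h3, h4⟩ := ih (by omega) (by omega)
    have h5 := prefixWeight_succ (d := d) (U := U) 0 (k - t - 1)
    have h6 := prefixWeight_succ (d := d) (U := U) 0 (k' - t - 1)
    rw [show k - t - 1 + 1 = k - t by omega] at h5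
    rw [show k' - t - 1 + 1 = k' - t by omega, ← h3] at h6
    have h7 : prefixWeight d U 0 (k - (t + 1)) + prefixWeight d U 0 k' =
        prefixWeight d U 0 (k' - (t + 1)) + prefixWeight d U 0 k := by
      rw [show k - (t + 1) = k - t - 1 by omega, show k' - (t + 1) = k' - t - 1 by omega]
      omega
    have h8 := aux (t + 1) htk ht (by omega) h7
    exact ⟨h8.1, h8.2, h7⟩

/-- The image of an occurrence of a palindrome, with the same number of letters cut off at both
ends, determines the occurrence. -/
theorem coded_occurrence {l m t i' : ℕ} (hlm : l < m) (hpal : IsPal U l (m + 1))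
    (ht : t < imageLen d 0 (U m))
    (hi' : i' < prefixWeight d U 0 l + (imageLen d 0 (U m) - 1 - t))
    (ha : Agree V i' (prefixWeight d U 0 l + (imageLen d 0 (U m) - 1 - t))
      (prefixWeight d U 0 m + t + 1 - (prefixWeight d U 0 l + (imageLen d 0 (U m) - 1 - t)))) :
    ∃ l' < l, Agree U l' l (m + 1 - l) := by
  have hmono := prefixWeight_strictMono d U
  have hUl : U l = U m := by
    rw [hpal l le_rfl (by omega)]
    congr 1
    omega
  have hWl := prefixWeight_succ (d := d) (U := U) 0 l
  rw [hUl] at hWl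
  have hlm' := hmono.monotone (show l + 1 ≤ m by omega)
  set i := prefixWeight d U 0 l + (imageLen d 0 (U m) - 1 - t) with hi
  by_cases hz : ∃ k, l ≤ k ∧ k ≤ m ∧ U k = 0
  · obtain ⟨k, hlk, hkm, hk0⟩ := hz
    have hik : i ≤ prefixWeight d U 0 k := by
      rcases hlk.lt_or_eq with h | h
      · have := hmono.monotone (show l + 1 ≤ k by omega)
        omega
      · subst h
        rw [← hUl, hk0, imageLen_letter_zero hd] at hi
        omega
    have hkm' := hmono.monotone hkm
    have h1 := ha (prefixWeight d U 0 k - i) (by omega)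
    rw [show i + (prefixWeight d U 0 k - i) = prefixWeight d U 0 k by omega,
      coded_zero hV hd hk0] at h1
    obtain ⟨k', hk', hk0'⟩ := S.exists_of_coded_zero hV hd h1
    have hkk : k' < k := hmono.lt_iff_lt.1 (by omega)
    have hright : Agree V (prefixWeight d U 0 k) (prefixWeight d U 0 k')
        (prefixWeight d U 0 m + t + 1 - prefixWeight d U 0 k) := by
      intro y hy
      have := ha (prefixWeight d U 0 k - i + y) (by omega)
      rw [show i' + (prefixWeight d U 0 k - i + y) = prefixWeight d U 0 k' + y by omega,
        show i + (prefixWeight d U 0 k - i + y) = prefixWeight d U 0 k + y by omega] at this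
      exact this.symm
    have hleft : ∀ y < prefixWeight d U 0 k - i,
        V (prefixWeight d U 0 k - 1 - y) = V (prefixWeight d U 0 k' - 1 - y) := by
      intro y hy
      have := ha (prefixWeight d U 0 k - i - 1 - y) (by omega)
      rw [show i' + (prefixWeight d U 0 k - i - 1 - y) = prefixWeight d U 0 k' - 1 - y by omega,
        show i + (prefixWeight d U 0 k - i - 1 - y) = prefixWeight d U 0 k - 1 - y by omega] at this
      exact this.symm
    have hL : ∀ y < k - l, y < k' ∧ U (k - y - 1) = U (k' - y - 1) := by
      intro y hy
      have h2 := hmono.monotone (show l + 1 ≤ k - y by omega)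
      have h3 := hmono.monotone (show k - y ≤ k by omega)
      have := S.coded_agree_left hV (w := prefixWeight d U 0 k - i) (by omega) hleft y (by omega)
        (by omega)
      exact ⟨this.1, this.2.1⟩
    have hkl : k - l ≤ k' := by
      rcases Nat.eq_zero_or_pos (k - l) with h | h
      · omega
      · have := (hL (k - l - 1) (by omega)).1
        omega
    refine ⟨k' - (k - l), by omega, fun y hy => ?_⟩
    by_cases h : y < k - l
    · have := (hL (k - l - 1 - y) (by omega)).2
      rw [show k - (k - l - 1 - y) - 1 = l + y by omega,
        show k' - (k - l - 1 - y) - 1 = k' - (k - l) + y by omega] at this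
      exact this.symm
    · have h2 := hmono.monotone (show k + (y - (k - l)) ≤ m by omega)
      have := (S.coded_agree_right hV hright (y - (k - l)) (by omega)).1
      rw [show k + (y - (k - l)) = l + y by omega,
        show k' + (y - (k - l)) = k' - (k - l) + y by omega] at this
      exact this.symm
  · push Not at hz
    -- A palindrome without 0 and longer than one letter is ee. Alignment now has to come from the
    -- boundary between its two blocks.
    obtain ⟨n, -, -, h1, h2, h3⟩ := S.top_of_two_nonzero (p := l) (hz l le_rfl (by omega))
      (hz (l + 1) (by omega) (by omega))
    obtain rfl : m = l + 1 := by
      by_contra h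
      exact hz (l + 2) (by omega) (by omega) (by rw [h3, S.at_pos])
    have hH : imageLen d 0 (U (l + 1)) = 8 * 2 ^ (d - 3) := by
      rw [h2, imageLen_zero d le_rfl, if_neg (by omega), show 2 * d - d = 3 + (d - 3) by omega,
        pow_add]
      norm_num
    have hpos : 0 < 2 ^ (d - 3) := by positivity
    generalize 2 ^ (d - 3) = c at hH hpos
    have a1 := ha t (by omega)
    have a2 := ha (t + 1) (by omega)
    rw [show i + t = prefixWeight d U 0 l + (imageLen d 0 (U (l + 1)) - 1) by omega] at a1
    rw [show i + (t + 1) = prefixWeight d U 0 (l + 1) + 0 by omega] at a2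
    obtain ⟨k, y, hk, hy⟩ := exists_code_pos d U (i' + t)
    rw [hk] at a1
    obtain ⟨b1, b2⟩ := S.coded_inj hV hy (by rw [hUl]; omega) a1
    rw [h1] at b1
    have hUk : U k = U (l + 1) := by rw [b1, h2]
    rw [hUk] at b2 hy
    have hWk := prefixWeight_succ (d := d) (U := U) 0 k
    rw [hUk] at hWk
    rw [← add_assoc, hk] at a2
    -- The first and last letters of the block coincide. After the first one comes a different
    -- letter of the same block, so only the last can match.
    have hy2 : y = imageLen d 0 (U (l + 1)) - 1 := by
      rcases b2 with b2 | b2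
      · exact b2
      · obtain rfl : y = 0 := by omega
        have := S.coded_inj hV (m := k) (t := 1) (by rw [hUk]; omega) (one_le_imageLen _ _) a2
        rw [hUk] at this
        omega
    rw [show prefixWeight d U 0 k + y + 1 = prefixWeight d U 0 (k + 1) + 0 by omega] at a2
    have hUk1 := (S.coded_inj hV (one_le_imageLen _ _) (one_le_imageLen _ _) a2).1
    have hkl : k < l := hmono.lt_iff_lt.1 (by omega)
    refine ⟨k, hkl, fun z hz => ?_⟩
    rcases (by omega : z = 0 ∨ z = 1) with rfl | rfl
    · rw [add_zero, add_zero, b1, h1]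
    · exact hUk1

/-- If the unioccurrent palindromic suffix of `U` is longer than one letter, its code is trimmed
equally at both ends. If it is one letter, that letter is new in `U` and a palindrome inside its
block suffices. -/
theorem coded_exists_unioccurrent (N : ℕ) :
    ∃ i ≤ N, IsPal V i (N + 1) ∧ ∀ i' < i, ¬ Agree V i' i (N + 1 - i) := by
  have hmono := prefixWeight_strictMono d U
  obtain ⟨m, t, rfl, ht⟩ := exists_code_pos d U N
  obtain ⟨l, hl, hpal, hno⟩ := S.exists_unioccurrent m
  have hWm := prefixWeight_succ (d := d) (U := U) 0 m
  have hpalV := coded_isPal hV hpal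
  rcases hl.lt_or_eq with hlm | rfl
  · have hUl : U l = U m := by
      rw [hpal l le_rfl (by omega)]
      congr 1
      omega
    have hWl := prefixWeight_succ (d := d) (U := U) 0 l
    have h1 := hmono.monotone (show l + 1 ≤ m by omega)
    rw [hUl] at hWl
    refine ⟨prefixWeight d U 0 l + (imageLen d 0 (U m) - 1 - t), by omega,
      (hpalV.shrink (imageLen d 0 (U m) - 1 - t)).congr rfl (by omega), fun i' hi' ha => ?_⟩
    obtain ⟨l', h2, h3⟩ := S.coded_occurrence hV hd hlm hpal ht hi' ha
    exact hno l' h2 h3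
  · refine ⟨prefixWeight d U 0 l + min t (imageLen d 0 (U l) - 1 - t), by omega, ?_,
      fun i' hi' ha => ?_⟩
    · rcases le_total t (imageLen d 0 (U l) - 1 - t) with h | h
      · rw [min_eq_left h]
        intro p h1 h2
        congr 1
        omega
      · rw [min_eq_right h]
        exact (hpalV.shrink (imageLen d 0 (U l) - 1 - t)).congr rfl (by omega)
    · obtain ⟨k, y, hk, hy⟩ := exists_code_pos d U i'
      have a0 := ha 0 (by omega)
      rw [add_zero, add_zero, hk] at a0
      obtain ⟨b1, b2⟩ := S.coded_inj hV hy (by omega) a0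
      have hkl : k ≤ l := by
        have := hmono.lt_iff_lt.1 (show prefixWeight d U 0 k < prefixWeight d U 0 (l + 1) by omega)
        omega
      rcases hkl.lt_or_eq with h | rfl
      · refine hno k h fun z hz => ?_
        obtain rfl : z = 0 := by omega
        exact b1
      · omega

end Subst

/-! ### The dominant root -/

section Root

theorem exists_root {d : ℕ} (hd : 1 ≤ d) : ∃ x : ℝ, 2 < x ∧ x < 3 ∧ x ^ d * (x - 2) = 1 := by
  have hcont : ContinuousOn (fun x : ℝ => x ^ d * (x - 2)) (Set.Icc 2 3) := by fun_prop
  have h3 : (3 : ℝ) ^ 1 ≤ 3 ^ d := pow_le_pow_right₀ (by norm_num) hd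
  have hmem : (1 : ℝ) ∈ Set.Icc ((2 : ℝ) ^ d * (2 - 2)) (3 ^ d * (3 - 2)) := by
    constructor <;> linarith
  obtain ⟨x, ⟨h4, h5⟩, h6⟩ := intermediate_value_Icc (by norm_num : (2 : ℝ) ≤ 3) hcont hmem
  simp only at h6
  refine ⟨x, lt_of_le_of_ne h4 ?_, lt_of_le_of_ne h5 ?_, h6⟩
  · rintro rfl
    norm_num at h6
  · rintro rfl
    linarith

-- Roots satisfy |z|^d |z-2| = 1. If |z| ≥ x, then |z-2| ≤ x-2, while |z-2| ≥ |z|-2 ≥ x-2; equality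
-- throughout forces z = x.
open Polynomial in
theorem isDominantRoot_of_root {d : ℕ} {x : ℝ} (hx : 2 < x) (hroot : x ^ d * (x - 2) = 1) :
    IsDominantRoot ((X ^ (2 * d) * (X - 2) ^ 2 - 1 : ℂ[X])) (x : ℂ) := by
  have heval : ∀ z : ℂ, (X ^ (2 * d) * (X - 2) ^ 2 - 1 : ℂ[X]).IsRoot z ↔
      (z ^ d * (z - 2)) ^ 2 = 1 := by
    intro z
    have h2 : eval z (2 : ℂ[X]) = 2 := by
      simp
    rw [IsRoot, eval_sub, eval_mul, eval_pow, eval_pow, eval_sub, eval_X, eval_one, h2, sub_eq_zero,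
      mul_pow, ← pow_mul, mul_comm d 2]
  refine ⟨(heval _).2 ?_, fun z hz hne => ?_⟩
  · have : ((x ^ d * (x - 2) : ℝ) : ℂ) = 1 := by rw [hroot, Complex.ofReal_one]
    push_cast at this
    rw [this, one_pow]
  · have h1 := congrArg norm ((heval z).1 hz)
    rw [norm_pow, norm_mul, norm_pow, norm_one] at h1
    have h2 : ‖z‖ ^ d * ‖z - 2‖ = 1 := by
      have : 0 ≤ ‖z‖ ^ d * ‖z - 2‖ := by positivity
      nlinarith
    rw [Complex.norm_real, Real.norm_of_nonneg (by linarith)]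
    by_contra hlt
    push Not at hlt
    have h3 : ‖z‖ - 2 ≤ ‖z - 2‖ := by
      have := norm_sub_norm_le z 2
      simpa using this
    have h4 : x ^ d ≤ ‖z‖ ^ d := pow_le_pow_left₀ (by linarith) hlt d
    have h5 : 0 < x ^ d := by positivity
    have h6 : ‖z - 2‖ ≤ x - 2 := by
      by_contra h
      push Not at h
      have h8 : x ^ d * (x - 2) < x ^ d * ‖z - 2‖ := mul_lt_mul_of_pos_left h h5
      have h9 := mul_le_mul_of_nonneg_right h4 (norm_nonneg (z - 2))
      linarith
    have h7 : ‖z‖ = x := by linarith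
    have h8 : ‖z - 2‖ = x - 2 := by linarith
    have h9 := Complex.sq_norm z
    have h10 := Complex.sq_norm (z - 2)
    rw [Complex.normSq_apply] at h9 h10
    simp only [Complex.sub_re, Complex.sub_im, Complex.re_ofNat, Complex.im_ofNat, sub_zero] at h10
    rw [h7] at h9
    rw [h8] at h10
    have hre : z.re = x := by nlinarith
    have him : z.im = 0 := by
      rw [hre] at h9
      nlinarith
    exact hne (Complex.ext (by simpa using hre) (by simpa using him))

end Root

/-! ### Existence and uniqueness of the fixed point -/

section FixedPoint

variable (k : ℕ) [NeZero k]

theorem phi_ne_nil (i : Fin k) : phi k i ≠ [] := by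
  unfold phi
  split_ifs <;> simp

theorem phi_head (i : Fin k) : (phi k i)[0]? = some 0 := by
  unfold phi
  split_ifs <;> simp

theorem two_le_length_phi (i : Fin k) : 2 ≤ (phi k i).length := by
  unfold phi
  split_ifs <;> simp

/-- The word `φ^n(0)`. -/
def phiIterate : ℕ → List (Fin k)
  | 0 => [0]
  | n + 1 => (phiIterate n).flatMap (phi k)

theorem phiIterate_prefix_succ (n : ℕ) : phiIterate k n <+: phiIterate k (n + 1) := by
  induction n with
  | zero =>
    rw [phiIterate, phiIterate, phiIterate, List.flatMap_cons, List.flatMap_nil, List.append_nil]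
    obtain ⟨a, l, h⟩ := List.exists_cons_of_ne_nil (phi_ne_nil k 0)
    have := phi_head k 0
    rw [h] at this ⊢
    simp only [List.getElem?_cons_zero, Option.some.injEq] at this
    rw [this]
    exact List.prefix_append [0] l
  | succ n ih =>
    obtain ⟨t, ht⟩ := ih
    have h1 : phiIterate k (n + 1) = (phiIterate k n).flatMap (phi k) := rfl
    have h2 : phiIterate k (n + 1 + 1) = (phiIterate k (n + 1)).flatMap (phi k) := rfl
    have h3 : (phiIterate k (n + 1)).flatMap (phi k) =
        phiIterate k (n + 1) ++ t.flatMap (phi k) := by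
      calc _ = (phiIterate k n ++ t).flatMap (phi k) := by rw [ht]
        _ = _ := by rw [List.flatMap_append, h1]
    rw [h2, h3]
    exact List.prefix_append _ _

theorem phiIterate_prefix {m n : ℕ} (h : m ≤ n) : phiIterate k m <+: phiIterate k n := by
  induction n with
  | zero =>
    obtain rfl : m = 0 := by omega
    exact List.prefix_rfl
  | succ n ih =>
    rcases h.lt_or_eq with h | rfl
    · exact (ih (by omega)).trans (phiIterate_prefix_succ k n)
    · exact List.prefix_rfl

theorem lt_length_phiIterate (n : ℕ) : n < (phiIterate k n).length := by
  induction n with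
  | zero => simp [phiIterate]
  | succ n ih =>
    have h : ∀ w : List (Fin k), 2 * w.length ≤ (w.flatMap (phi k)).length := by
      intro w
      induction w with
      | nil => simp
      | cons a w ihw =>
        have := two_le_length_phi k a
        rw [List.flatMap_cons, List.length_append, List.length_cons]
        omega
    have := h (phiIterate k n)
    rw [phiIterate]
    omega

/-- The words φ^n(0) are prefixes of each other with unbounded lengths; the diagonal sequence is
their limit. -/
theorem exists_fixedPoint : ∃ u : ℕ → Fin k, IsFixedPoint (phi k) u := by
  set u : ℕ → Fin k := fun p => (phiIterate k p)[p]'(lt_length_phiIterate k p) with hu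
  have hblock : ∀ n, phiIterate k n = block u 0 (phiIterate k n).length := by
    intro n
    refine List.ext_getElem (by simp) fun t h1 h2 => ?_
    rw [getElem_block, zero_add]
    rcases le_total n t with h | h
    · exact (phiIterate_prefix k h).getElem h1
    · exact ((phiIterate_prefix k h).getElem (lt_length_phiIterate k t)).symm
  have hpre : ∀ (l : List (Fin k)) N, l <+: block u 0 N → l = block u 0 l.length := by
    intro l N h
    refine List.ext_getElem (by simp) fun t h1 h2 => ?_
    rw [h.getElem h1, getElem_block, getElem_block]
  refine ⟨u, fun n => ?_, fun N => ⟨N, le_imagePos u (phi_ne_nil k) N⟩⟩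
  obtain ⟨a, ha⟩ := Nat.exists_eq_add_of_le (lt_length_phiIterate k n).le
  have h1 : phiIterate k (n + 1) = (block u 0 n).flatMap (phi k) ++
      (block u (0 + n) a).flatMap (phi k) := by
    rw [← List.flatMap_append, ← block_add, ← ha, ← hblock]
    rfl
  refine hpre _ (phiIterate k (n + 1)).length ?_
  rw [← hblock, h1]
  exact List.prefix_append _ _

theorem two_mul_le_imagePos (u : ℕ → Fin k) (n : ℕ) : 2 * n ≤ imagePos (phi k) u n := by
  induction n with
  | zero => simp
  | succ n ih =>
    have := two_le_length_phi k (u n)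
    rw [imagePos_succ]
    omega

theorem imagePos_strictMono (u : ℕ → Fin k) : StrictMono (imagePos (phi k) u) :=
  strictMono_nat_of_lt_succ fun n => by
    have := two_le_length_phi k (u n)
    rw [imagePos_succ]
    omega

theorem fixedPoint_unique {u u' : ℕ → Fin k} (h : IsFixedPoint (phi k) u)
    (h' : IsFixedPoint (phi k) u') : u' = u := by
  funext p
  induction p using Nat.strong_induction_on with
  | _ p ih =>
  rcases Nat.eq_zero_or_pos p with rfl | hp
  · have h1 := IsImage.apply h 0 0 (by have := two_le_length_phi k (u 0); omega)
    have h2 := IsImage.apply h' 0 0 (by have := two_le_length_phi k (u' 0); omega)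
    rw [imagePos_zero, phi_head] at h1 h2
    exact (Option.some_injective _ h2).symm.trans (Option.some_injective _ h1)
  -- The letter at `p` lies in the image of the letter at some `n` with 2n ≤ p, so n < p and the
  -- earlier letters determine it.
  · obtain ⟨n, h1, h2⟩ := exists_between_of_strictMono (imagePos_strictMono k u)
      (imagePos_zero _ _) p
    have h3 := two_mul_le_imagePos k u n
    have hpos : imagePos (phi k) u' n = imagePos (phi k) u n := by
      have hb : block u' 0 n = block u 0 n :=
        block_eq_block fun t ht => by rw [zero_add]; exact ih t (by omega)
      rw [imagePos, imagePos, hb]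
    have hn := ih n (by omega)
    rw [imagePos_succ] at h2
    have h4 := IsImage.apply h n (p - imagePos (phi k) u n) (by omega)
    have h5 := IsImage.apply h' n (p - imagePos (phi k) u n) (by rw [hn]; omega)
    rw [show imagePos (phi k) u n + (p - imagePos (phi k) u n) = p by omega] at h4
    rw [hpos, show imagePos (phi k) u n + (p - imagePos (phi k) u n) = p by omega, hn, h4] at h5
    exact (Option.some_injective _ h5).symm

theorem subst_of_fixedPoint {e : ℕ} (he : 2 ≤ e) {u : ℕ → Fin (e + 1)}
    (h : IsFixedPoint (phi (e + 1)) u) :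
    Subst e (fun p => (u p : ℕ)) (imagePos (phi (e + 1)) u) := by
  have hlow : ∀ n (hn : (u n : ℕ) ≠ e), phi (e + 1) (u n) = [0, ⟨u n + 1, by omega⟩] := by
    intro n hn
    rw [phi, dif_pos (by omega)]
  have htop : ∀ n, (u n : ℕ) = e → phi (e + 1) (u n) = [0, u n, u n] := by
    intro n hn
    rw [phi, dif_neg (by omega)]
  refine ⟨he, imagePos_zero _ _, fun n => ?_, fun n => ?_, fun n => ?_, fun n hn => ?_,
    fun n => by omega⟩
  · rw [imagePos_succ]
    split_ifs with hn
    · rw [htop n hn]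
      rfl
    · rw [hlow n hn]
      rfl
  · have h1 := IsImage.apply h n 0 (by have := two_le_length_phi (e + 1) (u n); omega)
    rw [phi_head, add_zero] at h1
    rw [← Option.some_injective _ h1]
    rfl
  · have h1 := IsImage.apply h n 1 (by have := two_le_length_phi (e + 1) (u n); omega)
    by_cases hn : (u n : ℕ) = e
    · rw [htop n hn] at h1
      rw [← Option.some_injective _ h1]
      omega
    · rw [hlow n hn] at h1
      rw [← Option.some_injective _ h1]
      change (u n : ℕ) + 1 = _
      omega
  · have h1 := IsImage.apply h n 2 (by rw [htop n hn]; simp)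
    rw [htop n hn] at h1
    rw [← Option.some_injective _ h1]
    exact hn

end FixedPoint

/-! ### The code as a morphism of words -/

section CodeMorphism

/-- The morphism that replaces the letters with palindromes. -/
def codeMorphism (d : ℕ) (i : Fin (2 * d + 1)) : List (Fin (d + 2 ^ d)) :=
  List.ofFn fun t : Fin (imageLen d 0 i) =>
    ⟨codeLetter d i t, codeLetter_lt (by omega) t.2⟩

variable {d : ℕ}

theorem length_codeMorphism (i : Fin (2 * d + 1)) :
    (codeMorphism d i).length = imageLen d 0 i := by
  simp [codeMorphism]

theorem imageLen_zero_eq_weight (i : Fin (2 * d + 1)) : imageLen d 0 i = weight d i := by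
  rw [imageLen_zero d (by omega), weight]

theorem mem_codeMorphism {i : Fin (2 * d + 1)} {b : Fin (d + 2 ^ d)} :
    b ∈ codeMorphism d i ↔ ∃ t < imageLen d 0 i, codeLetter d i t = b := by
  rw [codeMorphism, List.mem_ofFn]
  constructor
  · rintro ⟨t, rfl⟩
    exact ⟨t, t.2, rfl⟩
  · rintro ⟨t, ht, h⟩
    exact ⟨⟨t, ht⟩, Fin.ext h⟩

theorem codeMorphism_ne_nil (i : Fin (2 * d + 1)) : codeMorphism d i ≠ [] := by
  rw [← List.length_pos_iff, length_codeMorphism]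
  exact one_le_imageLen _ _

theorem isWeighted_codeMorphism : IsWeighted d (codeMorphism d) := by
  refine ⟨fun i => ?_, fun i => ?_, fun i => ?_, fun i j hij b hb hb' => ?_⟩
  · refine List.Palindrome.of_reverse_eq (List.ext_getElem (by simp) fun t h1 h2 => ?_)
    rw [length_codeMorphism] at h2
    refine Fin.ext ?_
    rw [List.getElem_reverse]
    simp only [codeMorphism, List.getElem_ofFn, List.length_ofFn]
    exact codeLetter_symm h2
  · rw [length_codeMorphism, imageLen_zero_eq_weight]
  · rw [← imageLen_zero_eq_weight,
      ← Set.ncard_image_of_injective _ (Fin.val_injective (n := d + 2 ^ d))]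
    have hset : Fin.val '' {b : Fin (d + 2 ^ d) | b ∈ codeMorphism d i} =
        Set.Ico (codeBase d i) (codeBase d i + (imageLen d 0 i + 1) / 2) := by
      ext c
      constructor
      · rintro ⟨b, hb, rfl⟩
        obtain ⟨t, ht, h⟩ := mem_codeMorphism.1 hb
        rw [← h, codeLetter, Set.mem_Ico]
        omega
      · rintro ⟨h1, h2⟩
        have ht : c - codeBase d i < imageLen d 0 i := by
          have := one_le_imageLen (d := d) 0 i
          omega
        have hc : codeLetter d i (c - codeBase d i) = c := by
          unfold codeLetter
          omega
        refine ⟨⟨c, ?_⟩, mem_codeMorphism.2 ⟨_, ht, hc⟩, rfl⟩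
        rw [← hc]
        exact codeLetter_lt (by omega) ht
    rw [hset, Set.ncard_eq_toFinset_card', Set.toFinset_Ico, Nat.card_Ico]
    omega
  · obtain ⟨t, ht, h⟩ := mem_codeMorphism.1 hb
    obtain ⟨t', ht', h'⟩ := mem_codeMorphism.1 hb'
    exact hij (Fin.ext (codeLetter_inj (by omega) (by omega) ht ht' (h.trans h'.symm)).1)

theorem exists_mem_codeMorphism (b : Fin (d + 2 ^ d)) : ∃ i, b ∈ codeMorphism d i := by
  obtain ⟨i, hi, t, ht, h⟩ := exists_codeLetter b.2
  exact ⟨⟨i, by omega⟩, mem_codeMorphism.2 ⟨t, ht, h⟩⟩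

theorem imagePos_codeMorphism (u : ℕ → Fin (2 * d + 1)) (m : ℕ) :
    imagePos (codeMorphism d) u m = prefixWeight d (fun p => (u p : ℕ)) 0 m := by
  induction m with
  | zero => rw [imagePos_zero, prefixWeight_zero]
  | succ m ih => rw [imagePos_succ, prefixWeight_succ, ih, length_codeMorphism]

theorem coded_of_isImage {u : ℕ → Fin (2 * d + 1)} {v : ℕ → Fin (d + 2 ^ d)}
    (h : IsImage (codeMorphism d) u v) :
    Coded d (fun p => (u p : ℕ)) (fun p => (v p : ℕ)) := by
  intro m t ht
  have h1 := h.apply m t (by rwa [length_codeMorphism])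
  rw [imagePos_codeMorphism, List.getElem?_eq_getElem (by rwa [length_codeMorphism])] at h1
  have h2 := Option.some_injective _ h1
  change (v (prefixWeight d (fun p => (u p : ℕ)) 0 m + t) : ℕ) = codeLetter d (u m) t
  rw [← h2]
  simp [codeMorphism]

theorem rich_of_val {n : ℕ} {v : ℕ → Fin n}
    (h : ∀ N, ∃ i ≤ N, IsPal (fun p => (v p : ℕ)) i (N + 1) ∧
      ∀ i' < i, ¬ Agree (fun p => (v p : ℕ)) i' i (N + 1 - i)) : Rich v := by
  refine rich_of_unioccurrent fun N => ?_
  obtain ⟨i, hi, h1, h2⟩ := h N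
  refine ⟨i, hi, fun t ht1 ht2 => Fin.ext ?_, fun i' hi' ha => h2 i' hi' fun t ht => ?_⟩
  · exact (h1 t ht1 (by omega)).trans (by simp only; congr 2)
  · exact congrArg Fin.val (ha t (by omega))

end CodeMorphism

/-! ### Exponents in terms of overlaps -/

section Exponents

variable {n : ℕ} {w : ℕ → Fin n}

theorem isPrefixOfPower_self {A : Type*} {z : List A} (hz : z ≠ []) : IsPrefixOfPower z z :=
  ⟨hz, fun i hi => by rw [Nat.mod_eq_of_lt hi]⟩

theorem rootLength_spec {i m : ℕ} (hm : 1 ≤ m) :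
    1 ≤ rootLength (block w i m) ∧ rootLength (block w i m) ≤ m ∧
      Agree (fun p => (w p : ℕ)) i (i + rootLength (block w i m))
        (m - rootLength (block w i m)) := by
  have hne : block w i m ≠ [] := by
    rw [← List.length_pos_iff, length_block]
    omega
  -- The word itself is a root, so the infimum is attained and is not the default value 0.
  have hmem : m ∈ {q : ℕ | ∃ x : List (Fin n), IsPrefixOfPower (block w i m) x ∧ x.length = q} :=
    ⟨_, isPrefixOfPower_self hne, length_block _ _ _⟩
  obtain ⟨x, ⟨hx1, hx2⟩, hx3⟩ := Nat.sInf_mem ⟨m, hmem⟩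
  have hle := Nat.sInf_le hmem
  change x.length = rootLength (block w i m) at hx3
  change rootLength (block w i m) ≤ m at hle
  have hpos := List.length_pos_iff.2 hx1
  generalize rootLength (block w i m) = q at *
  refine ⟨by omega, hle, fun t ht => ?_⟩
  have h1 := hx2 t (by rw [length_block]; omega)
  have h2 := hx2 (q + t) (by rw [length_block]; omega)
  rw [hx3, Nat.add_mod_left, ← hx3, ← h1, getElem?_block _ _ _ _ (by omega),
    getElem?_block _ _ _ _ (by omega)] at h2
  have h3 := Option.some_injective _ h2
  show (w (i + t) : ℕ) = w (i + q + t)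
  rw [← h3, add_assoc, hx3]

theorem exponent_eq_ofReal {z : List (Fin n)} (hz : 1 ≤ rootLength z) :
    exponent z = ENNReal.ofReal ((z.length : ℝ) / rootLength z) := by
  rw [exponent, ENNReal.ofReal_div_of_pos (by exact_mod_cast hz), ENNReal.ofReal_natCast,
    ENNReal.ofReal_natCast]

/-- A factor with root length q is a repetition with period q and overlap r = length - q. Periods
that are not minimal are harmless, since they only lower the quotient. -/
theorem expSup_le {N : ℕ} {B : ℝ} (h : ∀ i q r, 1 ≤ q → N ≤ q + r →
    Agree (fun p => (w p : ℕ)) i (i + q) r → (q + r : ℝ) ≤ B * q) :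
    expSup w N ≤ ENNReal.ofReal B := by
  refine iSup₂_le fun z hz => ?_
  obtain ⟨⟨j, hj⟩, hne, hN⟩ := hz
  have hlen := List.length_pos_iff.2 hne
  obtain ⟨h1, h2, h3⟩ := rootLength_spec (w := w) (i := j) (m := z.length) hlen
  rw [← hj] at h1 h2 h3
  rw [exponent_eq_ofReal h1]
  refine ENNReal.ofReal_le_ofReal ?_
  have h4 := h j (rootLength z) (z.length - rootLength z) h1 (by omega) h3
  have h5 : ((z.length - rootLength z : ℕ) : ℝ) = z.length - rootLength z := by
    rw [Nat.cast_sub h2]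
  rw [h5] at h4
  rw [div_le_iff₀ (by exact_mod_cast h1)]
  linarith

theorem le_expSup {N i q r : ℕ} (hq : 1 ≤ q) (hN : N ≤ q + r)
    (ha : Agree (fun p => (w p : ℕ)) i (i + q) r) :
    ENNReal.ofReal ((q + r : ℝ) / q) ≤ expSup w N := by
  set z := block w i (q + r) with hz
  have hzl : z.length = q + r := length_block _ _ _
  have hzne : z ≠ [] := by
    rw [← List.length_pos_iff]
    omega
  have hper : ∀ t < q + r, w (i + t) = w (i + t % q) := by
    intro t
    induction t using Nat.strong_induction_on with
    | _ t ih =>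
    intro ht
    rcases Nat.lt_or_ge t q with h | h
    · rw [Nat.mod_eq_of_lt h]
    · have h1 := ha (t - q) (by omega)
      have h2 := ih (t - q) (by omega) (by omega)
      simp only at h1
      rw [show i + q + (t - q) = i + t by omega] at h1
      rw [Nat.mod_eq_sub_mod h, ← h2]
      exact Fin.ext h1.symm
  have hroot : rootLength z ≤ q := by
    refine Nat.sInf_le ⟨block w i q, ⟨?_, fun t ht => ?_⟩, length_block _ _ _⟩
    · rw [← List.length_pos_iff, length_block]
      omega
    · rw [hzl] at ht
      rw [length_block, hz, getElem?_block _ _ _ _ ht,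
        getElem?_block _ _ _ _ (Nat.mod_lt _ (by omega)), hper t ht]
  have h1 := (rootLength_spec (w := w) (i := i) (m := q + r) (by omega)).1
  refine le_trans ?_ (le_iSup₂ (f := fun (z : List (Fin n))
    (_ : IsFactor z w ∧ z ≠ [] ∧ N ≤ z.length) => exponent z) z ⟨⟨i, by rw [hzl]⟩, hzne, by omega⟩)
  rw [exponent_eq_ofReal h1, hzl]
  refine ENNReal.ofReal_le_ofReal ?_
  push_cast
  have h2 : (rootLength z : ℝ) ≤ q := by exact_mod_cast hroot
  have h3 : (0 : ℝ) < rootLength z := by exact_mod_cast h1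
  exact div_le_div_of_nonneg_left (by positivity) h3 h2

end Exponents

/-! ### The two critical exponents -/

namespace Subst

variable {d : ℕ} {U s V : ℕ → ℕ} (S : Subst (2 * d) U s) {x : ℝ}

theorem coded_agree (hV : Coded d U V) {i j r : ℕ} (ha : Agree U i j r) :
    Agree V (prefixWeight d U 0 i) (prefixWeight d U 0 j)
      (prefixWeight d U 0 (i + r) - prefixWeight d U 0 i) := by
  have hmono := prefixWeight_strictMono d U
  intro y hy
  obtain ⟨k, t, hk, ht⟩ := exists_code_pos d U (prefixWeight d U 0 i + y)
  have h1 : i ≤ k := by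
    have := hmono.lt_iff_lt.1 (show prefixWeight d U 0 i < prefixWeight d U 0 (k + 1) by
      rw [prefixWeight_succ]; omega)
    omega
  have h2 : k < i + r := hmono.lt_iff_lt.1 (by omega)
  obtain ⟨c, rfl⟩ := Nat.exists_eq_add_of_le h1
  have h3 := ha.prefixWeight (d := d) 0 (show c ≤ r by omega)
  have h4 := ha c (by omega)
  rw [hk, show prefixWeight d U 0 j + y = prefixWeight d U 0 (j + c) + t by omega, hV _ _ ht,
    hV _ _ (by rwa [← h4]), h4]

include S

theorem exists_large_repetition (hd : 3 ≤ d) (hx : 2 < x) (hroot : x ^ d * (x - 2) = 1) {ε : ℝ}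
    (hε : 0 < ε) (M : ℕ) : ∃ i q r, M ≤ q ∧ 1 ≤ q ∧ Agree U i (i + q) r ∧
      0 < (prefixWeight d U 0 (i + q) : ℝ) - prefixWeight d U 0 i ∧
      (1 + (1 - ε) / (3 - x)) * ((prefixWeight d U 0 (i + q) : ℝ) - prefixWeight d U 0 i) ≤
        prefixWeight d U 0 (i + q + r) - prefixWeight d U 0 i := by
  have hx3 : 0 < 3 - x := by
    have := root_sub_two_le hx hroot hd
    linarith
  -- A letter weighs at most 2^d, so a period of weight at least 2^d M has at least M letters.
  obtain ⟨n, hn, hE⟩ := exists_excess_ge hx hroot hd hε (2 ^ d * M)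
  obtain ⟨i, j, r, -, hij, ha, -, -, -, -, hw⟩ := S.exists_long_repetition (by omega) n
  obtain ⟨h1, h2⟩ := hw 0
  rw [prefixSum_zero, zero_add, extLen_of_lt d (Nat.mod_lt n (by omega))] at h2
  simp only [add_zero, mul_zero] at h1 h2
  obtain ⟨q, rfl⟩ := Nat.exists_eq_add_of_le hij.le
  have h3 := (S.prefixWeight_add_le i q).2
  have h4 := two_pow_le_zeroLen d (n + d)
  have h5 : n + d < 2 ^ (n + d) := Nat.lt_two_pow_self
  have hMq : M ≤ q := by
    have : 2 ^ d * M ≤ 2 ^ d * q := by omega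
    exact Nat.le_of_mul_le_mul_left this (by positivity)
  refine ⟨i, q, r, hMq, by omega, ha, ?_, ?_⟩
  · have := one_le_zeroLen d (n + d)
    rw [h1, Nat.cast_add, add_sub_cancel_left]
    exact_mod_cast this
  · have h6 := ha.prefixWeight (d := d) 0 le_rfl
    have h7 : (prefixWeight d U 0 (i + q) : ℝ) = prefixWeight d U 0 i + zeroLen d (n + d) := by
      exact_mod_cast h1
    have h8 : (prefixWeight d U 0 (i + q + r) : ℝ) - prefixWeight d U 0 i =
        2 * zeroLen d (n + d) + excess d n := by
      have : prefixWeight d U 0 (i + q + r) =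
          prefixWeight d U 0 i + (2 * zeroLen d (n + d) + excess d n) := by omega
      rw [this]
      push_cast
      ring
    rw [h8, h7, add_sub_cancel_left]
    -- The identity behind the constant is 1 + (x - 2 - ε)/(3 - x) = (1 - ε)/(3 - x).
    have h9 : (1 - ε) / (3 - x) * zeroLen d (n + d) ≤ zeroLen d (n + d) + excess d n := by
      rw [div_mul_eq_mul_div, div_le_iff₀ hx3]
      linarith
    linarith

end Subst

section CriticalExponents

variable {d : ℕ} {u : ℕ → Fin (2 * d + 1)} {s : ℕ → ℕ} {x : ℝ}

open Filter Topology

theorem critExp_coded_le (S : Subst (2 * d) (fun p => (u p : ℕ)) s) {v : ℕ → Fin (d + 2 ^ d)}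
    (hV : Coded d (fun p => (u p : ℕ)) (fun p => (v p : ℕ))) (hd : 3 ≤ d) (hx : 2 < x)
    (hroot : x ^ d * (x - 2) = 1) : critExp v ≤ ENNReal.ofReal (1 + 1 / (3 - x)) := by
  have hx3 : 0 < 3 - x := by
    have := root_sub_two_le hx hroot hd
    linarith
  refine expSup_le fun i q r hq _ ha => ?_
  have h1 := S.coded_repetition_bound hV hd hx hroot (show i < i + q by omega) ha
  push_cast at h1
  have h2 : (r : ℝ) ≤ 1 / (3 - x) * q := by
    rw [div_mul_eq_mul_div, one_mul, le_div_iff₀ hx3]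
    linarith
  linarith

theorem le_critExp_coded (S : Subst (2 * d) (fun p => (u p : ℕ)) s) {v : ℕ → Fin (d + 2 ^ d)}
    (hV : Coded d (fun p => (u p : ℕ)) (fun p => (v p : ℕ))) (hd : 3 ≤ d) (hx : 2 < x)
    (hroot : x ^ d * (x - 2) = 1) : ENNReal.ofReal (1 + 1 / (3 - x)) ≤ critExp v := by
  have hlim : Tendsto (fun ε : ℝ => ENNReal.ofReal (1 + (1 - ε) / (3 - x))) (𝓝[>] 0)
      (𝓝 (ENNReal.ofReal (1 + 1 / (3 - x)))) := by
    refine ENNReal.tendsto_ofReal (Tendsto.mono_left ?_ nhdsWithin_le_nhds)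
    have : Continuous fun ε : ℝ => 1 + (1 - ε) / (3 - x) := by fun_prop
    simpa using this.tendsto 0
  refine le_of_tendsto hlim (eventually_nhdsWithin_of_forall fun ε hε => ?_)
  obtain ⟨i, q, r, -, hq, ha, h0, h1⟩ := S.exists_large_repetition hd hx hroot hε 0
  have ha' := Subst.coded_agree hV ha
  have hmono := prefixWeight_strictMono d fun p => (u p : ℕ)
  have h2 := hmono (show i < i + q by omega)
  have h3 := hmono.monotone (show i ≤ i + r by omega)
  have h4 := ha.prefixWeight (d := d) 0 le_rfl
  rw [show prefixWeight d (fun p => (u p : ℕ)) 0 (i + q) = prefixWeight d (fun p => (u p : ℕ)) 0 i +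
    (prefixWeight d (fun p => (u p : ℕ)) 0 (i + q) - prefixWeight d (fun p => (u p : ℕ)) 0 i) by
    omega] at ha'
  refine le_trans (ENNReal.ofReal_le_ofReal ?_) (le_expSup (N := 0) (by omega) (by omega) ha')
  rw [Nat.cast_sub h2.le, Nat.cast_sub h3, le_div_iff₀ h0]
  have h5 : (prefixWeight d (fun p => (u p : ℕ)) 0 (i + r) : ℝ) +
      prefixWeight d (fun p => (u p : ℕ)) 0 (i + q) =
      prefixWeight d (fun p => (u p : ℕ)) 0 (i + q + r) +
      prefixWeight d (fun p => (u p : ℕ)) 0 i := by exact_mod_cast h4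
  linarith

theorem asympCritExp_le (S : Subst (2 * d) (fun p => (u p : ℕ)) s) (hd : 3 ≤ d) (hx : 2 < x)
    (hroot : x ^ d * (x - 2) = 1) : asympCritExp u ≤ ENNReal.ofReal (1 + 1 / (3 - x)) := by
  have hx3 : 1 / 2 ≤ 3 - x := by
    have := root_sub_two_le hx hroot hd
    linarith
  have hlim : Tendsto (fun ε : ℝ => ENNReal.ofReal ((1 + ε) * (1 + 1 / (3 - x)))) (𝓝[>] 0)
      (𝓝 (ENNReal.ofReal (1 + 1 / (3 - x)))) := by
    refine ENNReal.tendsto_ofReal (Tendsto.mono_left ?_ nhdsWithin_le_nhds)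
    have : Continuous fun ε : ℝ => (1 + ε) * (1 + 1 / (3 - x)) := by fun_prop
    simpa using this.tendsto 0
  have hev : ∀ᶠ ε : ℝ in 𝓝[>] 0, 0 < ε ∧ ε ≤ 1 :=
    Filter.eventually_of_mem (Ioc_mem_nhdsGT (by norm_num : (0 : ℝ) < 1)) fun ε h => h
  refine ge_of_tendsto hlim (hev.mono fun ε ⟨hε, hε1⟩ => ?_)
  obtain ⟨m, hm, N, hN⟩ := S.exists_uniform_ratio hε hε1
  -- As 3 - x ≥ 1/2 and letters weigh between 1 and 2^d, the overlap has at most 2^(d+1) q letters.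
  -- This length therefore forces a period q ≥ N, long enough for comparing lengths with weights.
  refine (iInf_le _ ((2 ^ (d + 1) + 1) * N + 1)).trans (expSup_le fun i q r hq hqr ha => ?_)
  have h1 := S.repetition_bound hd hx hroot 0 (show i < i + q by omega) ha
  have h2 := (S.prefixWeight_add_le i r).1
  have h3 := (S.prefixWeight_add_le i q).2
  have h4 := ha.prefixWeight (d := d) 0 le_rfl
  have h4' : (prefixWeight d (fun p => (u p : ℕ)) 0 (i + r) : ℝ) +
      prefixWeight d (fun p => (u p : ℕ)) 0 (i + q) =
      prefixWeight d (fun p => (u p : ℕ)) 0 (i + q + r) +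
      prefixWeight d (fun p => (u p : ℕ)) 0 i := by exact_mod_cast h4
  have h2' : (prefixWeight d (fun p => (u p : ℕ)) 0 i : ℝ) + r ≤
    prefixWeight d (fun p => (u p : ℕ)) 0 (i + r) := by exact_mod_cast h2
  have h3' : (prefixWeight d (fun p => (u p : ℕ)) 0 (i + q) : ℝ) ≤
    prefixWeight d (fun p => (u p : ℕ)) 0 i + 2 ^ d * q := by exact_mod_cast h3
  have hqN : N ≤ q := by
    by_contra hlt
    have h5 : (r : ℝ) ≤ 2 ^ (d + 1) * q := by
      have hr0 : (0 : ℝ) ≤ r := by positivity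
      rw [pow_succ]
      nlinarith
    have h6 : r ≤ 2 ^ (d + 1) * q := by exact_mod_cast h5
    have h7 : 2 ^ (d + 1) * q ≤ 2 ^ (d + 1) * N := Nat.mul_le_mul_left _ (by omega)
    rw [add_mul, one_mul] at hqr
    omega
  have h5 := (hN i q hqN).1
  have h6 := (hN i (q + r) (by omega)).2
  rw [← add_assoc] at h6
  push_cast at h6
  set P := prefixWeight d (fun p => (u p : ℕ)) 0
  have h7 : (P (i + r) : ℝ) - P i ≤ 1 / (3 - x) * (P (i + q) - P i) := by
    rw [div_mul_eq_mul_div, one_mul, le_div_iff₀ (by linarith)]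
    linarith
  calc (q + r : ℝ) ≤ m * (1 + ε) * (P (i + q + r) - P i) := h6
    _ ≤ m * (1 + ε) * ((1 + 1 / (3 - x)) * (P (i + q) - P i)) := by
      refine mul_le_mul_of_nonneg_left ?_ (by positivity)
      linarith
    _ = (1 + ε) * (1 + 1 / (3 - x)) * (m * (P (i + q) - P i)) := by ring
    _ ≤ (1 + ε) * (1 + 1 / (3 - x)) * q := by
      refine mul_le_mul_of_nonneg_left h5 ?_
      have : 0 < 1 / (3 - x) := by
        rw [one_div_pos]
        linarith
      positivity

theorem le_asympCritExp (S : Subst (2 * d) (fun p => (u p : ℕ)) s) (hd : 3 ≤ d) (hx : 2 < x)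
    (hroot : x ^ d * (x - 2) = 1) : ENNReal.ofReal (1 + 1 / (3 - x)) ≤ asympCritExp u := by
  have hx3 : 0 < 3 - x := by
    have := root_sub_two_le hx hroot hd
    linarith
  refine le_iInf fun M => ?_
  have hlim : Tendsto (fun ε : ℝ => ENNReal.ofReal ((1 + (1 - ε) / (3 - x)) / (1 + ε))) (𝓝[>] 0)
      (𝓝 (ENNReal.ofReal (1 + 1 / (3 - x)))) := by
    refine ENNReal.tendsto_ofReal (Tendsto.mono_left ?_ nhdsWithin_le_nhds)
    have : ContinuousAt (fun ε : ℝ => (1 + (1 - ε) / (3 - x)) / (1 + ε)) 0 := by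
      refine ContinuousAt.div (by fun_prop) (by fun_prop) (by norm_num)
    simpa using this.tendsto
  have hev : ∀ᶠ ε : ℝ in 𝓝[>] 0, 0 < ε ∧ ε ≤ 1 :=
    Filter.eventually_of_mem (Ioc_mem_nhdsGT (by norm_num : (0 : ℝ) < 1)) fun ε h => h
  refine le_of_tendsto hlim (hev.mono fun ε ⟨hε, hε1⟩ => ?_)
  obtain ⟨m, hm, N, hN⟩ := S.exists_uniform_ratio hε hε1
  obtain ⟨i, q, r, hMq, hq, ha, h0, h1⟩ := S.exists_large_repetition hd hx hroot hε (max M N)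
  refine le_trans (ENNReal.ofReal_le_ofReal ?_) (le_expSup (N := M) hq (by omega) ha)
  have h5 := (hN i q (by omega)).2
  have h6 := (hN i (q + r) (by omega)).1
  rw [← add_assoc] at h6
  push_cast at h6
  set P := prefixWeight d (fun p => (u p : ℕ)) 0
  have hq0 : (0 : ℝ) < q := by exact_mod_cast hq
  have hA : 0 ≤ 1 + (1 - ε) / (3 - x) := by
    have : 0 ≤ (1 - ε) / (3 - x) := div_nonneg (by linarith) hx3.le
    linarith
  rw [div_le_div_iff₀ (by linarith) hq0]
  calc (1 + (1 - ε) / (3 - x)) * q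
      ≤ (1 + (1 - ε) / (3 - x)) * (m * (1 + ε) * (P (i + q) - P i)) :=
        mul_le_mul_of_nonneg_left h5 hA
    _ = m * (1 + ε) * ((1 + (1 - ε) / (3 - x)) * (P (i + q) - P i)) := by ring
    _ ≤ m * (1 + ε) * (P (i + q + r) - P i) :=
        mul_le_mul_of_nonneg_left h1 (by positivity)
    _ = m * (P (i + q + r) - P i) * (1 + ε) := by ring
    _ ≤ (q + r) * (1 + ε) := mul_le_mul_of_nonneg_right h6 (by linarith)

end CriticalExponents

end RichSeq

open RichSeq Polynomial in
theorem theorem1 (d : ℕ) (hd : 3 ≤ d) :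
    ∃ u : ℕ → Fin (2 * d + 1),
      (IsFixedPoint (phi (2 * d + 1)) u ∧
        ∀ u' : ℕ → Fin (2 * d + 1), IsFixedPoint (phi (2 * d + 1)) u' → u' = u) ∧
      ∃ Λ : ℝ, (2 < Λ ∧ Λ < 3 ∧
        IsDominantRoot ((X ^ (2 * d) * (X - 2) ^ 2 - 1 : ℂ[X])) (Λ : ℂ)) ∧
      ∃ π : Fin (2 * d + 1) → List (Fin (d + 2 ^ d)),
        IsWeighted d π ∧ (∀ b, ∃ i, b ∈ π i) ∧
        ∃ v : ℕ → Fin (d + 2 ^ d), IsImage π u v ∧ Rich v ∧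
          critExp v = asympCritExp u ∧
          asympCritExp u = ENNReal.ofReal (1 + 1 / (3 - Λ)) := by
  obtain ⟨u, hu⟩ := exists_fixedPoint (2 * d + 1)
  obtain ⟨x, hx, hx3, hroot⟩ := exists_root (show 1 ≤ d by omega)
  have : Inhabited (Fin (d + 2 ^ d)) := ⟨⟨0, by positivity⟩⟩
  obtain ⟨v, hv⟩ := exists_image u (codeMorphism_ne_nil (d := d))
  have S := subst_of_fixedPoint (show 2 ≤ 2 * d by omega) hu
  have hV := coded_of_isImage hv
  have hE : asympCritExp u = ENNReal.ofReal (1 + 1 / (3 - x)) :=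
    le_antisymm (asympCritExp_le S hd hx hroot) (le_asympCritExp S hd hx hroot)
  refine ⟨u, ⟨hu, fun u' hu' => fixedPoint_unique _ hu hu'⟩, x,
    ⟨hx, hx3, isDominantRoot_of_root hx hroot⟩, codeMorphism d, isWeighted_codeMorphism,
    exists_mem_codeMorphism, v, hv, rich_of_val (S.coded_exists_unioccurrent hV hd), ?_, hE⟩
  rw [hE]
  exact le_antisymm (critExp_coded_le S hV hd hx hroot) (le_critExp_coded S hV hd hx hroot)
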